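/- Fix $0<\beta<\tfrac12$ and $k\in\mathbb N$. Let $C^+_\beta$ be the set of continuous nondecreasing maps $g:[0,1]\to[0,1]$ with $g(0)=0$, $g(1)=1$ that are continuously differentiable on $[0,\beta]$ and on $[1-\beta,1]$ (one-sidedly at the end points). Let $\mathcal F_0$ be the set of pairs $(\Gamma,p)$, where $\Gamma=(g_1,\dots,g_k)$ is a $k$-tuple of homeomorphisms of $[0,1]$ belonging to $C^+_\beta$ and $p=(p_1,\dots,p_k)$ is a probability vector, with the metric \[ d\big((\Gamma,p),(\Delta,q)\big)=\sum_{i=1}^k\Big(|p_i-q_i|+\|g_i-h_i\|_\infty+\|g_i^{-1}-h_i^{-1}\|_\infty+\sup_{[0,\beta]\cup[1-\beta,1]}|g_i'-h_i'|\Big), \] where $\Delta=(h_1,\dots,h_k)$ and $q=(q_1,\dots,q_k)$. Let $\mathcal F\subset\mathcal F_0$ be the set of those $(\Gamma,p)$ such that 1. all $p_i>0$; 2. for every $x\in(0,1)$ there are $i,j$ with $g_i(x)<x<g_j(x)$; 3. $g_i'(0)>0$ and $g_i'(1)>0$ for all $i$, $\sum_{i} p_i\log g_i'(0)>0$ and $\sum_{i}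 p_i\log g_i'(1)>0$; 4. every $g_i$ is absolutely continuous. For $n\ge1$ let $\mathcal F_n$ be the set of all $(\Gamma,p)\in\mathcal F$ that have an invariant Borel probability measure $\mu$ on $[0,1]$ (that is, $\mu=\sum_i p_i\,\mu\circ g_i^{-1}$) such that $\mu((0,1))=1$ and there is a Borel set $A\subset[0,1]$ of Lebesgue measure $m(A)<\tfrac1n$ with $\mu(A)>1-\tfrac1{2n}$. Then for every integer $n\ge1$ the set $\mathcal F_n$ is dense in the metric space $(\mathcal F,d)$. -/

import Mathlib

open MeasureTheory Set unitInterval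

noncomputable section

namespace IntervalIFS

/-- A self-map of `[0,1]` viewed as a function on the real line (constant to the left of `0`
and to the right of `1`). Only its behaviour on `[0,1]` is ever used. -/
def ext (g : I → I) : ℝ → ℝ := fun x => (g (projIcc 0 1 zero_le_one x) : ℝ)

/-- The space `C⁺_β` of continuous nondecreasing maps of `[0,1]` that fix `0` and `1` and are
continuously differentiable (one-sidedly at end points) on `[0,β]` and on `[1-β,1]`. -/
def CPlus (β : ℝ) : Set C(I, I) :=
  {g | Monotone g ∧ g 0 = 0 ∧ g 1 = 1 ∧
    ContDiffOn ℝ 1 (ext g) (Icc 0 β) ∧ ContDiffOn ℝ 1 (ext g) (Icc (1 - β) 1)}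

/-- The set `[0,β] ∪ [1-β,1]`. -/
def endSet (β : ℝ) : Set ℝ := Icc 0 β ∪ Icc (1 - β) 1

/-- The derivative of `g` on `[0,β] ∪ [1-β,1]`, one-sided at `0`, `β`, `1-β` and `1`. -/
def endDeriv (β : ℝ) (g : I → I) (x : ℝ) : ℝ := derivWithin (ext g) (endSet β) x

/-- The space `𝓕₀` for the parameter `β ∈ (0,1/2)`: `k` homeomorphisms from `C⁺_β` together with
a probability vector. -/
structure IFS (β : Ioo (0 : ℝ) (1 / 2)) (k : ℕ) where
  /-- The homeomorphisms `g₁, …, g_k`. -/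
  map : Fin k → I ≃ₜ I
  /-- The probabilities `p₁, …, p_k`. -/
  prob : Fin k → ℝ
  map_mem : ∀ i, (map i : C(I, I)) ∈ CPlus β
  prob_mem : prob ∈ stdSimplex ℝ (Fin k)

namespace IFS

variable {β : Ioo (0 : ℝ) (1 / 2)} {k : ℕ}

/-- The metric on `𝓕₀`:
`∑ᵢ (|pᵢ - qᵢ| + ‖gᵢ - hᵢ‖ + ‖gᵢ⁻¹ - hᵢ⁻¹‖ + sup_{[0,β]∪[1-β,1]} |gᵢ' - hᵢ'|)`;
the distance of `C(I, I)` is the supremum distance. -/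
def d (S T : IFS β k) : ℝ :=
  ∑ i, (|S.prob i - T.prob i|
    + dist (S.map i : C(I, I)) (T.map i : C(I, I))
    + dist ((S.map i).symm : C(I, I)) ((T.map i).symm : C(I, I))
    + ⨆ x : endSet β, |endDeriv β (S.map i) x - endDeriv β (T.map i) x|)

theorem continuousOn_endDeriv (S : IFS β k) (i : Fin k) :
    ContinuousOn (endDeriv β (S.map i)) (endSet β) := by
  obtain ⟨-, -, -, h0, h1⟩ := S.map_mem i
  obtain ⟨b, hb0, hb1⟩ := β
  simp only at h0 h1 ⊢
  have hu : UniqueDiffOn ℝ (endSet b) := by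
    intro x hx
    rcases hx with hx | hx
    · exact (uniqueDiffOn_Icc hb0 x hx).mono subset_union_left
    · exact (uniqueDiffOn_Icc (by linarith) x hx).mono subset_union_right
  have hc : ContDiffOn ℝ 1 (ext (S.map i)) (endSet b) := by
    intro x hx
    rcases hx with hx | hx
    · refine (h0 x hx).mono_of_mem_nhdsWithin ?_
      rw [mem_nhdsWithin]
      refine ⟨Iio (1 - b), isOpen_Iio, ?_, ?_⟩
      · have := hx.2
        simp only [mem_Iio]
        linarith
      · rintro y ⟨hy, hy' | hy'⟩
        · exact hy'
        · exact absurd hy (not_lt.2 hy'.1)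
    · refine (h1 x hx).mono_of_mem_nhdsWithin ?_
      rw [mem_nhdsWithin]
      refine ⟨Ioi b, isOpen_Ioi, ?_, ?_⟩
      · have := hx.1
        simp only [mem_Ioi]
        linarith
      · rintro y ⟨hy, hy' | hy'⟩
        · exact absurd hy (not_lt.2 hy'.2)
        · exact hy'
  exact hc.continuousOn_derivWithin hu le_rfl

theorem bddAbove_endDeriv (S T : IFS β k) (i : Fin k) :
    BddAbove (range fun x : endSet β =>
      |endDeriv β (S.map i) x - endDeriv β (T.map i) x|) := by
  have hK : IsCompact (endSet (β : ℝ)) := isCompact_Icc.union isCompact_Icc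
  have h := hK.bddAbove_image
    ((S.continuousOn_endDeriv i).sub (T.continuousOn_endDeriv i)).abs
  rwa [image_eq_range] at h

theorem d_triangle (S T U : IFS β k) : d S U ≤ d S T + d T U := by
  unfold d
  rw [← Finset.sum_add_distrib]
  refine Finset.sum_le_sum fun i _ => ?_
  have h1 := abs_sub_le (S.prob i) (T.prob i) (U.prob i)
  have h2 := dist_triangle (S.map i : C(I, I)) (T.map i : C(I, I)) (U.map i : C(I, I))
  have h3 := dist_triangle ((S.map i).symm : C(I, I)) ((T.map i).symm : C(I, I))
    ((U.map i).symm : C(I, I))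
  have : Nonempty (endSet (β : ℝ)) := ⟨⟨0, Or.inl ⟨le_rfl, β.2.1.le⟩⟩⟩
  have h4 : (⨆ x : endSet (β : ℝ), |endDeriv β (S.map i) x - endDeriv β (U.map i) x|) ≤
      (⨆ x : endSet (β : ℝ), |endDeriv β (S.map i) x - endDeriv β (T.map i) x|) +
      ⨆ x : endSet (β : ℝ), |endDeriv β (T.map i) x - endDeriv β (U.map i) x| :=
    ciSup_le fun x => (abs_sub_le _ (endDeriv β (T.map i) x) _).trans
      (add_le_add (le_ciSup (bddAbove_endDeriv S T i) x) (le_ciSup (bddAbove_endDeriv T U i) x))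
  linarith

theorem eq_of_d_eq_zero {S T : IFS β k} (h : d S T = 0) : S = T := by
  have hs (i : Fin k) : 0 ≤ ⨆ x : endSet (β : ℝ),
      |endDeriv β (S.map i) x - endDeriv β (T.map i) x| :=
    Real.iSup_nonneg fun _ => abs_nonneg _
  have hd1 (i : Fin k) : 0 ≤ dist (S.map i : C(I, I)) (T.map i : C(I, I)) := dist_nonneg
  have hd2 (i : Fin k) : 0 ≤ dist ((S.map i).symm : C(I, I)) ((T.map i).symm : C(I, I)) :=
    dist_nonneg
  have h0 := (Finset.sum_eq_zero_iff_of_nonneg (fun i _ => by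
    have := abs_nonneg (S.prob i - T.prob i)
    linarith [hs i, hd1 i, hd2 i])).1 h
  have hp : S.prob = T.prob := by
    funext i
    have := h0 i (Finset.mem_univ i)
    have h' := abs_nonneg (S.prob i - T.prob i)
    exact sub_eq_zero.1 (abs_eq_zero.1 (by linarith [hs i, hd1 i, hd2 i]))
  have hm : S.map = T.map := by
    funext i
    have := h0 i (Finset.mem_univ i)
    have h' := abs_nonneg (S.prob i - T.prob i)
    have h1 : dist (S.map i : C(I, I)) (T.map i : C(I, I)) = 0 := by
      linarith [hs i, hd1 i, hd2 i]
    exact Homeomorph.ext fun x => DFunLike.congr_fun (dist_eq_zero.1 h1) x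
  cases S
  cases T
  simp_all

instance : MetricSpace (IFS β k) where
  dist := d
  dist_self S := by simp [d]
  dist_comm S T := by simp only [d, abs_sub_comm, dist_comm]
  dist_triangle := d_triangle
  eq_of_dist_eq_zero := eq_of_d_eq_zero

/-- Admissible iterated function systems. The strict positivity of the derivatives at the common
fixed points is what the finiteness of the logarithms in the Lyapunov exponents requires
(with `log 0 = -∞`, a vanishing derivative would make the exponent equal to `-∞`). -/
structure IsAdmissible (S : IFS β k) : Prop where
  prob_pos : ∀ i, 0 < S.prob i
  exists_lt_lt : ∀ x ∈ Ioo (0 : I) 1, ∃ i j, S.map i x < x ∧ x < S.map j x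
  deriv_zero_pos : ∀ i, 0 < endDeriv β (S.map i) 0
  deriv_one_pos : ∀ i, 0 < endDeriv β (S.map i) 1
  lyapunov_zero_pos : 0 < ∑ i, S.prob i * Real.log (endDeriv β (S.map i) 0)
  lyapunov_one_pos : 0 < ∑ i, S.prob i * Real.log (endDeriv β (S.map i) 1)

/-- The Markov operator `P μ = ∑ᵢ pᵢ gᵢ μ`. -/
def markov (S : IFS β k) (μ : Measure I) : Measure I :=
  ∑ i, ENNReal.ofReal (S.prob i) • μ.map (S.map i)

end IFS

/-- The space `𝓕` of admissible systems all of whose maps are absolutely continuous. -/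
def admissibleAC (β : Ioo (0 : ℝ) (1 / 2)) (k : ℕ) : Set (IFS β k) :=
  {S | S.IsAdmissible ∧ ∀ i, AbsolutelyContinuousOnInterval (ext (S.map i)) 0 1}

/-- Borel probability measures `μ` on `[0,1]` with `μ((0,1)) = 1`. -/
def probOpen : Set (Measure I) := {μ | IsProbabilityMeasure μ ∧ μ (Ioo 0 1) = 1}

/-- Borel probability measures `μ` on `[0,1]` for which there is a Borel set `A` of Lebesgue
measure less than `ε` with `μ(A) > 1 - ε/2`. -/
def almostSingular (ε : ℝ) : Set (Measure I) :=
  {μ | IsProbabilityMeasure μ ∧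
    ∃ A : Set I, MeasurableSet A ∧ (volume : Measure I).real A < ε ∧ 1 - ε / 2 < μ.real A}

/-- The set `𝓕ₙ` of systems in `𝓕` with an invariant measure in `𝓜₁(0,1) ∩ 𝓜₁^{1/n}`. -/
def Fn (β : Ioo (0 : ℝ) (1 / 2)) (k n : ℕ) : Set (IFS β k) :=
  {S | S ∈ admissibleAC β k ∧
    ∃ μ ∈ probOpen ∩ almostSingular (1 / (n : ℝ)), S.markov μ = μ}

end IntervalIFS

end

open MeasureTheory Set unitInterval Filter Topology
noncomputable section
namespace IntervalIFS

/-! ### Absolutely continuous functions and monotone Lipschitz changes of variable -/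

/-! The metric sees derivatives only on the two end intervals; elsewhere it sees uniform distance.
So conjugating a system by a C¹ diffeomorphism Ψ that is uniformly close to the identity moves it
little, provided Ψ'(g x) / Ψ'(x) is close to 1 for the branches g near the ends. Conjugation carries
an invariant μ to its image under Ψ, and this image charges a Lebesgue-small set as soon as Ψ' is
tiny on a set of almost full μ-measure. What is needed is a density that is nearly invariant under
the branches near the ends, tiny on most of μ, and equidistributed at a fine scale.

Such a density exists if the branches near the ends are locally multiplications by powers of one
number r = 1 + 1/q, up to translations that are integers at the relevant scales. Let χ be a tent on
a narrow arc of the circle and w(x) = δ + ∑_{|m| ≤ N} ρ^|m| χ(r^m M x). Multiplying x by r^j shifts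
the index m; for |j| ≤ J and ρ near 1 this changes w by a factor near 1, the truncation error being
absorbed by δ (`weight_le_of_compatible`). A large M makes the primitive of w nearly linear. Among L
disjoint arcs, one is visited by the phases r^m M x only on a set of μ-measure at most (2N+1)/L
(`exists_arc`); elsewhere w = δ, which is small against the integral of w. This gives
`exists_concentrating_homeomorph`.

The branches near the ends are first replaced by primitives of smoothed step functions with slopes
r^j (`exists_compatible_primitive`). Smoothing is harmless: near the break points all phases are
close to integers, where no arc lies. The new system stays admissible (`exists_compatible_system`),
and every admissible system has an invariant measure on the open interval
(`IsAdmissible.exists_invariant`).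

The order of choices matters: q and J first, then ρ, N, L, δ, then the frequency, then the
approximating system, then its measure μ, and the arc last. Hence `Compatible` mentions no arc. -/

open AbsolutelyContinuousOnInterval in
theorem absolutelyContinuousOnInterval_comp_monotoneOn {f φ : ℝ → ℝ} {a b : ℝ} (hab : a ≤ b)
    (hf : AbsolutelyContinuousOnInterval f a b) {K : NNReal} (hK : LipschitzOnWith K φ (Icc a b))
    (hm : MonotoneOn φ (Icc a b)) (hmaps : MapsTo φ (Icc a b) (Icc a b)) :
    AbsolutelyContinuousOnInterval (f ∘ φ) a b := by
  rw [absolutelyContinuousOnInterval_iff] at hf ⊢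
  intro ε hε
  obtain ⟨δ, hδ, h⟩ := hf ε hε
  -- Monotonicity keeps the image intervals disjoint and the Lipschitz bound controls their total
  -- length, so the δ of `f` applies to them; K + 1 because K may vanish.
  refine ⟨δ / (K + 1), by positivity, fun E hE hs => ?_⟩
  simp only [disjWithin, uIcc_of_le hab, mem_ofPred_eq] at hE h
  refine h (E.1, fun i => (φ (E.2 i).1, φ (E.2 i).2)) ⟨fun i hi => ?_, ?_⟩ ?_
  · exact ⟨hmaps (hE.1 i hi).1, hmaps (hE.1 i hi).2⟩
  · intro i hi j hj hij
    have hd := hE.2 hi hj hij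
    obtain ⟨hi1, hi2⟩ := hE.1 i hi
    obtain ⟨hj1, hj2⟩ := hE.1 j hj
    simp only [Function.onFun, uIoc, Ioc_disjoint_Ioc] at hd ⊢
    -- The intervals are given by unordered pairs of end points, hence the split over orientations.
    rcases le_total (E.2 i).1 (E.2 i).2 with h1 | h1 <;>
    rcases le_total (E.2 j).1 (E.2 j).2 with h2 | h2 <;>
    [have e1 := hm hi1 hi2 h1; have e1 := hm hi1 hi2 h1; have e1 := hm hi2 hi1 h1;
      have e1 := hm hi2 hi1 h1] <;>
    [have e2 := hm hj1 hj2 h2; have e2 := hm hj2 hj1 h2; have e2 := hm hj1 hj2 h2;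
      have e2 := hm hj2 hj1 h2] <;>
    simp only [min_eq_left, min_eq_right, max_eq_left, max_eq_right, h1, h2, e1, e2, le_max_iff,
      min_le_iff] at hd ⊢ <;>
    rcases hd with (hd | hd) | (hd | hd)
    all_goals first
      | exact Or.inl (Or.inl (hm ‹_› ‹_› hd)) | exact Or.inl (Or.inr (hm ‹_› ‹_› hd))
      | exact Or.inr (Or.inl (hm ‹_› ‹_› hd)) | exact Or.inr (Or.inr (hm ‹_› ‹_› hd))
  · calc ∑ i ∈ Finset.range E.1, dist (φ (E.2 i).1) (φ (E.2 i).2)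
        ≤ ∑ i ∈ Finset.range E.1, K * dist (E.2 i).1 (E.2 i).2 :=
          Finset.sum_le_sum fun i hi => hK.dist_le_mul _ (hE.1 i hi).1 _ (hE.1 i hi).2
      _ = K * ∑ i ∈ Finset.range E.1, dist (E.2 i).1 (E.2 i).2 := by rw [Finset.mul_sum]
      _ ≤ K * (δ / (K + 1)) := by gcongr
      _ < (K + 1) * (δ / (K + 1)) := by gcongr; linarith
      _ = δ := by field_simp

theorem lipschitz_comp_absolutelyContinuousOnInterval {f φ : ℝ → ℝ} {a b : ℝ} {s : Set ℝ}
    (hf : AbsolutelyContinuousOnInterval f a b) {K : NNReal} (hK : LipschitzOnWith K φ s)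
    (hmaps : MapsTo f (uIcc a b) s) : AbsolutelyContinuousOnInterval (φ ∘ f) a b := by
  rw [absolutelyContinuousOnInterval_iff] at hf ⊢
  intro ε hε
  obtain ⟨δ, hδ, h⟩ := hf (ε / (K + 1)) (by positivity)
  refine ⟨δ, hδ, fun E hE hs => ?_⟩
  calc ∑ i ∈ Finset.range E.1, dist (φ (f (E.2 i).1)) (φ (f (E.2 i).2))
      ≤ ∑ i ∈ Finset.range E.1, K * dist (f (E.2 i).1) (f (E.2 i).2) :=
        Finset.sum_le_sum fun i hi =>
          hK.dist_le_mul _ (hmaps (hE.1 i hi).1) _ (hmaps (hE.1 i hi).2)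
    _ = K * ∑ i ∈ Finset.range E.1, dist (f (E.2 i).1) (f (E.2 i).2) := by rw [Finset.mul_sum]
    _ ≤ K * (ε / (K + 1)) := by gcongr; exact (h E hE hs).le
    _ < (K + 1) * (ε / (K + 1)) := by gcongr; linarith
    _ = ε := by field_simp

theorem absolutelyContinuousOnInterval_congr {f g : ℝ → ℝ} {a b : ℝ}
    (hf : AbsolutelyContinuousOnInterval f a b) (h : EqOn f g (uIcc a b)) :
    AbsolutelyContinuousOnInterval g a b := by
  rw [absolutelyContinuousOnInterval_iff] at hf ⊢
  intro ε hε
  obtain ⟨δ, hδ, hd⟩ := hf ε hε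
  refine ⟨δ, hδ, fun E hE hs => (le_of_eq ?_).trans_lt (hd E hE hs)⟩
  exact Finset.sum_congr rfl fun i hi => by rw [h (hE.1 i hi).1, h (hE.1 i hi).2]

/-! ### Homeomorphisms of the unit interval given by real functions -/

theorem ext_apply (g : I → I) (x : I) : ext g x = g x := by
  simp [ext]

theorem ext_of_mem (g : I → I) {x : ℝ} (hx : x ∈ Icc (0 : ℝ) 1) : ext g x = g ⟨x, hx⟩ := by
  simp [ext, projIcc_of_mem zero_le_one hx]

theorem continuous_ext {g : I → I} (hg : Continuous g) : Continuous (ext g) :=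
  continuous_subtype_val.comp (hg.comp continuous_projIcc)

theorem ext_mem (g : I → I) (x : ℝ) : ext g x ∈ Icc (0 : ℝ) 1 := (g _).2

theorem monotone_ext {g : I → I} (hg : Monotone g) : Monotone (ext g) :=
  fun _ _ h => hg (monotone_projIcc _ h)

theorem strictMonoOn_ext {g : I → I} (hg : StrictMono g) : StrictMonoOn (ext g) (Icc 0 1) := by
  intro x hx y hy h
  rw [ext_of_mem g hx, ext_of_mem g hy]
  exact hg (by simpa using h)

/-- A strictly increasing continuous real function fixing `0` and `1` restricts to a
homeomorphism of the unit interval. -/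
theorem exists_homeomorph_of_strictMonoOn {f : ℝ → ℝ} (hc : ContinuousOn f (Icc 0 1))
    (hm : StrictMonoOn f (Icc 0 1)) (h0 : f 0 = 0) (h1 : f 1 = 1) :
    ∃ e : I ≃ₜ I, StrictMono e ∧ EqOn (ext e) f (Icc 0 1) := by
  have hmaps : ∀ x : I, f x ∈ Icc (0 : ℝ) 1 := fun x => by
    constructor
    · rw [← h0]; exact hm.monotoneOn (by simp) x.2 x.2.1
    · rw [← h1]; exact hm.monotoneOn x.2 (by simp) x.2.2
  let F : I → I := fun x => ⟨f x, hmaps x⟩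
  have hF : StrictMono F := fun x y h => hm x.2 y.2 h
  have hFc : Continuous F := (hc.comp_continuous continuous_subtype_val fun x => x.2).subtype_mk _
  have hFs : Function.Surjective F := by
    intro y
    have := intermediate_value_Icc zero_le_one hc
    rw [h0, h1] at this
    obtain ⟨x, hx, hxy⟩ := this y.2
    exact ⟨⟨x, hx⟩, Subtype.ext hxy⟩
  refine ⟨(hF.orderIsoOfSurjective F hFs).toHomeomorph, hF, fun x hx => ?_⟩
  rw [ext_of_mem _ hx]
  rfl

theorem homeomorph_fix {g : I ≃ₜ I} (hg : Monotone g) : g 0 = 0 ∧ g 1 = 1 := by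
  constructor
  · obtain ⟨x, hx⟩ := g.surjective 0
    exact le_antisymm ((hg (show 0 ≤ x from x.2.1)).trans hx.le) (g 0).2.1
  · obtain ⟨x, hx⟩ := g.surjective 1
    exact le_antisymm (g 1).2.2 (hx.ge.trans (hg (show x ≤ 1 from x.2.2)))

theorem IFS.strictMono {β : Ioo (0 : ℝ) (1 / 2)} {k : ℕ} (S : IFS β k) (i : Fin k) :
    StrictMono (S.map i) :=
  (S.map_mem i).1.strictMono_of_injective (S.map i).injective

/-! ### One-sided derivatives on the end intervals -/

theorem uniqueDiffOn_endSet {β : ℝ} (h : β ∈ Ioo (0 : ℝ) (1 / 2)) : UniqueDiffOn ℝ (endSet β) := by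
  intro x hx
  rcases hx with hx | hx
  · exact (uniqueDiffOn_Icc h.1 x hx).mono subset_union_left
  · exact (uniqueDiffOn_Icc (by linarith [h.1]) x hx).mono subset_union_right

/-- Since β < 1/2 the two end intervals are separated, so near a point of one of them `endSet` is
that interval alone. -/
theorem endSet_nhds_left {β x : ℝ} (h : β ∈ Ioo (0 : ℝ) (1 / 2)) (hx : x ∈ Icc 0 β) :
    Icc 0 β ∈ 𝓝[endSet β] x := by
  rw [mem_nhdsWithin]
  refine ⟨Iio (1 - β), isOpen_Iio, ?_, ?_⟩
  · have := hx.2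
    have := h.2
    simp only [mem_Iio]
    linarith
  · rintro y ⟨hy, hy' | hy'⟩
    · exact hy'
    · exact absurd hy (not_lt.2 hy'.1)

theorem endSet_nhds_right {β x : ℝ} (h : β ∈ Ioo (0 : ℝ) (1 / 2)) (hx : x ∈ Icc (1 - β) 1) :
    Icc (1 - β) 1 ∈ 𝓝[endSet β] x := by
  rw [mem_nhdsWithin]
  refine ⟨Ioi β, isOpen_Ioi, ?_, ?_⟩
  · have := hx.1
    have := h.2
    simp only [mem_Ioi]
    linarith
  · rintro y ⟨hy, hy' | hy'⟩
    · exact absurd hy (not_lt.2 hy'.2)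
    · exact hy'

theorem endDeriv_eq_left {β x f' : ℝ} (h : β ∈ Ioo (0 : ℝ) (1 / 2)) {g : I → I} {F : ℝ → ℝ}
    (hF : HasDerivAt F f' x) (hg : EqOn (ext g) F (Icc 0 β)) (hx : x ∈ Icc 0 β) :
    endDeriv β g x = f' := by
  refine HasDerivWithinAt.derivWithin ?_ (uniqueDiffOn_endSet h x (Or.inl hx))
  exact hF.hasDerivWithinAt.congr_of_eventuallyEq
    (mem_of_superset (endSet_nhds_left h hx) hg) (hg hx)

theorem endDeriv_eq_right {β x f' : ℝ} (h : β ∈ Ioo (0 : ℝ) (1 / 2)) {g : I → I} {F : ℝ → ℝ}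
    (hF : HasDerivAt F f' x) (hg : EqOn (ext g) F (Icc (1 - β) 1)) (hx : x ∈ Icc (1 - β) 1) :
    endDeriv β g x = f' := by
  refine HasDerivWithinAt.derivWithin ?_ (uniqueDiffOn_endSet h x (Or.inr hx))
  exact hF.hasDerivWithinAt.congr_of_eventuallyEq
    (mem_of_superset (endSet_nhds_right h hx) hg) (hg hx)

theorem hasDerivWithinAt_ext_left {β x : ℝ} (h : β ∈ Ioo (0 : ℝ) (1 / 2)) {g : C(I, I)}
    (hg : g ∈ CPlus β) (hx : x ∈ Icc 0 β) :
    HasDerivWithinAt (ext g) (endDeriv β g x) (Icc 0 β) x := by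
  have h1 : DifferentiableWithinAt ℝ (ext g) (endSet β) x :=
    ((hg.2.2.2.1 x hx).differentiableWithinAt (by norm_num)).mono_of_mem_nhdsWithin
      (endSet_nhds_left h hx)
  exact h1.hasDerivWithinAt.mono subset_union_left

theorem hasDerivWithinAt_ext_right {β x : ℝ} (h : β ∈ Ioo (0 : ℝ) (1 / 2)) {g : C(I, I)}
    (hg : g ∈ CPlus β) (hx : x ∈ Icc (1 - β) 1) :
    HasDerivWithinAt (ext g) (endDeriv β g x) (Icc (1 - β) 1) x := by
  have h1 : DifferentiableWithinAt ℝ (ext g) (endSet β) x :=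
    ((hg.2.2.2.2 x hx).differentiableWithinAt (by norm_num)).mono_of_mem_nhdsWithin
      (endSet_nhds_right h hx)
  exact h1.hasDerivWithinAt.mono subset_union_right

theorem mem_CPlus_of_eqOn {β : ℝ} {g : I ≃ₜ I} (hg : Monotone g) {F G : ℝ → ℝ}
    (hF : ContDiff ℝ 1 F) (hG : ContDiff ℝ 1 G) (h0 : EqOn (ext g) F (Icc 0 β))
    (h1 : EqOn (ext g) G (Icc (1 - β) 1)) : (g : C(I, I)) ∈ CPlus β :=
  ⟨hg, (homeomorph_fix hg).1, (homeomorph_fix hg).2, hF.contDiffOn.congr h0,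
    hG.contDiffOn.congr h1⟩

/-- Inversion of homeomorphisms of the interval is continuous for the supremum distance. -/
theorem exists_dist_symm_lt (g : I ≃ₜ I) {ε : ℝ} (hε : 0 < ε) :
    ∃ δ > 0, ∀ e : I ≃ₜ I, dist (e : C(I, I)) (g : C(I, I)) < δ →
      dist (e.symm : C(I, I)) (g.symm : C(I, I)) < ε := by
  obtain ⟨δ, hδ, h⟩ := Metric.uniformContinuous_iff.1
    (CompactSpace.uniformContinuous_of_continuous g.symm.continuous) (ε / 2) (half_pos hε)
  refine ⟨δ, hδ, fun e he => ?_⟩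
  refine lt_of_le_of_lt ((ContinuousMap.dist_le (half_pos hε).le).2 fun y => ?_) (half_lt_self hε)
  have h1 : dist (e (e.symm y)) (g (e.symm y)) < δ :=
    (ContinuousMap.dist_apply_le_dist (f := (e : C(I, I))) (g := (g : C(I, I))) _).trans_lt he
  have h2 := h h1
  simp only [Homeomorph.apply_symm_apply, Homeomorph.symm_apply_apply] at h2
  rw [dist_comm]
  exact h2.le


/-! ### Existence of invariant measures -/

/-- The function `x (1 - x)`, which measures the distance to the end points. -/
def gap (x : ℝ) : ℝ := x * (1 - x)

theorem gap_pos {x : ℝ} (hx : x ∈ Ioo (0 : ℝ) 1) : 0 < gap x :=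
  mul_pos hx.1 (sub_pos.2 hx.2)

theorem gap_le_one {x : ℝ} (hx : x ∈ Icc (0 : ℝ) 1) : gap x ≤ 1 := by
  unfold gap; nlinarith [hx.1, hx.2]

theorem continuous_gap : Continuous gap := by unfold gap; fun_prop

/-- The ratio factors as (f x / x) · ((1 - f x) / (1 - x)), and the second factor tends to 1. -/
theorem tendsto_gap_ratio_zero {f : ℝ → ℝ} {b c : ℝ} (hb : 0 < b)
    (hf : HasDerivWithinAt f c (Icc 0 b) 0) (h0 : f 0 = 0) :
    Tendsto (fun x => gap (f x) / gap x) (𝓝[>] 0) (𝓝 c) := by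
  have hle : 𝓝[>] (0 : ℝ) ≤ 𝓝[Icc 0 b \ {0}] 0 := by
    rw [Icc_sdiff_left, nhdsWithin_Ioc_eq_nhdsGT hb]
  have h1 : Tendsto (fun x => f x / x) (𝓝[>] 0) (𝓝 c) := by
    refine ((hasDerivWithinAt_iff_tendsto_slope.1 hf).mono_left hle).congr fun x => ?_
    rw [slope_def_field, h0, sub_zero, sub_zero]
  have h2 : Tendsto f (𝓝[>] 0) (𝓝 0) := by
    have := hf.continuousWithinAt.tendsto.mono_left (hle.trans (nhdsWithin_mono _ sdiff_subset))
    rwa [h0] at this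
  have h3 : Tendsto (fun x : ℝ => 1 - x) (𝓝[>] 0) (𝓝 (1 - 0)) :=
    (by fun_prop : Continuous fun x : ℝ => 1 - x).continuousWithinAt
  have h4 := h1.mul ((tendsto_const_nhds (x := (1 : ℝ)).sub h2).div h3 (by norm_num))
  simp only [sub_zero, div_one, mul_one] at h4
  refine h4.congr fun x => ?_
  simp only [gap, Pi.div_apply]
  rw [div_mul_div_comm]

theorem tendsto_gap_ratio_one {f : ℝ → ℝ} {b c : ℝ} (hb : 0 < b)
    (hf : HasDerivWithinAt f c (Icc (1 - b) 1) 1) (h1 : f 1 = 1) :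
    Tendsto (fun x => gap (f x) / gap x) (𝓝[<] 1) (𝓝 c) := by
  have hF : HasDerivWithinAt (fun x => 1 - f (1 - x)) c (Icc 0 b) 0 := by
    have hg : HasDerivWithinAt (fun x : ℝ => 1 - x) (-1) (Icc 0 b) 0 := by
      simpa using (hasDerivWithinAt_id (0 : ℝ) (Icc 0 b)).const_sub 1
    have := HasDerivWithinAt.scomp (t' := Icc (1 - b) 1) (g₁ := f) (g₁' := c) (0 : ℝ)
      (by simpa using hf) hg (fun x hx => ⟨by linarith [hx.2], by linarith [hx.1]⟩)
    simpa using this.const_sub 1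
  have h := tendsto_gap_ratio_zero hb hF (by simp [h1])
  have hm : Tendsto (fun x : ℝ => 1 - x) (𝓝[<] 1) (𝓝[>] 0) := by
    refine tendsto_nhdsWithin_iff.2 ⟨?_, ?_⟩
    · have := (by fun_prop : Continuous fun x : ℝ => 1 - x).continuousWithinAt (s := Iio 1) (x := 1)
      simpa [ContinuousWithinAt] using this
    · filter_upwards [self_mem_nhdsWithin] with x hx
      simpa using hx
  refine (h.comp hm).congr fun x => ?_
  simp only [gap, Function.comp, sub_sub_cancel]
  rw [mul_comm (1 - f x), mul_comm (1 - x)]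

namespace IFS

variable {β : Ioo (0 : ℝ) (1 / 2)} {k : ℕ} {S : IFS β k}

theorem ext_map_zero (S : IFS β k) (i : Fin k) : ext (S.map i) 0 = 0 := by
  have := congrArg Subtype.val (S.map_mem i).2.1
  rw [ext_of_mem _ ⟨le_rfl, zero_le_one⟩]
  exact this

theorem ext_map_one (S : IFS β k) (i : Fin k) : ext (S.map i) 1 = 1 := by
  have := congrArg Subtype.val (S.map_mem i).2.2.1
  rw [ext_of_mem _ ⟨zero_le_one, le_rfl⟩]
  exact this

theorem ext_map_mem_Ioo (S : IFS β k) (i : Fin k) {x : ℝ} (hx : x ∈ Ioo (0 : ℝ) 1) :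
    ext (S.map i) x ∈ Ioo (0 : ℝ) 1 := by
  have hm := strictMonoOn_ext (S.strictMono i)
  constructor
  · rw [← S.ext_map_zero i]
    exact hm ⟨le_rfl, zero_le_one⟩ (Ioo_subset_Icc_self hx) hx.1
  · rw [← S.ext_map_one i]
    exact hm (Ioo_subset_Icc_self hx) ⟨zero_le_one, le_rfl⟩ hx.2

/-- `log (gap (gᵢ x) / gap x)` -/
def logRatio (S : IFS β k) (i : Fin k) (x : ℝ) : ℝ :=
  Real.log (gap (ext (S.map i) x) / gap x)

theorem IsAdmissible.tendsto_logRatio_zero (hS : S.IsAdmissible) (i : Fin k) :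
    Tendsto (S.logRatio i) (𝓝[>] 0) (𝓝 (Real.log (endDeriv β (S.map i) 0))) :=
  (tendsto_gap_ratio_zero β.2.1 (hasDerivWithinAt_ext_left β.2 (S.map_mem i)
    ⟨le_rfl, β.2.1.le⟩) (S.ext_map_zero i)).log (hS.deriv_zero_pos i).ne'

theorem IsAdmissible.tendsto_logRatio_one (hS : S.IsAdmissible) (i : Fin k) :
    Tendsto (S.logRatio i) (𝓝[<] 1) (𝓝 (Real.log (endDeriv β (S.map i) 1))) :=
  (tendsto_gap_ratio_one β.2.1 (hasDerivWithinAt_ext_right β.2 (S.map_mem i)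
    ⟨by linarith [β.2.1], le_rfl⟩) (S.ext_map_one i)).log (hS.deriv_one_pos i).ne'

theorem continuousOn_logRatio (S : IFS β k) (i : Fin k) :
    ContinuousOn (S.logRatio i) (Ioo 0 1) := by
  refine ContinuousOn.log (ContinuousOn.div ?_ continuous_gap.continuousOn ?_) ?_
  · exact (continuous_gap.comp (continuous_ext (S.map i).continuous)).continuousOn
  · exact fun x hx => (gap_pos hx).ne'
  · exact fun x hx => (div_pos (gap_pos (S.ext_map_mem_Ioo i hx)) (gap_pos hx)).ne'

/-- Weak limits of measures need a continuous test function on the closed interval; its end values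
are the logarithms of the slopes there. -/
theorem IsAdmissible.continuousOn_extendFrom (hS : S.IsAdmissible) (i : Fin k) :
    ContinuousOn (extendFrom (Ioo 0 1) (S.logRatio i)) (Icc 0 1) :=
  continuousOn_Icc_extendFrom_Ioo (S.continuousOn_logRatio i)
    (hS.tendsto_logRatio_zero i) (hS.tendsto_logRatio_one i)

theorem extendFrom_logRatio (S : IFS β k) (i : Fin k) {x : ℝ} (hx : x ∈ Ioo (0 : ℝ) 1) :
    extendFrom (Ioo 0 1) (S.logRatio i) x = S.logRatio i x :=
  extendFrom_extends (S.continuousOn_logRatio i) x hx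

/-- The dual Markov operator on functions. -/
def dual (S : IFS β k) (f : I → ℝ) (x : I) : ℝ := ∑ i, S.prob i * f (S.map i x)

theorem continuous_dual (S : IFS β k) {f : I → ℝ} (hf : Continuous f) : Continuous (S.dual f) :=
  continuous_finsetSum _ fun i _ => continuous_const.mul (hf.comp (S.map i).continuous)

theorem prob_nonneg (S : IFS β k) (i : Fin k) : 0 ≤ S.prob i := S.prob_mem.1 i

theorem sum_prob (S : IFS β k) : ∑ i, S.prob i = 1 := S.prob_mem.2

theorem sum_ofReal_prob (S : IFS β k) : ∑ i, ENNReal.ofReal (S.prob i) = 1 := by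
  rw [← ENNReal.ofReal_sum_of_nonneg fun i _ => S.prob_nonneg i, S.sum_prob, ENNReal.ofReal_one]

theorem markov_apply (S : IFS β k) (μ : Measure I) {A : Set I} (hA : MeasurableSet A) :
    S.markov μ A = ∑ i, ENNReal.ofReal (S.prob i) * μ (S.map i ⁻¹' A) := by
  simp only [markov, Measure.coe_finsetSum, Finset.sum_apply, Measure.smul_apply, smul_eq_mul]
  exact Finset.sum_congr rfl fun i _ => by rw [Measure.map_apply (S.map i).measurable hA]

instance isProbabilityMeasure_markov (S : IFS β k) (μ : Measure I) [IsProbabilityMeasure μ] :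
    IsProbabilityMeasure (S.markov μ) :=
  ⟨by rw [markov_apply _ _ MeasurableSet.univ]; simp [S.sum_ofReal_prob]⟩

theorem integral_markov (S : IFS β k) (μ : Measure I) [IsFiniteMeasure μ] {f : I → ℝ}
    (hf : Continuous f) : ∫ x, f x ∂(S.markov μ) = ∫ x, S.dual f x ∂μ := by
  have hint : ∀ ν : Measure I, IsFiniteMeasure ν → ∀ h : I → ℝ, Continuous h → Integrable h ν :=
    fun ν _ h hh => hh.integrable_of_hasCompactSupport (HasCompactSupport.of_compactSpace h)
  unfold markov dual
  rw [integral_finsetSum_measure, integral_finsetSum]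
  · refine Finset.sum_congr rfl fun i _ => ?_
    rw [integral_smul_measure, ENNReal.toReal_ofReal (S.prob_nonneg i), integral_const_mul,
      integral_map (S.map i).continuous.aemeasurable hf.aestronglyMeasurable, smul_eq_mul]
  · exact fun i _ => (hint _ inferInstance _ (hf.comp (S.map i).continuous)).const_mul _
  · intro i _
    exact (hint _ inferInstance _ hf).smul_measure ENNReal.ofReal_ne_top

/-- Krylov–Bogoliubov averaging from the point 1/2, with V = -log(x(1-x)) as Lyapunov function. In
the interior V minus its dual image is the mean logarithmic ratio `ell`, whose values at 0 and 1 are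
the Lyapunov exponents. The averages force ∫ `ell` ≤ 0 in the limit, so positive exponents forbid a
limit carried by the end points. -/
theorem IsAdmissible.exists_invariant (hS : S.IsAdmissible) : ∃ μ ∈ probOpen, S.markov μ = μ := by
  have hint : ∀ ν : Measure I, IsFiniteMeasure ν → ∀ h : I → ℝ, Continuous h → Integrable h ν :=
    fun ν _ h hh => hh.integrable_of_hasCompactSupport (HasCompactSupport.of_compactSpace h)
  let x₀ : I := ⟨1 / 2, by norm_num, by norm_num⟩
  let ν : ℕ → Measure I := fun m => S.markov^[m] (Measure.dirac x₀)
  have hνs : ∀ m, ν (m + 1) = S.markov (ν m) := fun m => Function.iterate_succ_apply' _ _ _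
  have hνp : ∀ m, IsProbabilityMeasure (ν m) := by
    intro m
    induction m with
    | zero => exact inferInstanceAs (IsProbabilityMeasure (Measure.dirac x₀))
    | succ m ih => rw [hνs]; infer_instance
  have hνi : ∀ m, ∀ f : I → ℝ, Continuous f → ∫ x, f x ∂(ν m) = S.dual^[m] f x₀ := by
    intro m
    induction m with
    | zero => intro f hf; exact integral_dirac f x₀
    | succ m ih =>
      intro f hf
      rw [hνs, integral_markov _ _ hf, ih _ (S.continuous_dual hf), Function.iterate_succ_apply]
  -- Cesàro averages
  let A : ℕ → Measure I := fun n => ((n : ENNReal) + 1)⁻¹ • ∑ m ∈ Finset.range (n + 1), ν m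
  have hAp : ∀ n, IsProbabilityMeasure (A n) := by
    intro n
    refine ⟨?_⟩
    simp only [A, Measure.smul_apply, Measure.coe_finsetSum, Finset.sum_apply, measure_univ,
      Finset.sum_const, Finset.card_range, smul_eq_mul, nsmul_eq_mul, mul_one]
    push_cast
    exact ENNReal.inv_mul_cancel (by simp) (by simp)
  have hAi : ∀ n, ∀ f : I → ℝ, Continuous f →
      ∫ x, f x ∂(A n) = ((n : ℝ) + 1)⁻¹ * ∑ m ∈ Finset.range (n + 1), S.dual^[m] f x₀ := by
    intro n f hf
    simp only [A]
    rw [integral_smul_measure, integral_finsetSum_measure fun m _ => hint _ inferInstance _ hf,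
      smul_eq_mul, Finset.sum_congr rfl fun m _ => hνi m f hf]
    congr 1
    rw [ENNReal.toReal_inv]
    norm_cast
  let Q : ℕ → ProbabilityMeasure I := fun n => ⟨A n, hAp n⟩
  -- By compactness the limit along a free ultrafilter exists, without passing to subsequences.
  obtain ⟨P, -, hP⟩ := isCompact_univ.ultrafilter_le_nhds'
    ((hyperfilter ℕ).map Q) univ_mem
  have hlim : Tendsto Q (hyperfilter ℕ) (𝓝 P) := hP
  have hlim' : ∀ f : C(I, ℝ), Tendsto
      (fun n : ℕ => ((n : ℝ) + 1)⁻¹ * ∑ m ∈ Finset.range (n + 1), S.dual^[m] f x₀)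
      (hyperfilter ℕ) (𝓝 (∫ x, f x ∂(P : Measure I))) := by
    intro f
    have := ProbabilityMeasure.tendsto_iff_forall_integral_tendsto.1 hlim
      (BoundedContinuousFunction.mkOfCompact f)
    refine this.congr fun n => ?_
    exact hAi n f f.continuous
  have hfree : Tendsto (fun n : ℕ => ((n : ℝ) + 1)⁻¹) (hyperfilter ℕ) (𝓝 0) := by
    have : Tendsto (fun n : ℕ => ((n : ℝ) + 1)⁻¹) atTop (𝓝 0) := by
      simpa using tendsto_one_div_add_atTop_nhds_zero_nat (𝕜 := ℝ)
    exact this.mono_left Nat.hyperfilter_le_atTop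
  -- invariance of the limit
  have hbound : ∀ f : C(I, ℝ), ∀ m, |S.dual^[m] f x₀| ≤ ‖f‖ := by
    intro f m
    rw [← hνi m f f.continuous, ← Real.norm_eq_abs]
    refine (norm_integral_le_of_norm_le_const (C := ‖f‖)
      (Eventually.of_forall f.norm_coe_le_norm)).trans ?_
    simp
  have hinv : S.markov (P : Measure I) = P := by
    refine ext_of_forall_integral_eq_of_IsFiniteMeasure fun f => ?_
    rw [integral_markov _ _ f.continuous]
    let F : C(I, ℝ) := ⟨S.dual f, S.continuous_dual f.continuous⟩
    have h1 := hlim' F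
    have h2 := hlim' f.toContinuousMap
    -- The averages of `f` and of its dual image differ by a telescoped boundary term of order 1/n.
    have h3 : Tendsto (fun n : ℕ => ((n : ℝ) + 1)⁻¹ *
        (S.dual^[n + 1] f x₀ - S.dual^[0] f x₀)) (hyperfilter ℕ) (𝓝 0) := by
      refine hfree.zero_mul_isBoundedUnder_le ?_
      refine isBoundedUnder_of ⟨2 * ‖f.toContinuousMap‖, fun n => ?_⟩
      have e1 := hbound f.toContinuousMap (n + 1)
      have e2 := hbound f.toContinuousMap 0
      refine (abs_sub _ _).trans ?_
      simp only [BoundedContinuousFunction.coe_toContinuousMap] at e1 e2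
      linarith
    have h4 := h2.add h3
    rw [add_zero] at h4
    refine tendsto_nhds_unique (h1.congr fun n => ?_) h4
    rw [← mul_add, ← Finset.sum_range_sub (fun m => S.dual^[m] f x₀), ← Finset.sum_add_distrib]
    congr 1
    refine Finset.sum_congr rfl fun m _ => ?_
    have : S.dual^[m + 1] f x₀ = S.dual^[m] F x₀ := by
      rw [Function.iterate_succ_apply]; rfl
    rw [this]
    simp
  -- the drift condition
  let ell : I → ℝ := fun x => ∑ i, S.prob i * extendFrom (Ioo 0 1) (S.logRatio i) x
  have hell : Continuous ell := continuous_finsetSum _ fun i _ => continuous_const.mul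
    ((hS.continuousOn_extendFrom i).comp_continuous continuous_subtype_val fun x => x.2)
  let V : I → ℝ := fun x => -Real.log (gap x)
  have hpos : ∀ m, ∀ x ∈ Ioo (0 : I) 1, 0 ≤ S.dual^[m] V x ∧
      S.dual^[m] ell x = S.dual^[m] V x - S.dual^[m + 1] V x := by
    have hio : ∀ x ∈ Ioo (0 : I) 1, (x : ℝ) ∈ Ioo (0 : ℝ) 1 := fun x hx => ⟨hx.1, hx.2⟩
    have hmap : ∀ i, ∀ x ∈ Ioo (0 : I) 1, S.map i x ∈ Ioo (0 : I) 1 := by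
      intro i x hx
      have := S.ext_map_mem_Ioo i (hio x hx)
      rw [ext_apply] at this
      exact ⟨this.1, this.2⟩
    intro m
    induction m with
    | zero =>
      intro x hx
      refine ⟨neg_nonneg.2 (Real.log_nonpos (gap_pos (hio x hx)).le (gap_le_one x.2)), ?_⟩
      simp only [Function.iterate_zero, id_eq, zero_add, Function.iterate_one]
      have : V x = ∑ i, S.prob i * V x := by rw [← Finset.sum_mul, S.sum_prob, one_mul]
      rw [this, dual, ← Finset.sum_sub_distrib]
      refine Finset.sum_congr rfl fun i _ => ?_
      rw [S.extendFrom_logRatio i (hio x hx), logRatio, Real.log_div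
        (gap_pos (S.ext_map_mem_Ioo i (hio x hx))).ne' (gap_pos (hio x hx)).ne', ext_apply]
      simp only [V]
      ring
    | succ m ih =>
      intro x hx
      constructor
      · rw [Function.iterate_succ_apply']
        exact Finset.sum_nonneg fun i _ => mul_nonneg (S.prob_nonneg i) (ih _ (hmap i x hx)).1
      · rw [Function.iterate_succ_apply', Function.iterate_succ_apply' (n := m + 1)]
        simp only [dual.eq_1 S (S.dual^[m] ell), dual.eq_1 S (S.dual^[m + 1] V)]
        nth_rewrite 1 [Function.iterate_succ_apply']
        rw [dual.eq_1 S (S.dual^[m] V)]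
        rw [← Finset.sum_sub_distrib]
        refine Finset.sum_congr rfl fun i _ => ?_
        rw [(ih _ (hmap i x hx)).2]
        ring
  have hx₀ : x₀ ∈ Ioo (0 : I) 1 :=
    ⟨Subtype.coe_lt_coe.1 (by norm_num [x₀]), Subtype.coe_lt_coe.1 (by norm_num [x₀])⟩
  -- Telescoping, together with V ≥ 0 along the orbit, bounds the averages of `ell` by V(x₀)/(n+1).
  have hle : ∫ x, ell x ∂(P : Measure I) ≤ 0 := by
    have h1 := hlim' ⟨ell, hell⟩
    have h2 : Tendsto (fun n : ℕ => ((n : ℝ) + 1)⁻¹ * V x₀) (hyperfilter ℕ) (𝓝 0) := by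
      simpa using hfree.mul_const (V x₀)
    refine le_of_tendsto_of_tendsto' h1 h2 fun n => ?_
    refine mul_le_mul_of_nonneg_left ?_ (by positivity)
    have : ∑ m ∈ Finset.range (n + 1), S.dual^[m] ell x₀ = V x₀ - S.dual^[n + 1] V x₀ := by
      rw [Finset.sum_congr rfl fun m _ => (hpos m x₀ hx₀).2, Finset.sum_range_sub']
      rfl
    simp only [ContinuousMap.coe_mk]
    rw [this]
    linarith [(hpos (n + 1) x₀ hx₀).1]
  -- positive mass in the interior
  have hell0 : 0 < ell 0 := by
    have := hS.lyapunov_zero_pos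
    convert! this using 3 with i
    exact eq_lim_at_left_extendFrom_Ioo zero_lt_one (hS.tendsto_logRatio_zero i)
  have hell1 : 0 < ell 1 := by
    have := hS.lyapunov_one_pos
    convert! this using 3 with i
    exact eq_lim_at_right_extendFrom_Ioo zero_lt_one (hS.tendsto_logRatio_one i)
  have hmass : (P : Measure I) (Ioo 0 1) ≠ 0 := by
    intro h0
    have hae : ∀ᵐ x ∂(P : Measure I), min (ell 0) (ell 1) ≤ ell x := by
      have : ∀ᵐ x ∂(P : Measure I), x ∉ Ioo (0 : I) 1 := measure_eq_zero_iff_ae_notMem.1 h0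
      filter_upwards [this] with x hx
      by_cases hx0 : x = 0
      · rw [hx0]; exact min_le_left _ _
      · by_cases hx1 : x = 1
        · rw [hx1]; exact min_le_right _ _
        · exact absurd ⟨unitInterval.pos_iff_ne_zero.2 hx0, unitInterval.lt_one_iff_ne_one.2 hx1⟩ hx
    have h1 := integral_mono_ae (integrable_const (min (ell 0) (ell 1)))
      (hint _ inferInstance _ hell) hae
    simp only [integral_const, probReal_univ, smul_eq_mul, one_mul] at h1
    have := lt_min hell0 hell1
    linarith
  -- restrict and normalise
  have hpre : ∀ i, S.map i ⁻¹' Ioo 0 1 = Ioo 0 1 := by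
    intro i
    have h01 := homeomorph_fix (S.strictMono i).monotone
    ext x
    have a1 := (S.strictMono i).lt_iff_lt (a := 0) (b := x)
    have a2 := (S.strictMono i).lt_iff_lt (a := x) (b := 1)
    rw [h01.1] at a1
    rw [h01.2] at a2
    simp only [mem_preimage, mem_Ioo, a1, a2]
  refine ⟨((P : Measure I) (Ioo 0 1))⁻¹ • (P : Measure I).restrict (Ioo 0 1), ⟨⟨?_⟩, ?_⟩, ?_⟩
  · simp [ENNReal.inv_mul_cancel hmass (measure_ne_top _ _)]
  · simp [ENNReal.inv_mul_cancel hmass (measure_ne_top _ _)]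
  · refine Measure.ext fun B hB => ?_
    rw [markov_apply _ _ hB]
    simp only [Measure.smul_apply, smul_eq_mul]
    have h1 := markov_apply S P (hB.inter (measurableSet_Ioo (a := (0 : I)) (b := 1)))
    rw [hinv] at h1
    rw [Measure.restrict_apply hB, h1, Finset.mul_sum]
    refine Finset.sum_congr rfl fun i _ => ?_
    rw [Measure.restrict_apply ((S.map i).measurable hB), preimage_inter, hpre i]
    ring

end IFS

/-! ### Primitives with quantized slopes -/

/-- The points `x`, `y` are compatible if, for all `|m| ≤ N`, the phase of `y` at scale `r ^ m * M`
is that of `x` at scale `r ^ (m + j) * M`, with a shift `|j| ≤ J` independent of `m`, or if all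
these phases are close to `0`. -/
def Compatible (r M : ℝ) (N J : ℕ) (x y : ℝ) : Prop :=
  (∃ j : ℤ, |j| ≤ J ∧ ∀ m : ℤ, |m| ≤ N → ∃ t : ℤ, r ^ m * M * y = r ^ (m + j) * M * x + t) ∨
  ∀ m : ℤ, |m| ≤ N → (∃ t : ℤ, |r ^ m * M * x - t| < 1 / 8) ∧ ∃ t : ℤ, |r ^ m * M * y - t| < 1 / 8

/-- With r = (q+1)/q, the factor q(q+1) clears denominators for both signs: it turns r into (q+1)²
and r⁻¹ into q². -/
theorem exists_int_eq_zpow_mul {q : ℕ} (hq : 1 ≤ q) {m : ℤ} {n : ℕ} (hm : |m| ≤ n) :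
    ∃ t : ℤ, (1 + 1 / (q : ℝ)) ^ m * ((q * (q + 1) : ℕ) : ℝ) ^ n = t := by
  have hq0 : (q : ℝ) ≠ 0 := by positivity
  have hq1 : (q : ℝ) + 1 ≠ 0 := by positivity
  have hr : 1 + 1 / (q : ℝ) = (q + 1) / q := by field_simp
  have hn : m.natAbs ≤ n := by rw [Int.abs_eq_natAbs] at hm; omega
  obtain ⟨d, rfl⟩ := Nat.exists_eq_add_of_le hn
  rw [hr]
  rcases Int.natAbs_eq m with h | h
  · refine ⟨((q + 1) ^ (2 * m.natAbs) * (q * (q + 1)) ^ d : ℕ), ?_⟩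
    rw [h, zpow_natCast]
    simp only [Int.natAbs_natCast]
    push_cast
    rw [pow_add, ← mul_assoc, ← mul_pow, pow_mul]
    congr 2
    field_simp
  · refine ⟨(q ^ (2 * m.natAbs) * (q * (q + 1)) ^ d : ℕ), ?_⟩
    rw [h, zpow_neg, zpow_natCast]
    simp only [Int.natAbs_neg, Int.natAbs_natCast]
    push_cast
    rw [pow_add, ← mul_assoc, ← inv_pow, ← mul_pow, pow_mul]
    congr 2
    field_simp

/-- Consecutive powers of r differ by the factor 1 + 1/q, so rounding down to a power of r costs at
most C/q. The two bounds on r^J keep the exponent in [-J, J]. -/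
theorem exists_quantized_slopes {φ : ℝ → ℝ} {C τ : ℝ} {q J : ℕ} (hq : 1 ≤ q) (hτ : 0 < τ)
    (hφ : ∀ x, φ x ∈ Icc τ C) (hJ : C ≤ (1 + 1 / (q : ℝ)) ^ J)
    (hJ' : 1 + 1 / (q : ℝ) ≤ τ * (1 + 1 / (q : ℝ)) ^ J) (x : ℝ) :
    ∃ j : ℤ, |j| ≤ J ∧ |(1 + 1 / (q : ℝ)) ^ j - φ x| ≤ C / q := by
  have hq0 : (0 : ℝ) < q := by positivity
  set r : ℝ := 1 + 1 / (q : ℝ) with hr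
  have hr1 : 1 < r := by rw [hr]; have : 0 < 1 / (q : ℝ) := by positivity
                         linarith
  obtain ⟨h1, h2⟩ := hφ x
  obtain ⟨j, hj1, hj2⟩ := exists_mem_Ico_zpow (hτ.trans_le h1) hr1
  refine ⟨j, abs_le.2 ⟨?_, ?_⟩, ?_⟩
  · have h3 : r ^ (1 : ℤ) < r ^ (j + 1 + J) := by
      rw [zpow_add₀ (by positivity), zpow_natCast, zpow_one]
      calc r ≤ τ * r ^ J := hJ'
        _ ≤ φ x * r ^ J := by gcongr
        _ < r ^ (j + 1) * r ^ J := by gcongr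
    have := (zpow_lt_zpow_iff_right₀ hr1).1 h3
    omega
  · have h3 : r ^ j ≤ r ^ (J : ℤ) := by
      rw [zpow_natCast]; linarith
    exact (zpow_le_zpow_iff_right₀ hr1).1 h3
  · rw [abs_sub_comm, abs_of_nonneg (by linarith)]
    have h3 : r ^ (j + 1) = r ^ j + r ^ j / q := by
      rw [zpow_add_one₀ (by positivity), hr]; ring
    have h4 : r ^ j / q ≤ C / q := by gcongr; linarith
    linarith

/-- The step function with slope `r ^ j l` on the cell `(l / K, (l + 1) / K]`. -/
def stepFun (r : ℝ) (K : ℕ) (j : ℕ → ℤ) (u : ℝ) : ℝ := r ^ j (⌈K * u⌉₊ - 1)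

/-- The piecewise affine function with slope `stepFun r K j`. -/
def stepPrim (r : ℝ) (K : ℕ) (j : ℕ → ℤ) (x : ℝ) : ℝ := ∫ u in (0 : ℝ)..x, stepFun r K j u

/-- The average of `stepPrim r K j` over `[x - ι, x + ι]`. -/
def steklov (r : ℝ) (K : ℕ) (j : ℕ → ℤ) (ι x : ℝ) : ℝ :=
  (2 * ι)⁻¹ * ∫ u in (x - ι)..(x + ι), stepPrim r K j u

theorem stepFun_mem {r : ℝ} {K J : ℕ} {j : ℕ → ℤ} (hr : 1 < r) (hj : ∀ l, |j l| ≤ J)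
    (u : ℝ) : stepFun r K j u ∈ Icc ((r ^ J)⁻¹) (r ^ J) := by
  have h := abs_le.1 (hj (⌈K * u⌉₊ - 1))
  unfold stepFun
  constructor
  · rw [← zpow_natCast, ← zpow_neg]
    exact zpow_le_zpow_right₀ hr.le h.1
  · rw [← zpow_natCast]
    exact zpow_le_zpow_right₀ hr.le h.2

theorem intervalIntegrable_stepFun {r : ℝ} {K J : ℕ} {j : ℕ → ℤ} (hr : 1 < r) (hj : ∀ l, |j l| ≤ J)
    (a b : ℝ) :
    IntervalIntegrable (stepFun r K j) volume a b := by
  have hm : Measurable (stepFun r K j) := by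
    unfold stepFun
    exact (measurable_from_nat (f := fun n : ℕ => r ^ j (n - 1))).comp
      (Nat.measurable_ceil.comp (measurable_const.mul measurable_id))
  refine (intervalIntegrable_const (c := r ^ J)).mono_fun hm.aestronglyMeasurable ?_
  refine Eventually.of_forall fun u => ?_
  have h := stepFun_mem hr hj (K := K) u
  have h0 : 0 < (r ^ J)⁻¹ := by positivity
  change ‖stepFun r K j u‖ ≤ ‖r ^ J‖
  rw [Real.norm_of_nonneg (h0.le.trans h.1), Real.norm_of_nonneg (by positivity)]
  exact h.2

theorem stepPrim_sub {r : ℝ} {K J : ℕ} {j : ℕ → ℤ} (hr : 1 < r) (hj : ∀ l, |j l| ≤ J)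
    (a b : ℝ) :
    stepPrim r K j b - stepPrim r K j a = ∫ u in a..b, stepFun r K j u :=
  intervalIntegral.integral_interval_sub_left (intervalIntegrable_stepFun hr hj _ _)
    (intervalIntegrable_stepFun hr hj _ _)

theorem continuous_stepPrim {r : ℝ} {K J : ℕ} {j : ℕ → ℤ} (hr : 1 < r) (hj : ∀ l, |j l| ≤ J)
    : Continuous (stepPrim r K j) :=
  intervalIntegral.continuous_primitive (fun a b => intervalIntegrable_stepFun hr hj a b) 0

theorem abs_stepPrim_sub_le {r : ℝ} {K J : ℕ} {j : ℕ → ℤ} (hr : 1 < r) (hj : ∀ l, |j l| ≤ J)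
    (a b : ℝ) :
    |stepPrim r K j b - stepPrim r K j a| ≤ r ^ J * |b - a| := by
  rw [stepPrim_sub hr hj, ← Real.norm_eq_abs]
  refine intervalIntegral.norm_integral_le_of_norm_le_const fun u _ => ?_
  have h := stepFun_mem hr hj (K := K) u
  have h0 : 0 < (r ^ J)⁻¹ := by positivity
  rw [Real.norm_of_nonneg (h0.le.trans h.1)]
  exact h.2

/-- Truncated subtraction assigns index 0 to every u ≤ 0 too, so the first cell extends to the left
without bound; hence the alternative l = 0. Averaging windows around points near 0 rely on this. -/
theorem stepFun_of_mem {r : ℝ} {K : ℕ} {j : ℕ → ℤ} (hK : 0 < K) {l : ℕ} {u : ℝ} (h1 : l = 0 ∨ (l : ℝ) / K < u)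
    (h2 : u ≤ (l + 1) / K) : stepFun r K j u = r ^ j l := by
  have hK' : (0 : ℝ) < K := by positivity
  have h3 : ⌈K * u⌉₊ ≤ l + 1 := by
    rw [Nat.ceil_le]
    rw [le_div_iff₀ hK'] at h2
    push_cast
    linarith
  have h4 : l = 0 ∨ l < ⌈K * u⌉₊ := by
    refine h1.imp_right fun h => ?_
    rw [Nat.lt_ceil]
    rw [div_lt_iff₀ hK'] at h
    linarith
  unfold stepFun
  congr 2
  omega

theorem stepPrim_of_mem {r : ℝ} {K J : ℕ} {j : ℕ → ℤ} (hr : 1 < r) (hj : ∀ l, |j l| ≤ J)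
    (hK : 0 < K) {l : ℕ} {x : ℝ} (h1 : l = 0 ∨ (l : ℝ) / K ≤ x)
    (h2 : x ≤ (l + 1) / K) :
    stepPrim r K j x = stepPrim r K j (l / K) + r ^ j l * (x - l / K) := by
  have hK' : (0 : ℝ) < K := by positivity
  have h3 : (l : ℝ) / K ≤ (l + 1) / K := by gcongr; linarith
  have h := stepPrim_sub hr hj (K := K) (l / K) x
  rw [intervalIntegral.integral_congr_ae (g := fun _ => r ^ j l)
    (Eventually.of_forall fun u hu => ?_)] at h
  · rw [intervalIntegral.integral_const, smul_eq_mul] at h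
    linarith
  · rw [uIoc, mem_Ioc] at hu
    refine stepFun_of_mem hK ?_ (hu.2.trans (max_le h3 h2))
    refine h1.imp_right fun h => ?_
    rw [min_eq_left h] at hu
    exact hu.1

theorem stepPrim_node {r : ℝ} {K J : ℕ} {j : ℕ → ℤ} (hr : 1 < r) (hj : ∀ l, |j l| ≤ J)
    (hK : 0 < K) (l : ℕ) :
    stepPrim r K j (l / K) = ∑ i ∈ Finset.range l, r ^ j i / K := by
  have hK' : (0 : ℝ) < K := by positivity
  induction l with
  | zero => simp [stepPrim]
  | succ l ih =>
    have h3 : (l : ℝ) / K ≤ (l + 1) / K := by gcongr; linarith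
    rw [Finset.sum_range_succ, ← ih]
    push_cast
    rw [stepPrim_of_mem hr hj hK (Or.inr h3) le_rfl]
    ring

theorem hasDerivAt_steklov {r : ℝ} {K J : ℕ} {j : ℕ → ℤ} (hr : 1 < r) (hj : ∀ l, |j l| ≤ J)
    (ι x : ℝ) : HasDerivAt (steklov r K j ι)
    ((2 * ι)⁻¹ * (stepPrim r K j (x + ι) - stepPrim r K j (x - ι))) x := by
  have hc := continuous_stepPrim hr hj (K := K)
  have h1 : ∀ y, HasDerivAt (fun y => ∫ u in (0 : ℝ)..y, stepPrim r K j u) (stepPrim r K j y) y :=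
    fun y => hc.integral_hasStrictDerivAt 0 y |>.hasDerivAt
  have h2 := ((h1 (x + ι)).comp_add_const x ι).sub ((h1 (x - ι)).comp_sub_const x ι)
  have h3 := h2.const_mul (2 * ι)⁻¹
  refine h3.congr_of_eventuallyEq (Eventually.of_forall fun y => ?_)
  simp only [steklov, Pi.sub_apply]
  rw [intervalIntegral.integral_interval_sub_left (hc.intervalIntegrable _ _)
    (hc.intervalIntegrable _ _)]

theorem abs_steklov_sub_le {r : ℝ} {K J : ℕ} {j : ℕ → ℤ} (hr : 1 < r) (hj : ∀ l, |j l| ≤ J)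
    {ι : ℝ} (hι : 0 < ι) (x y : ℝ) :
    |steklov r K j ι x - stepPrim r K j y| ≤ r ^ J * (|x - y| + ι) := by
  have hc := continuous_stepPrim hr hj (K := K)
  have h1 : steklov r K j ι x - stepPrim r K j y =
      (2 * ι)⁻¹ * ∫ u in (x - ι)..(x + ι), (stepPrim r K j u - stepPrim r K j y) := by
    rw [intervalIntegral.integral_sub (hc.intervalIntegrable _ _) (by simp),
      intervalIntegral.integral_const, smul_eq_mul, steklov]
    field_simp
    ring
  have h2 : ‖∫ u in (x - ι)..(x + ι), (stepPrim r K j u - stepPrim r K j y)‖ ≤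
      (r ^ J * (|x - y| + ι)) * |x + ι - (x - ι)| := by
    refine intervalIntegral.norm_integral_le_of_norm_le_const fun u hu => ?_
    rw [uIoc_of_le (by linarith), mem_Ioc] at hu
    refine (abs_stepPrim_sub_le hr hj y u).trans ?_
    have : |u - y| ≤ |x - y| + ι := by
      have h3 : |u - x| ≤ ι := abs_le.2 ⟨by linarith, by linarith⟩
      have := abs_sub_le u x y
      linarith
    gcongr
  rw [h1, abs_mul, abs_of_pos (by positivity)]
  rw [Real.norm_eq_abs, show x + ι - (x - ι) = 2 * ι by ring, abs_of_pos (by linarith : 0 < 2 * ι)]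
    at h2
  calc (2 * ι)⁻¹ * _ ≤ (2 * ι)⁻¹ * ((r ^ J * (|x - y| + ι)) * (2 * ι)) := by gcongr
    _ = _ := by field_simp

/-- A symmetric average reproduces affine functions, so the smoothing is invisible at distance ι
from the nodes. -/
theorem steklov_of_mem {r : ℝ} {K J : ℕ} {j : ℕ → ℤ} (hr : 1 < r) (hj : ∀ l, |j l| ≤ J)
    (hK : 0 < K) {ι : ℝ} (hι : 0 < ι) {l : ℕ} {x : ℝ}
    (h1 : l = 0 ∨ (l : ℝ) / K ≤ x - ι) (h2 : x + ι ≤ (l + 1) / K) :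
    steklov r K j ι x = stepPrim r K j (l / K) + r ^ j l * (x - l / K) := by
  unfold steklov
  rw [intervalIntegral.integral_congr (g := fun u => stepPrim r K j (l / K) + r ^ j l * (u - l / K))]
  · rw [intervalIntegral.integral_add (by simp)
      (Continuous.intervalIntegrable (by fun_prop) _ _), intervalIntegral.integral_const_mul,
      intervalIntegral.integral_sub (by simp) (by simp)]
    simp only [intervalIntegral.integral_const, integral_id, smul_eq_mul]
    field_simp
    ring
  · intro u hu
    rw [uIcc_of_le (by linarith), mem_Icc] at hu
    exact stepPrim_of_mem hr hj hK (h1.imp_right fun h => h.trans hu.1) (hu.2.trans h2)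

/-- A positive continuous function is approximated by the derivative of a `C¹` function all of
whose values are compatible with their arguments. -/
theorem exists_compatible_primitive {φ : ℝ → ℝ} {C τ ε : ℝ} {q J K : ℕ} (hq : 1 ≤ q) (hτ : 0 < τ)
    (hφ : ∀ x, φ x ∈ Icc τ C) (hJ : C ≤ (1 + 1 / (q : ℝ)) ^ J)
    (hJ' : 1 + 1 / (q : ℝ) ≤ τ * (1 + 1 / (q : ℝ)) ^ J) (hK : 0 < K)
    (hmod : ∀ x y : ℝ, |x - y| ≤ 2 / K → |φ x - φ y| ≤ ε) (N : ℕ) :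
    ∃ h h' : ℝ → ℝ, Continuous h' ∧ (∀ x, HasDerivAt h (h' x) x) ∧ (∀ x, 0 < h' x) ∧ h 0 = 0 ∧
      (∀ x, 0 ≤ x → |h' x - φ x| ≤ C / q + ε) ∧
      ∀ x, 0 ≤ x → Compatible (1 + 1 / (q : ℝ)) (K * ((q * (q + 1) : ℕ) : ℝ) ^ (J + N)) N J x
        (h x) := by
  have hq0 : (0 : ℝ) < q := by positivity
  have hr1 : 1 < 1 + 1 / (q : ℝ) := by
    have : 0 < 1 / (q : ℝ) := by positivity
    linarith
  have hint := fun (m : ℤ) (n : ℕ) (hm : |m| ≤ n) => exists_int_eq_zpow_mul hq hm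
  choose j₀ hj₀ hj₀' using exists_quantized_slopes hq hτ hφ hJ hJ'
  generalize hr : 1 + 1 / (q : ℝ) = r at *
  generalize hQ : ((q * (q + 1) : ℕ) : ℝ) = Q at *
  have hQ0 : 0 < Q := by rw [← hQ]; positivity
  have hK' : (0 : ℝ) < K := by positivity
  set M : ℝ := K * Q ^ (J + N) with hM
  have hM0 : 0 < M := by positivity
  let j : ℕ → ℤ := fun l => j₀ (l / K)
  have hj : ∀ l, |j l| ≤ J := fun l => hj₀ _
  -- The first bound keeps the averaging window shorter than a cell. The second puts all phases of a
  -- point within ι of a node, and of its image, within 1/8 of an integer.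
  obtain ⟨ι, hι, hι1, hι2⟩ : ∃ ι : ℝ, 0 < ι ∧ ι ≤ 1 / (2 * K) ∧ r ^ N * M * (r ^ J * (ι + ι)) < 1 / 8 := by
    refine ⟨min (1 / (2 * K)) (1 / (32 * (r ^ N * M * r ^ J))), by positivity, min_le_left _ _, ?_⟩
    have h1 := min_le_right (1 / (2 * (K : ℝ))) (1 / (32 * (r ^ N * M * r ^ J)))
    have h2 : 0 < r ^ N * M * r ^ J := by positivity
    rw [le_div_iff₀ (by positivity)] at h1
    nlinarith
  -- The height of a node is a sum of terms r^j / K with |j| ≤ J, so K Q^J makes it an integer.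
  have hnode : ∀ l : ℕ, ∃ z : ℤ, stepPrim r K j (l / K) * (K * Q ^ J) = z := by
    intro l
    choose z hz using fun i => hint (j i) J (hj i)
    refine ⟨∑ i ∈ Finset.range l, z i, ?_⟩
    rw [stepPrim_node hr1 hj hK, Finset.sum_mul]
    push_cast
    refine Finset.sum_congr rfl fun i _ => ?_
    rw [← hz]
    field_simp
  have hzpow : ∀ m : ℤ, |m| ≤ N → r ^ m ≤ r ^ N := fun m hm => by
    rw [← zpow_natCast]
    exact zpow_le_zpow_right₀ hr1.le (abs_le.1 hm).2
  have hrJ : 1 ≤ r ^ J := one_le_pow₀ hr1.le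
  refine ⟨steklov r K j ι,
    fun x => (2 * ι)⁻¹ * (stepPrim r K j (x + ι) - stepPrim r K j (x - ι)), ?_,
    fun x => hasDerivAt_steklov hr1 hj ι x, fun x => ?_, ?_, fun x hx => ?_, fun x hx => ?_⟩
  · have := continuous_stepPrim hr1 hj (K := K)
    fun_prop
  · beta_reduce
    rw [stepPrim_sub hr1 hj]
    have h0 : 0 < (r ^ J)⁻¹ := by positivity
    have h1 := intervalIntegral.integral_mono_on (show x - ι ≤ x + ι by linarith)
      (intervalIntegrable_const (c := (r ^ J)⁻¹)) (intervalIntegrable_stepFun hr1 hj (K := K) _ _)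
      fun u _ => (stepFun_mem hr1 hj u).1
    rw [intervalIntegral.integral_const, smul_eq_mul] at h1
    have h2 : 0 < (x + ι - (x - ι)) * (r ^ J)⁻¹ := by
      apply mul_pos _ h0; linarith
    have h3 := h2.trans_le h1
    positivity
  · rw [steklov_of_mem hr1 hj hK hι (l := 0) (Or.inl rfl)]
    · simp [stepPrim]
    · refine (zero_add ι).le.trans (hι1.trans ?_)
      gcongr
      · simp
      · linarith
  · beta_reduce
    rw [stepPrim_sub hr1 hj]
    have h1 : (2 * ι)⁻¹ * (∫ u in (x - ι)..(x + ι), stepFun r K j u) - φ x =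
        (2 * ι)⁻¹ * ∫ u in (x - ι)..(x + ι), (stepFun r K j u - φ x) := by
      rw [intervalIntegral.integral_sub (intervalIntegrable_stepFun hr1 hj _ _) (by simp),
        intervalIntegral.integral_const, smul_eq_mul]
      field_simp
      ring
    have h2 : ‖∫ u in (x - ι)..(x + ι), (stepFun r K j u - φ x)‖ ≤
        (C / q + ε) * |x + ι - (x - ι)| := by
      refine intervalIntegral.norm_integral_le_of_norm_le_const fun u hu => ?_
      rw [uIoc_of_le (by linarith), mem_Ioc] at hu
      rw [Real.norm_eq_abs]
      unfold stepFun
      set l := ⌈K * u⌉₊ - 1 with hl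
      have e1 : |r ^ j l - φ (l / K)| ≤ C / q := hj₀' _
      have e2 : |φ (l / K) - φ x| ≤ ε := by
        apply hmod
        have e3 : (2 : ℝ) / K = 1 / K + 1 / (2 * K) + 1 / (2 * K) := by field_simp; norm_num
        have e4 : 0 < 1 / (K : ℝ) := by positivity
        rcases le_or_gt u 0 with hu0 | hu0
        · have : l = 0 := by
            rw [hl, Nat.ceil_eq_zero.2 (mul_nonpos_of_nonneg_of_nonpos hK'.le hu0)]
          rw [this, abs_le]
          constructor <;> simp <;> linarith
        · have e5 : 0 < ⌈K * u⌉₊ := Nat.ceil_pos.2 (by positivity)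
          have e6 : (l : ℝ) = ⌈K * u⌉₊ - 1 := by rw [hl, Nat.cast_sub e5]; simp
          have e7 := Nat.ceil_lt_add_one (a := K * u) (by positivity)
          have e8 := Nat.le_ceil (K * u)
          have e9 : (l : ℝ) / K ≤ u := by rw [div_le_iff₀ hK']; linarith
          have e10 : u - 1 / K ≤ (l : ℝ) / K := by
            rw [le_div_iff₀ hK', sub_mul, one_div, inv_mul_cancel₀ hK'.ne']
            linarith
          rw [abs_le]
          constructor <;> linarith
      exact (abs_sub_le _ (φ (l / K)) _).trans (add_le_add e1 e2)
    rw [h1, abs_mul, abs_of_pos (by positivity)]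
    rw [Real.norm_eq_abs, show x + ι - (x - ι) = 2 * ι by ring,
      abs_of_pos (by linarith : 0 < 2 * ι)] at h2
    calc (2 * ι)⁻¹ * _ ≤ (2 * ι)⁻¹ * ((C / q + ε) * (2 * ι)) := by gcongr
      _ = _ := by field_simp
  -- Near a node all phases are close to integers. Elsewhere the function is affine with slope r^(j
  -- l), and its offset is an integer at every scale because M carries the factor Q^(J + N).
  · by_cases hnear : ∃ l : ℕ, |x - l / K| < ι
    · obtain ⟨l, hl⟩ := hnear
      refine Or.inr fun m hm => ⟨?_, ?_⟩
      · obtain ⟨t, ht⟩ := hint m (J + N) (hm.trans (by push_cast; omega))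
        refine ⟨t * l, ?_⟩
        have e1 : r ^ m * M * x - ((t * l : ℤ) : ℝ) = r ^ m * M * (x - l / K) := by
          push_cast
          rw [← ht, hM]
          field_simp
        have hrm : 0 < r ^ m := by positivity
        rw [e1, abs_mul, abs_of_pos (by positivity)]
        refine lt_of_le_of_lt ?_ hι2
        have := hzpow m hm
        gcongr
        nlinarith
      · obtain ⟨t, ht⟩ := hint m N hm
        obtain ⟨z, hz⟩ := hnode l
        refine ⟨t * z, ?_⟩
        have e1 : r ^ m * M * steklov r K j ι x - ((t * z : ℤ) : ℝ) =
            r ^ m * M * (steklov r K j ι x - stepPrim r K j (l / K)) := by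
          push_cast
          rw [← ht, ← hz, hM, pow_add]
          ring
        have hrm : 0 < r ^ m := by positivity
        rw [e1, abs_mul, abs_of_pos (by positivity)]
        refine lt_of_le_of_lt ?_ hι2
        have := hzpow m hm
        have e2 := abs_steklov_sub_le hr1 hj hι (K := K) x (l / K)
        calc r ^ m * M * |steklov r K j ι x - stepPrim r K j (l / K)|
            ≤ r ^ N * M * (r ^ J * (|x - l / K| + ι)) := by gcongr
          _ ≤ _ := by gcongr
    · push Not at hnear
      set l := ⌊K * x⌋₊ with hl
      have e1 : (l : ℝ) / K ≤ x := by
        rw [div_le_iff₀ hK', mul_comm]; exact Nat.floor_le (by positivity)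
      have e2 : x < (l + 1) / K := by
        rw [lt_div_iff₀ hK', mul_comm]; exact Nat.lt_floor_add_one _
      have e3 := hnear l
      have e4 := hnear (l + 1)
      push_cast at e4
      rw [abs_of_nonneg (by linarith)] at e3
      rw [abs_of_nonpos (by linarith)] at e4
      obtain ⟨z, hz⟩ := hnode l
      refine Or.inl ⟨j l, hj l, fun m hm => ?_⟩
      obtain ⟨t, ht⟩ := hint m N hm
      obtain ⟨t', ht'⟩ := hint (j l) J (hj l)
      refine ⟨t * (z - t' * l), ?_⟩
      rw [steklov_of_mem hr1 hj hK hι (l := l) (Or.inr (by linarith)) (by linarith),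
        zpow_add₀ (by positivity)]
      push_cast
      rw [← ht, ← hz, ← ht', hM, pow_add]
      field_simp
      ring

/-- Compatibility is invariant under the reflection `x ↦ 1 - x`. -/
theorem Compatible.reflect {q J N K : ℕ} (hq : 1 ≤ q) {x y : ℝ}
    (h : Compatible (1 + 1 / (q : ℝ)) (K * ((q * (q + 1) : ℕ) : ℝ) ^ (J + N)) N J x y) :
    Compatible (1 + 1 / (q : ℝ)) (K * ((q * (q + 1) : ℕ) : ℝ) ^ (J + N)) N J (1 - x) (1 - y) := by
  have hint := fun (m : ℤ) (n : ℕ) (hm : |m| ≤ n) => exists_int_eq_zpow_mul hq hm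
  generalize ((q * (q + 1) : ℕ) : ℝ) = Q at *
  rcases h with ⟨j, hj, h⟩ | h
  · refine Or.inl ⟨j, hj, fun m hm => ?_⟩
    obtain ⟨t, ht⟩ := h m hm
    -- The scales r^m M with |m| ≤ J + N are integers, so reflection merely negates phases modulo 1.
    obtain ⟨t1, ht1⟩ := hint m (J + N) (hm.trans (by push_cast; omega))
    obtain ⟨t2, ht2⟩ := hint (m + j) (J + N) ((abs_add_le m j).trans (by push_cast; omega))
    refine ⟨K * t1 - K * t2 - t, ?_⟩
    push_cast
    rw [← ht1, ← ht2]
    linear_combination -ht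
  · refine Or.inr fun m hm => ?_
    obtain ⟨⟨s, hs⟩, ⟨t, ht⟩⟩ := h m hm
    obtain ⟨t1, ht1⟩ := hint m (J + N) (hm.trans (by push_cast; omega))
    refine ⟨⟨K * t1 - s, ?_⟩, ⟨K * t1 - t, ?_⟩⟩
    · push_cast
      rw [← ht1, abs_sub_comm]
      convert! hs using 2
      ring
    · push_cast
      rw [← ht1, abs_sub_comm]
      convert! ht using 2
      ring


/-! ### Almost invariant weights -/

/-- The distance to the nearest integer. -/
def distInt (x : ℝ) : ℝ := |x - round x|

theorem distInt_eq_norm (x : ℝ) : distInt x = ‖(x : UnitAddCircle)‖ :=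
  UnitAddCircle.norm_eq.symm

theorem continuous_distInt : Continuous distInt := by
  rw [show distInt = fun x : ℝ => ‖(x : UnitAddCircle)‖ from funext distInt_eq_norm]
  exact continuous_norm.comp (AddCircle.continuous_mk' 1)

theorem distInt_add_int (x : ℝ) (t : ℤ) : distInt (x + t) = distInt x := by
  simp [distInt]

theorem distInt_le (x : ℝ) (t : ℤ) : distInt x ≤ |x - t| := round_le x t

/-- The centres of `L` disjoint arcs of length `1 / (2 L)` in `[1/4, 3/4]`. -/
def arcCenter (L l : ℕ) : ℝ := 1 / 4 + (l + 1 / 2) / (2 * L)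

/-- The `1`-periodic tent function supported on the arc around `arcCenter L l`. -/
def arcBump (L l : ℕ) (y : ℝ) : ℝ := max 0 (1 - 4 * L * distInt (y - arcCenter L l))

theorem continuous_arcBump (L l : ℕ) : Continuous (arcBump L l) := by
  have := continuous_distInt
  unfold arcBump
  fun_prop

theorem arcBump_mem (L l : ℕ) (y : ℝ) : arcBump L l y ∈ Icc (0 : ℝ) 1 := by
  refine ⟨le_max_left _ _, max_le zero_le_one ?_⟩
  have : 0 ≤ 4 * L * distInt (y - arcCenter L l) :=
    mul_nonneg (by positivity) (abs_nonneg _)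
  linarith

theorem arcBump_add_int (L l : ℕ) (y : ℝ) (t : ℤ) : arcBump L l (y + t) = arcBump L l y := by
  unfold arcBump
  rw [show y + t - arcCenter L l = y - arcCenter L l + t by ring, distInt_add_int]

theorem exists_int_of_arcBump_pos {L l : ℕ} (hL : 0 < L) {y : ℝ} (h : 0 < arcBump L l y) :
    ∃ t : ℤ, |y - arcCenter L l - t| < 1 / (4 * L) := by
  refine ⟨round (y - arcCenter L l), ?_⟩
  unfold arcBump at h
  rcases lt_max_iff.1 h with h | h
  · exact absurd h (lt_irrefl _)
  · rw [lt_div_iff₀ (by positivity), mul_comm]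
    unfold distInt at h
    linarith

theorem arcBump_disjoint {L l l' : ℕ} (hl : l < L) (hl' : l' < L) {y : ℝ}
    (h : 0 < arcBump L l y) (h' : 0 < arcBump L l' y) : l = l' := by
  have hL : 0 < L := by omega
  have hL' : (0 : ℝ) < L := by positivity
  obtain ⟨t, ht⟩ := exists_int_of_arcBump_pos hL h
  obtain ⟨t', ht'⟩ := exists_int_of_arcBump_pos hL h'
  have h1 : |arcCenter L l - arcCenter L l' + (t - t')| < 1 / (2 * L) := by
    have e := abs_sub (y - arcCenter L l' - t') (y - arcCenter L l - t)
    have e2 : (1 : ℝ) / (4 * L) + 1 / (4 * L) = 1 / (2 * L) := by field_simp; norm_num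
    rw [show y - arcCenter L l' - t' - (y - arcCenter L l - t) =
      arcCenter L l - arcCenter L l' + (t - t') by ring] at e
    linarith
  -- Multiplied by 2L, the difference of the centres modulo 1 is an integer, of absolute value below
  -- 1.
  have h2 : arcCenter L l - arcCenter L l' + (t - t') =
      ((l - l' + 2 * L * (t - t') : ℤ) : ℝ) / (2 * L) := by
    unfold arcCenter
    push_cast
    field_simp
    ring
  rw [h2, abs_div, abs_of_pos (by positivity : (0 : ℝ) < 2 * L),
    div_lt_div_iff_of_pos_right (by positivity)] at h1
  have h3 : |(l - l' + 2 * L * (t - t') : ℤ)| < 1 := by exact_mod_cast h1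
  rw [Int.abs_lt_one_iff] at h3
  have h4 : t = t' := by
    by_contra hne
    rcases lt_or_gt_of_ne hne with h | h
    · nlinarith
    · nlinarith
  subst h4
  simp only [sub_self, mul_zero, add_zero] at h3
  omega

/-- The centres lie in [1/4, 3/4] and the tents reach at most 1/8 beyond them. This makes the second
alternative of `Compatible` harmless. -/
theorem arcBump_eq_zero {L l : ℕ} (hL : 2 ≤ L) (hl : l < L) {y : ℝ} {t : ℤ}
    (h : |y - t| < 1 / 8) : arcBump L l y = 0 := by
  have hL' : (2 : ℝ) ≤ L := by exact_mod_cast hL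
  by_contra hne
  obtain ⟨t', ht'⟩ := exists_int_of_arcBump_pos (by omega)
    (lt_of_le_of_ne (arcBump_mem L l y).1 (Ne.symm hne))
  have h1 : (1 : ℝ) / (4 * L) ≤ 1 / 8 := by gcongr; linarith
  have h2 : |arcCenter L l - (t - t' : ℤ)| < 1 / 4 := by
    have e := abs_sub (y - t) (y - arcCenter L l - t')
    rw [show y - t - (y - arcCenter L l - t') = arcCenter L l - (t - t' : ℤ) by
      push_cast; ring] at e
    linarith
  have h3 : 1 / 4 ≤ arcCenter L l := by
    unfold arcCenter
    have : 0 ≤ ((l : ℝ) + 1 / 2) / (2 * L) := by positivity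
    linarith
  have h4 : arcCenter L l ≤ 3 / 4 := by
    unfold arcCenter
    have hl' : (l : ℝ) + 1 ≤ L := by exact_mod_cast hl
    have : ((l : ℝ) + 1 / 2) / (2 * L) ≤ 1 / 2 := by
      rw [div_le_iff₀ (by positivity)]; linarith
    linarith
  rw [abs_lt] at h2
  have h5 : ((t - t' : ℤ) : ℝ) < 1 := by linarith
  have h6 : (0 : ℝ) < (t - t' : ℤ) := by linarith
  have h7 : t - t' < 1 := by exact_mod_cast h5
  have h8 : 0 < t - t' := by exact_mod_cast h6
  omega

/-- On the middle half of its support, of length 1/(4L), the tent is at least 1/2. -/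
theorem le_integral_arcBump {L l : ℕ} (hl : l < L) :
    1 / (8 * L) ≤ ∫ y in (0 : ℝ)..1, arcBump L l y := by
  have hL' : (0 : ℝ) < L := by have : 0 < L := by omega
                               positivity
  have hl' : (l : ℝ) + 1 ≤ L := by exact_mod_cast hl
  set α := arcCenter L l with hα
  have h2 : (1 : ℝ) / (8 * L) ≤ 1 / 4 + (l + 1 / 2) / (2 * L) := by
    rw [div_add_div _ _ (by norm_num) (by positivity), div_le_div_iff₀ (by positivity)
      (by positivity)]
    nlinarith
  have h3 : 1 / 4 + (l + 1 / 2) / (2 * (L : ℝ)) + 1 / (8 * L) ≤ 1 := by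
    have e1 : ((l : ℝ) + 1 / 2) / (2 * L) ≤ (L - 1 / 2) / (2 * L) := by gcongr; linarith
    have e2 : ((L : ℝ) - 1 / 2) / (2 * L) + 1 / (8 * L) ≤ 1 / 2 := by
      rw [div_add_div _ _ (by positivity) (by positivity), div_le_div_iff₀ (by positivity)
      (by positivity)]
      nlinarith
    linarith
  have hint : ∀ a b, IntervalIntegrable (arcBump L l) volume a b := fun a b =>
    (continuous_arcBump L l).intervalIntegrable a b
  have hpos : (0 : ℝ) < 1 / (8 * L) := by positivity
  have h4 : ∫ y in (α - 1 / (8 * L))..(α + 1 / (8 * L)), arcBump L l y ≤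
      ∫ y in (0 : ℝ)..1, arcBump L l y := by
    refine intervalIntegral.integral_mono_interval ?_ ?_ ?_ ?_ (hint _ _)
    · rw [hα, arcCenter]; linarith
    · linarith
    · rw [hα, arcCenter]; linarith
    · exact Eventually.of_forall fun y => (arcBump_mem L l y).1
  refine le_trans ?_ h4
  have h5 := intervalIntegral.integral_mono_on (a := α - 1 / (8 * L)) (b := α + 1 / (8 * L))
    (by linarith) (intervalIntegrable_const (c := (1 / 2 : ℝ))) (hint _ _) (fun y hy => ?_)
  · refine le_trans (le_of_eq ?_) h5
    rw [intervalIntegral.integral_const, smul_eq_mul]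
    ring
  · refine le_trans ?_ (le_max_right _ _)
    have e1 := distInt_le (y - α) 0
    have e2 : |y - α - (0 : ℤ)| ≤ 1 / (8 * L) := by
      rw [abs_le]; push_cast; constructor <;> linarith [hy.1, hy.2]
    have e3 : 4 * L * distInt (y - α) ≤ 4 * L * (1 / (8 * L)) := by gcongr; exact e1.trans e2
    have e4 : 4 * (L : ℝ) * (1 / (8 * L)) = 1 / 2 := by field_simp; norm_num
    linarith

/-- The weight `δ + ∑_{|m| ≤ N} ρ ^ |m| χ (r ^ m M x)`. -/
def weight (δ ρ r M : ℝ) (N : ℕ) (χ : ℝ → ℝ) (x : ℝ) : ℝ :=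
  δ + ∑ m ∈ Finset.Icc (-N : ℤ) N, ρ ^ m.natAbs * χ (r ^ m * M * x)

/-- A shift by at most J changes each coefficient ρ^|m| by a factor at most ρ^(-J) ≤ 1 + θ. Indices
pushed out of the window have coefficient at most ρ^(N-J), and all of them together contribute at
most θδ. -/
theorem sum_shift_le {ρ θ δ : ℝ} {N J : ℕ} (hρ : 0 < ρ) (hρ1 : ρ ≤ 1) (hθ : 1 ≤ (1 + θ) * ρ ^ J)
    (htail : (2 * N + 1) * ρ ^ N ≤ θ * δ * ρ ^ J) {X : ℤ → ℝ} (hX : ∀ m, X m ∈ Icc (0 : ℝ) 1)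
    {j : ℤ} (hj : |j| ≤ J) :
    ∑ m ∈ Finset.Icc (-N : ℤ) N, ρ ^ m.natAbs * X (m + j) ≤
      (1 + θ) * ∑ m ∈ Finset.Icc (-N : ℤ) N, ρ ^ m.natAbs * X m + θ * δ := by
  have hρJ : 0 < ρ ^ J := by positivity
  have hθ0 : 0 ≤ 1 + θ := by
    by_contra h
    push Not at h
    nlinarith
  rw [Int.abs_eq_natAbs] at hj
  let F : ℤ → ℝ := fun m => if m ∈ Finset.Icc (-N : ℤ) N then ρ ^ m.natAbs * X m else 0
  have hF : ∀ m, 0 ≤ ρ ^ m.natAbs * X m := fun m => mul_nonneg (by positivity) (hX m).1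
  have h1 : ∀ m ∈ Finset.Icc (-N : ℤ) N, ρ ^ m.natAbs * X (m + j) ≤
      (1 + θ) * F (m + j) + ρ ^ N / ρ ^ J := by
    intro m hm
    by_cases h : m + j ∈ Finset.Icc (-N : ℤ) N
    · simp only [F, if_pos h]
      have e1 : ρ ^ m.natAbs ≤ (1 + θ) * ρ ^ (m + j).natAbs := by
        have e2 : ρ ^ (m.natAbs + J) ≤ ρ ^ (m + j).natAbs :=
          pow_le_pow_of_le_one hρ.le hρ1 (by omega)
        calc ρ ^ m.natAbs ≤ ρ ^ m.natAbs * ((1 + θ) * ρ ^ J) :=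
              le_mul_of_one_le_right (by positivity) hθ
          _ = (1 + θ) * ρ ^ (m.natAbs + J) := by rw [pow_add]; ring
          _ ≤ _ := by gcongr
      have e3 := mul_le_mul_of_nonneg_right e1 (hX (m + j)).1
      have e4 : 0 ≤ ρ ^ N / ρ ^ J := by positivity
      linarith
    · simp only [F, if_neg h, mul_zero, zero_add]
      rw [le_div_iff₀ hρJ]
      have e2 : ρ ^ (m.natAbs + J) ≤ ρ ^ N := by
        refine pow_le_pow_of_le_one hρ.le hρ1 ?_
        rw [Finset.mem_Icc] at h hm
        omega
      rw [pow_add] at e2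
      have := (hX (m + j)).2
      have := (hX (m + j)).1
      nlinarith [mul_nonneg (by positivity : 0 ≤ ρ ^ m.natAbs) hρJ.le]
  refine (Finset.sum_le_sum h1).trans ?_
  rw [Finset.sum_add_distrib, ← Finset.mul_sum, Finset.sum_const, Int.card_Icc, nsmul_eq_mul]
  have h2 : ∑ m ∈ Finset.Icc (-N : ℤ) N, F (m + j) ≤
      ∑ m ∈ Finset.Icc (-N : ℤ) N, ρ ^ m.natAbs * X m := by
    have e0 := Finset.sum_map (Finset.Icc (-N : ℤ) N) (addRightEmbedding j) F
    simp only [addRightEmbedding_apply] at e0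
    rw [← e0, ← Finset.sum_filter_ne_zero]
    refine (Finset.sum_congr rfl fun m hm => ?_).le.trans
      (Finset.sum_le_sum_of_subset_of_nonneg (f := fun m => ρ ^ m.natAbs * X m) ?_
        fun m _ _ => hF m)
    · have : m ∈ Finset.Icc (-N : ℤ) N := by
        by_contra h
        exact (Finset.mem_filter.1 hm).2 (if_neg h)
      exact if_pos this
    · intro m hm
      by_contra h
      exact (Finset.mem_filter.1 hm).2 (if_neg h)
  have h3 : (((N : ℤ) + 1 - -N).toNat : ℝ) * (ρ ^ N / ρ ^ J) ≤ θ * δ := by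
    have : ((N : ℤ) + 1 - -N).toNat = 2 * N + 1 := by omega
    rw [this, ← mul_div_assoc, div_le_iff₀ hρJ]
    push_cast
    exact htail
  gcongr

/-- In the first alternative of `Compatible` the tents see the same phases with a shifted index, and
the additive error θδ is absorbed since the weight contains δ. In the second alternative both
weights equal δ. -/
theorem weight_le_of_compatible {δ ρ θ r M : ℝ} {N J L l : ℕ} (hδ : 0 < δ) (hρ : 0 < ρ)
    (hρ1 : ρ ≤ 1) (hθ0 : 0 ≤ θ) (hθ : 1 ≤ (1 + θ) * ρ ^ J)
    (htail : (2 * N + 1) * ρ ^ N ≤ θ * δ * ρ ^ J)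
    (hL : 2 ≤ L) (hl : l < L) {x y : ℝ} (h : Compatible r M N J x y) :
    weight δ ρ r M N (arcBump L l) y ≤ (1 + θ) * weight δ ρ r M N (arcBump L l) x ∧
    weight δ ρ r M N (arcBump L l) x ≤ (1 + θ) * weight δ ρ r M N (arcBump L l) y := by
  unfold weight
  rcases h with ⟨j, hj, h⟩ | h
  · let X : ℤ → ℝ := fun m => arcBump L l (r ^ m * M * x)
    have hX : ∀ m, X m ∈ Icc (0 : ℝ) 1 := fun m => arcBump_mem _ _ _
    have hy : ∑ m ∈ Finset.Icc (-N : ℤ) N, ρ ^ m.natAbs * arcBump L l (r ^ m * M * y) =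
        ∑ m ∈ Finset.Icc (-N : ℤ) N, ρ ^ m.natAbs * X (m + j) := by
      refine Finset.sum_congr rfl fun m hm => ?_
      obtain ⟨t, ht⟩ := h m (abs_le.2 (Finset.mem_Icc.1 hm))
      rw [ht, arcBump_add_int]
    rw [hy]
    have h1 := sum_shift_le hρ hρ1 hθ htail hX hj
    -- The reverse inequality is the same estimate, for the shifted sequence and the shift -j.
    have h2 := sum_shift_le hρ hρ1 hθ htail (X := fun m => X (m + j)) (fun m => hX _)
      (j := -j) (by rwa [abs_neg])
    simp only [neg_add_cancel_right] at h2
    exact ⟨by linarith, by linarith⟩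
  · have hz : ∀ m ∈ Finset.Icc (-N : ℤ) N, ρ ^ m.natAbs * arcBump L l (r ^ m * M * x) = 0 ∧
        ρ ^ m.natAbs * arcBump L l (r ^ m * M * y) = 0 := by
      intro m hm
      obtain ⟨⟨s, hs⟩, ⟨t, ht⟩⟩ := h m (abs_le.2 (Finset.mem_Icc.1 hm))
      rw [arcBump_eq_zero hL hl hs, arcBump_eq_zero hL hl ht]
      simp
    rw [Finset.sum_eq_zero fun m hm => (hz m hm).1, Finset.sum_eq_zero fun m hm => (hz m hm).2]
    constructor <;> nlinarith

theorem sum_pow_natAbs_mem {ρ : ℝ} {N : ℕ} (hρ : 0 < ρ) (hρ1 : ρ ≤ 1) :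
    ∑ m ∈ Finset.Icc (-N : ℤ) N, ρ ^ m.natAbs ∈ Icc (1 : ℝ) (2 * N + 1) := by
  constructor
  · have := Finset.single_le_sum (f := fun m : ℤ => ρ ^ m.natAbs) (s := Finset.Icc (-N : ℤ) N)
      (fun m _ => by positivity) (a := 0) (by simp)
    simpa using this
  · refine (Finset.sum_le_sum fun m _ => pow_le_one₀ hρ.le hρ1).trans ?_
    rw [Finset.sum_const, Int.card_Icc, nsmul_eq_mul, mul_one,
      show ((N : ℤ) + 1 - -N).toNat = 2 * N + 1 by omega]
    push_cast
    rfl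

theorem weight_mem {δ ρ r M : ℝ} {N L l : ℕ} (hρ : 0 < ρ) (hρ1 : ρ ≤ 1) (x : ℝ) :
    weight δ ρ r M N (arcBump L l) x ∈ Icc δ (δ + (2 * N + 1)) := by
  have h := (sum_pow_natAbs_mem (N := N) hρ hρ1).2
  constructor
  · exact le_add_of_nonneg_right (Finset.sum_nonneg fun m _ =>
      mul_nonneg (by positivity) (arcBump_mem _ _ _).1)
  · refine add_le_add_right (le_trans (Finset.sum_le_sum fun m _ => ?_) h) δ
    exact mul_le_of_le_one_right (by positivity) (arcBump_mem _ _ _).2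

theorem continuous_weight (δ ρ r M : ℝ) (N L l : ℕ) :
    Continuous (weight δ ρ r M N (arcBump L l)) := by
  have := continuous_arcBump L l
  unfold weight
  fun_prop

/-! ### Averages of rapidly oscillating weights -/

/-- The primitive of χ minus its mean is periodic and bounded by 1; speeding up the argument by c
divides it by c. -/
theorem abs_integral_periodic_sub_le {χ : ℝ → ℝ} (hχ : Continuous χ)
    (hp : Function.Periodic χ 1) (hm : ∀ x, χ x ∈ Icc (0 : ℝ) 1) {c : ℝ} (hc : 0 < c) (x : ℝ) :
    |(∫ y in (0 : ℝ)..x, χ (c * y)) - (∫ y in (0 : ℝ)..1, χ y) * x| ≤ 1 / c := by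
  set b := ∫ y in (0 : ℝ)..1, χ y with hb
  have hi : ∀ u v, IntervalIntegrable χ volume u v := fun u v => hχ.intervalIntegrable u v
  have hb01 : b ∈ Icc (0 : ℝ) 1 := by
    constructor
    · exact intervalIntegral.integral_nonneg zero_le_one fun u _ => (hm u).1
    · have := intervalIntegral.integral_mono_on zero_le_one (hi 0 1)
        (intervalIntegrable_const (c := (1 : ℝ))) fun u _ => (hm u).2
      simpa using this
  let F : ℝ → ℝ := fun y => (∫ u in (0 : ℝ)..y, χ u) - b * y
  have hF : Function.Periodic F 1 := by
    intro y
    have h1 := intervalIntegral.integral_add_adjacent_intervals (hi 0 y) (hi y (y + 1))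
    have h2 := hp.intervalIntegral_add_eq y 0
    rw [zero_add] at h2
    simp only [F]
    rw [← h1, h2]
    ring
  have hF1 : ∀ y, |F y| ≤ 1 := by
    intro y
    have h1 : F y = F (Int.fract y) := by
      have := hF.sub_zsmul_eq (x := y) ⌊y⌋
      rw [zsmul_eq_mul, mul_one, Int.self_sub_floor] at this
      exact this.symm
    rw [h1]
    have h2 := Int.fract_nonneg y
    have h3 := (Int.fract_lt_one y).le
    generalize Int.fract y = z at *
    have h4 : F z = ∫ u in (0 : ℝ)..z, (χ u - b) := by
      rw [intervalIntegral.integral_sub (hi _ _) (by simp), intervalIntegral.integral_const,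
        smul_eq_mul]
      simp only [F]
      ring
    have h5 := intervalIntegral.norm_integral_le_of_norm_le_const (a := 0) (b := z) (C := 1)
      (f := fun u => χ u - b) fun u _ => by
        rw [Real.norm_eq_abs, abs_le]
        constructor <;> linarith [(hm u).1, (hm u).2, hb01.1, hb01.2]
    rw [h4, ← Real.norm_eq_abs]
    rw [sub_zero, abs_of_nonneg h2] at h5
    linarith
  have h := hF1 (c * x)
  rw [intervalIntegral.integral_comp_mul_left χ hc.ne', mul_zero, smul_eq_mul]
  have e : c⁻¹ * (∫ u in (0 : ℝ)..(c * x), χ u) - b * x = F (c * x) / c := by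
    simp only [F]
    field_simp
  rw [e, abs_div, abs_of_pos hc]
  gcongr

theorem abs_integral_weight_sub_le {δ ρ r M : ℝ} {N L l : ℕ} (hρ : 0 < ρ) (hρ1 : ρ ≤ 1)
    {b : ℝ} (hb : 0 < b) (hM : ∀ m : ℤ, |m| ≤ N → b ≤ r ^ m * M) (x : ℝ) :
    |(∫ y in (0 : ℝ)..x, weight δ ρ r M N (arcBump L l) y) -
      (δ + (∑ m ∈ Finset.Icc (-N : ℤ) N, ρ ^ m.natAbs) * ∫ y in (0 : ℝ)..1, arcBump L l y) * x| ≤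
      (2 * N + 1) / b := by
  have hc := continuous_arcBump L l
  have hp : Function.Periodic (arcBump L l) 1 := fun y => by
    simpa using arcBump_add_int L l y 1
  unfold weight
  rw [intervalIntegral.integral_add (by simp) (Continuous.intervalIntegrable (by fun_prop) _ _),
    intervalIntegral.integral_finsetSum
      fun m _ => Continuous.intervalIntegrable (by fun_prop) _ _]
  simp only [intervalIntegral.integral_const_mul, intervalIntegral.integral_const, smul_eq_mul,
    sub_zero]
  set b₀ := ∫ y in (0 : ℝ)..1, arcBump L l y
  have e : x * δ + (∑ m ∈ Finset.Icc (-N : ℤ) N,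
        ρ ^ m.natAbs * ∫ y in (0 : ℝ)..x, arcBump L l (r ^ m * M * y)) -
      (δ + (∑ m ∈ Finset.Icc (-N : ℤ) N, ρ ^ m.natAbs) * b₀) * x =
      ∑ m ∈ Finset.Icc (-N : ℤ) N, ρ ^ m.natAbs *
        ((∫ y in (0 : ℝ)..x, arcBump L l (r ^ m * M * y)) - b₀ * x) := by
    simp only [mul_sub, Finset.sum_sub_distrib]
    rw [← Finset.sum_mul]
    ring
  rw [e]
  refine (Finset.abs_sum_le_sum_abs _ _).trans ?_
  have h := sum_pow_natAbs_mem (N := N) hρ hρ1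
  calc ∑ m ∈ Finset.Icc (-N : ℤ) N, |ρ ^ m.natAbs *
        ((∫ y in (0 : ℝ)..x, arcBump L l (r ^ m * M * y)) - b₀ * x)|
      ≤ ∑ m ∈ Finset.Icc (-N : ℤ) N, ρ ^ m.natAbs * (1 / b) := by
        refine Finset.sum_le_sum fun m hm => ?_
        have hm' := hM m (abs_le.2 (Finset.mem_Icc.1 hm))
        rw [abs_mul, abs_of_pos (by positivity)]
        have := abs_integral_periodic_sub_le hc hp (arcBump_mem L l) (hb.trans_le hm') x
        refine mul_le_mul_of_nonneg_left (this.trans ?_) (by positivity)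
        gcongr
    _ = (∑ m ∈ Finset.Icc (-N : ℤ) N, ρ ^ m.natAbs) * (1 / b) := by rw [Finset.sum_mul]
    _ ≤ (2 * N + 1) * (1 / b) := by gcongr; exact h.2
    _ = _ := by ring


/-! ### Conjugation by the primitive of a weight -/

/-- For every probability measure, some arc is rarely visited by all the phases `r ^ m * M * x`. -/
theorem exists_arc (μ : Measure I) [IsProbabilityMeasure μ] (r M : ℝ) (N : ℕ) {L : ℕ} (hL : 0 < L) :
    ∃ l < L, μ.real {x : I | ∃ m ∈ Finset.Icc (-N : ℤ) N, 0 < arcBump L l (r ^ m * M * x)} ≤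
      (2 * N + 1) / L := by
  let E : ℤ → ℕ → Set I := fun m l => {x : I | 0 < arcBump L l (r ^ m * M * x)}
  have hE : ∀ m l, MeasurableSet (E m l) := fun m l =>
    measurableSet_lt measurable_const (((continuous_arcBump L l).comp
      (by fun_prop : Continuous fun x : I => r ^ m * M * x)).measurable)
  -- For fixed m the L sets are disjoint; summing over the 2N + 1 scales and averaging over the arcs
  -- gives a good arc.
  have h1 : ∀ m, ∑ l ∈ Finset.range L, μ.real (E m l) ≤ 1 := by
    intro m
    rw [← measureReal_biUnion_finset]
    · exact measureReal_le_one
    · intro l hl l' hl' hne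
      rw [Function.onFun, Set.disjoint_left]
      intro x hx hx'
      exact hne (arcBump_disjoint (by simpa using hl) (by simpa using hl') hx hx')
    · exact fun l _ => hE m l
  have h2 : ∑ l ∈ Finset.range L, ∑ m ∈ Finset.Icc (-N : ℤ) N, μ.real (E m l) ≤
      ∑ l ∈ Finset.range L, ((2 * N + 1) / L : ℝ) := by
    rw [Finset.sum_comm]
    refine (Finset.sum_le_sum fun m _ => h1 m).trans ?_
    rw [Finset.sum_const, Finset.sum_const, Int.card_Icc, Finset.card_range, nsmul_eq_mul,
      nsmul_eq_mul, show ((N : ℤ) + 1 - -N).toNat = 2 * N + 1 by omega]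
    have : (0 : ℝ) < L := by positivity
    field_simp
    push_cast
    rfl
  obtain ⟨l, hl, h⟩ := Finset.exists_le_of_sum_le (by simpa using hL.ne') h2
  refine ⟨l, by simpa using hl, le_trans ?_ h⟩
  have : {x : I | ∃ m ∈ Finset.Icc (-N : ℤ) N, 0 < arcBump L l (r ^ m * M * x)} =
      ⋃ m ∈ Finset.Icc (-N : ℤ) N, E m l := by
    ext x; simp [E]
  rw [this]
  exact measureReal_biUnion_finset_le _ _

/-- The normalised primitive of a positive weight. -/
theorem exists_homeomorph_of_weight {w : ℝ → ℝ} (hw : Continuous w) {δ : ℝ} (hδ : 0 < δ)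
    (hδw : ∀ x, δ ≤ w x) :
    ∃ ψ : ℝ ≃ₜ ℝ, StrictMono ψ ∧ ψ 0 = 0 ∧ ψ 1 = 1 ∧
      (∀ x, ψ x = (∫ u in (0 : ℝ)..x, w u) / ∫ u in (0 : ℝ)..1, w u) ∧
      ∀ x, HasDerivAt ψ (w x / ∫ u in (0 : ℝ)..1, w u) x := by
  have hi : ∀ a b, IntervalIntegrable w volume a b := fun a b => hw.intervalIntegrable a b
  have hlow : ∀ a b, a ≤ b → δ * (b - a) ≤ ∫ u in a..b, w u := by
    intro a b hab
    have := intervalIntegral.integral_mono_on hab (intervalIntegrable_const (c := δ)) (hi a b)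
      fun u _ => hδw u
    rw [intervalIntegral.integral_const, smul_eq_mul] at this
    linarith
  set T := ∫ u in (0 : ℝ)..1, w u with hT
  have hT0 : 0 < T := by have := hlow 0 1 zero_le_one
                         linarith
  let f : ℝ → ℝ := fun x => (∫ u in (0 : ℝ)..x, w u) / T
  have hf : ∀ x, HasDerivAt f (w x / T) x := fun x =>
    (hw.integral_hasStrictDerivAt 0 x).hasDerivAt.div_const T
  have hsub : ∀ a b, a ≤ b → δ / T * (b - a) ≤ f b - f a := by
    intro a b hab
    simp only [f]
    rw [← sub_div, intervalIntegral.integral_interval_sub_left (hi _ _) (hi _ _), div_mul_eq_mul_div]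
    gcongr
    exact hlow a b hab
  have hδT : 0 < δ / T := by positivity
  have hmono : StrictMono f := by
    intro a b hab
    have := hsub a b hab.le
    have := mul_pos hδT (sub_pos.2 hab)
    linarith
  have hcont : Continuous f := continuous_iff_continuousAt.2 fun x => (hf x).continuousAt
  have hf0 : f 0 = 0 := by simp [f]
  have hsurj : Function.Surjective f := by
    refine hcont.surjective ?_ ?_
    · refine tendsto_atTop_mono' _ ?_ ((tendsto_id (α := ℝ)).const_mul_atTop hδT)
      filter_upwards [eventually_ge_atTop 0] with x hx
      have := hsub 0 x hx
      rw [hf0] at this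
      simpa using this
    · refine tendsto_atBot_mono' _ ?_ ((tendsto_id (α := ℝ)).const_mul_atBot hδT)
      filter_upwards [eventually_le_atBot 0] with x hx
      have := hsub x 0 hx
      rw [hf0] at this
      simp only [id_eq]
      linarith
  refine ⟨(hmono.orderIsoOfSurjective f hsurj).toHomeomorph, hmono, hf0, ?_, fun x => rfl, hf⟩
  exact div_self hT0.ne'

namespace IFS

variable {β : Ioo (0 : ℝ) (1 / 2)} {k : ℕ}

theorem markov_conj (S T : IFS β k) (hp : T.prob = S.prob) (Ψ : I ≃ₜ I)
    (hΨ : ∀ i, T.map i = Ψ.symm.trans ((S.map i).trans Ψ)) {μ : Measure I}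
    (hμ : S.markov μ = μ) : T.markov (μ.map Ψ) = μ.map Ψ := by
  refine Measure.ext fun A hA => ?_
  rw [markov_apply _ _ hA, Measure.map_apply Ψ.measurable hA]
  conv_rhs => rw [← hμ, markov_apply _ _ (Ψ.measurable hA)]
  refine Finset.sum_congr rfl fun i _ => ?_
  rw [hp, Measure.map_apply Ψ.measurable ((T.map i).measurable hA), hΨ]
  congr 2
  ext x
  simp

/-- A system whose maps are given by `C¹` functions near the end points, conjugated by a `C¹`
diffeomorphism with nearly invariant derivative. -/
theorem exists_conj (S : IFS β k) {a : ℝ} (ha : (β : ℝ) < a) (ha2 : a < 1 / 2)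
    (hAC : ∀ i, AbsolutelyContinuousOnInterval (ext (S.map i)) 0 1)
    {FL FL' FR FR' : Fin k → ℝ → ℝ} (hFL : ∀ i x, HasDerivAt (FL i) (FL' i x) x)
    (hFR : ∀ i x, HasDerivAt (FR i) (FR' i x) x) (hFLc : ∀ i, Continuous (FL' i))
    (hFRc : ∀ i, Continuous (FR' i)) (hL : ∀ i, EqOn (ext (S.map i)) (FL i) (Icc 0 a))
    (hR : ∀ i, EqOn (ext (S.map i)) (FR i) (Icc (1 - a) 1))
    {ψ : ℝ ≃ₜ ℝ} {v : ℝ → ℝ} (hψ : StrictMono ψ) (hψ0 : ψ 0 = 0) (hψ1 : ψ 1 = 1)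
    (hv : Continuous v) (hv0 : ∀ x, 0 < v x) (hψv : ∀ x, HasDerivAt ψ (v x) x) {κ : ℝ}
    (hκ : ∀ x ∈ Icc (0 : ℝ) 1, |ψ x - x| ≤ κ) (hκa : β + κ ≤ a) :
    ∃ (T : IFS β k) (Ψ : I ≃ₜ I), T.prob = S.prob ∧ (∀ x : I, (Ψ x : ℝ) = ψ x) ∧
      (∀ i, T.map i = Ψ.symm.trans ((S.map i).trans Ψ)) ∧
      (∀ i, AbsolutelyContinuousOnInterval (ext (T.map i)) 0 1) ∧
      (∀ i, ∀ y ∈ Icc (0 : ℝ) β, ∃ x ∈ Icc (0 : ℝ) a, ψ x = y ∧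
        endDeriv β (T.map i) y = FL' i x * (v (FL i x) / v x)) ∧
      ∀ i, ∀ y ∈ Icc (1 - β : ℝ) 1, ∃ x ∈ Icc (1 - a) 1, ψ x = y ∧
        endDeriv β (T.map i) y = FR' i x * (v (FR i x) / v x) := by
  obtain ⟨Ψ, hΨm, hΨ⟩ := exists_homeomorph_of_strictMonoOn ψ.continuous.continuousOn
    (hψ.strictMonoOn _) hψ0 hψ1
  have hΨ' : ∀ x : I, (Ψ x : ℝ) = ψ x := fun x => by rw [← hΨ x.2, ext_apply]
  have hΨs : ∀ y : I, (Ψ.symm y : ℝ) = ψ.symm y := fun y => by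
    rw [eq_comm, Homeomorph.symm_apply_eq, ← hΨ', Homeomorph.apply_symm_apply]
  have hβ := β.2
  have hψs : ∀ y, HasDerivAt ψ.symm (v (ψ.symm y))⁻¹ y := fun y =>
    HasDerivAt.of_local_left_inverse ψ.symm.continuous.continuousAt (hψv _) (hv0 _).ne'
      (Eventually.of_forall ψ.apply_symm_apply)
  have hψsm : StrictMono ψ.symm := by
    intro x y hxy
    rw [← hψ.lt_iff_lt, ψ.apply_symm_apply, ψ.apply_symm_apply]
    exact hxy
  have hψs0 : ψ.symm 0 = 0 := by rw [Homeomorph.symm_apply_eq, hψ0]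
  have hψs1 : ψ.symm 1 = 1 := by rw [Homeomorph.symm_apply_eq, hψ1]
  have hcd : ∀ F F' : ℝ → ℝ, (∀ x, HasDerivAt F (F' x) x) → Continuous F' → ContDiff ℝ 1 F := by
    intro F F' h hc
    refine contDiff_one_iff_deriv.2 ⟨fun x => (h x).differentiableAt, ?_⟩
    rwa [show deriv F = F' from funext fun x => (h x).deriv]
  have hψc : ContDiff ℝ 1 ψ := hcd _ _ hψv hv
  have hψsc : ContDiff ℝ 1 ψ.symm := hcd _ _ hψs
    ((hv.comp ψ.symm.continuous).inv₀ fun y => (hv0 _).ne')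
  -- ψ moves points by at most κ ≤ a - β, so the preimage of the end interval stays where the branch
  -- equals `FL`.
  have hLs : ∀ y ∈ Icc (0 : ℝ) β, ψ.symm y ∈ Icc 0 a := by
    intro y hy
    refine ⟨by rw [← hψs0]; exact hψsm.monotone hy.1, ?_⟩
    rw [← hψ.le_iff_le, ψ.apply_symm_apply]
    have := (abs_le.1 (hκ a ⟨by linarith [hβ.1], by linarith⟩)).1
    linarith [hy.2]
  have hRs : ∀ y ∈ Icc (1 - β : ℝ) 1, ψ.symm y ∈ Icc (1 - a) 1 := by
    intro y hy
    refine ⟨?_, by rw [← hψs1]; exact hψsm.monotone hy.2⟩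
    rw [← hψ.le_iff_le, ψ.apply_symm_apply]
    have := (abs_le.1 (hκ (1 - a) ⟨by linarith, by linarith [hβ.1]⟩)).2
    linarith [hy.1]
  let e : Fin k → I ≃ₜ I := fun i => Ψ.symm.trans ((S.map i).trans Ψ)
  have hem : ∀ i, Monotone (e i) := by
    intro i x y hxy
    refine hΨm.monotone ((S.strictMono i).monotone ?_)
    change Ψ.symm x ≤ Ψ.symm y
    rw [← hΨm.le_iff_le, Ψ.apply_symm_apply, Ψ.apply_symm_apply]
    exact hxy
  have hext : ∀ i, ∀ y ∈ Icc (0 : ℝ) 1, ext (e i) y = ψ (ext (S.map i) (ψ.symm y)) := by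
    intro i y hy
    have h1 : ψ.symm y = ((Ψ.symm ⟨y, hy⟩ : I) : ℝ) := by rw [hΨs]
    rw [ext_of_mem _ hy, h1, ext_apply, ← hΨ']
    rfl
  have hextL : ∀ i, EqOn (ext (e i)) (ψ ∘ FL i ∘ ψ.symm) (Icc 0 β) := by
    intro i y hy
    rw [hext i y ⟨hy.1, by linarith [hy.2, hβ.2]⟩, hL i (hLs y hy)]
    rfl
  have hextR : ∀ i, EqOn (ext (e i)) (ψ ∘ FR i ∘ ψ.symm) (Icc (1 - β) 1) := by
    intro i y hy
    rw [hext i y ⟨by linarith [hy.1, hβ.2], hy.2⟩, hR i (hRs y hy)]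
    rfl
  have hder : ∀ (F F' : ℝ → ℝ), (∀ x, HasDerivAt F (F' x) x) → ∀ y, HasDerivAt (ψ ∘ F ∘ ψ.symm)
      (F' (ψ.symm y) * (v (F (ψ.symm y)) / v (ψ.symm y))) y := by
    intro F F' h y
    have h1 := ((hψv (F (ψ.symm y))).comp (ψ.symm y) (h _)).comp y (hψs y)
    refine h1.congr_deriv ?_
    rw [div_eq_mul_inv]
    ring
  refine ⟨⟨e, S.prob, fun i => ?_, S.prob_mem⟩, Ψ, rfl, hΨ', fun i => rfl, fun i => ?_,
    fun i y hy => ⟨ψ.symm y, hLs y hy, ψ.apply_symm_apply y, ?_⟩,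
    fun i y hy => ⟨ψ.symm y, hRs y hy, ψ.apply_symm_apply y, ?_⟩⟩
  · exact mem_CPlus_of_eqOn (hem i) (hψc.comp ((hcd _ _ (hFL i) (hFLc i)).comp hψsc))
      (hψc.comp ((hcd _ _ (hFR i) (hFRc i)).comp hψsc)) (hextL i) (hextR i)
  -- Absolute continuity survives conjugation because ψ and its inverse are increasing and Lipschitz
  -- on the interval.
  · obtain ⟨K, hK⟩ := (hψc.contDiffOn (s := Icc 0 1)).exists_lipschitzOnWith (by decide)
      (convex_Icc (0 : ℝ) 1) isCompact_Icc
    obtain ⟨K', hK'⟩ := (hψsc.contDiffOn (s := Icc 0 1)).exists_lipschitzOnWith (by decide)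
      (convex_Icc (0 : ℝ) 1) isCompact_Icc
    have hmaps : MapsTo ψ.symm (Icc 0 1) (Icc 0 1) := fun y hy =>
      ⟨by rw [← hψs0]; exact hψsm.monotone hy.1, by rw [← hψs1]; exact hψsm.monotone hy.2⟩
    refine absolutelyContinuousOnInterval_congr (lipschitz_comp_absolutelyContinuousOnInterval
      (absolutelyContinuousOnInterval_comp_monotoneOn zero_le_one (hAC i) hK'
        (hψsm.monotone.monotoneOn _) hmaps) hK fun x _ => ext_mem _ _) ?_
    intro y hy
    rw [uIcc_of_le zero_le_one] at hy
    exact (hext i y hy).symm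
  · exact endDeriv_eq_left β.2 (hder _ _ (hFL i) y) (hextL i) hy
  · exact endDeriv_eq_right β.2 (hder _ _ (hFR i) y) (hextR i) hy

end IFS

/-- The image of the set where the weight is small has small Lebesgue measure. -/
theorem volume_image_le {Ψ : I ≃ₜ I} {ψ v : ℝ → ℝ} (hΨ : ∀ x : I, (Ψ x : ℝ) = ψ x)
    (hψ : Function.Injective ψ) (hψv : ∀ x, HasDerivAt ψ (v x) x) (hv0 : ∀ x, 0 < v x) {η : ℝ}
    (hη : 0 ≤ η) {E : Set I} (hE : MeasurableSet E) (hEv : ∀ x ∈ E, v x ≤ η) :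
    (volume : Measure I).real (Ψ '' E) ≤ η := by
  have hm : MeasurableSet ((↑) '' E : Set ℝ) := measurableSet_Icc.subtype_image hE
  have h1 : (volume : Measure I) (Ψ '' E) = volume (ψ '' ((↑) '' E)) := by
    rw [← volume_image_subtype_coe measurableSet_Icc, image_image, image_image]
    simp only [hΨ]
  have h2 : volume (ψ '' ((↑) '' E)) ≤ ENNReal.ofReal η := by
    rw [← lintegral_abs_det_fderiv_eq_addHaar_image volume hm
      (fun x _ => (hψv x).hasFDerivAt.hasFDerivWithinAt) hψ.injOn]
    calc _ ≤ ∫⁻ x in ((↑) '' E : Set ℝ), ENNReal.ofReal η := by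
          refine setLIntegral_mono measurable_const fun x hx => ?_
          obtain ⟨y, hy, rfl⟩ := hx
          refine ENNReal.ofReal_le_ofReal ?_
          have := hEv y hy
          simpa [abs_of_pos (hv0 _)] using this
      _ = ENNReal.ofReal η * volume ((↑) '' E : Set ℝ) := by rw [setLIntegral_const]
      _ ≤ ENNReal.ofReal η * 1 := by
          gcongr
          calc volume ((↑) '' E : Set ℝ) ≤ volume (Icc (0 : ℝ) 1) :=
                measure_mono (by rintro _ ⟨y, -, rfl⟩; exact y.2)
            _ = 1 := by simp
      _ = _ := mul_one _
  rw [measureReal_def, h1]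
  exact ENNReal.toReal_le_of_le_ofReal hη h2


/-! ### Approximation by compatible systems -/

/-- The target slope is (1 - τ) f truncated below at τ. The truncation supplies the positive lower
bound needed for rounding to powers of r. The factor 1 - τ lowers the target by τf ≥ 2τ² where f ≥
2τ, more than the total error τ², so h' ≤ f holds there. The pair q, J serves all N and K₀. -/
theorem exists_family_primitive {κ : Type*} [Finite κ] {f : κ → ℝ → ℝ} {C τ : ℝ}
    (hf : ∀ p, UniformContinuous (f p)) (hf0 : ∀ p x, f p x ∈ Icc 0 C) (hC : 0 ≤ C) (hτ : 0 < τ)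
    (hτ1 : τ ≤ 1 / 2) :
    ∃ q J : ℕ, 1 ≤ q ∧ ∀ N K₀ : ℕ, ∃ K : ℕ, K₀ ≤ K ∧ 0 < K ∧ ∀ p, ∃ h h' : ℝ → ℝ,
      Continuous h' ∧ (∀ x, HasDerivAt h (h' x) x) ∧ (∀ x, 0 < h' x) ∧ h 0 = 0 ∧
      (∀ x, 0 ≤ x → |h' x - f p x| ≤ τ * (C + 2)) ∧
      (∀ x, 0 ≤ x → 2 * τ ≤ f p x → h' x ≤ f p x) ∧
      ∀ x, 0 ≤ x → Compatible (1 + 1 / (q : ℝ)) (K * ((q * (q + 1) : ℕ) : ℝ) ^ (J + N)) N J x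
        (h x) := by
  obtain ⟨q, hq⟩ := exists_nat_gt (2 * (C + 1) / τ ^ 2)
  have hq0 : (0 : ℝ) < q := lt_of_le_of_lt (by positivity) hq
  have hq1 : 1 ≤ q := by exact_mod_cast hq0
  have hr1 : 1 < 1 + 1 / (q : ℝ) := by
    have : 0 < 1 / (q : ℝ) := by positivity
    linarith
  obtain ⟨J, hJ⟩ := pow_unbounded_of_one_lt (max (C + 1) ((1 + 1 / (q : ℝ)) / τ)) hr1
  refine ⟨q, J, hq1, fun N K₀ => ?_⟩
  have hmod : ∀ᶠ K : ℕ in atTop, ∀ p, ∀ x y : ℝ, |x - y| ≤ 2 / K → |f p x - f p y| ≤ τ ^ 2 / 2 := by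
    refine eventually_all.2 fun p => ?_
    obtain ⟨δ, hδ, h⟩ := Metric.uniformContinuous_iff.1 (hf p) (τ ^ 2 / 2) (by positivity)
    have : Tendsto (fun K : ℕ => 2 / (K : ℝ)) atTop (𝓝 0) :=
      tendsto_const_nhds.div_atTop tendsto_natCast_atTop_atTop
    filter_upwards [this.eventually_lt_const hδ] with K hK x y hxy
    exact (h (show dist x y < δ from hxy.trans_lt hK)).le
  obtain ⟨K, hK, hKK, hK0⟩ := (hmod.and ((eventually_ge_atTop K₀).and (eventually_gt_atTop 0))).exists
  refine ⟨K, hKK, hK0, fun p => ?_⟩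
  let φ : ℝ → ℝ := fun x => max ((1 - τ) * f p x) τ
  have hφ : ∀ x, φ x ∈ Icc τ (C + 1) := fun x => by
    refine ⟨le_max_right _ _, max_le ?_ (by linarith)⟩
    have := hf0 p x
    nlinarith [this.1, this.2]
  have hφm : ∀ x y : ℝ, |x - y| ≤ 2 / K → |φ x - φ y| ≤ τ ^ 2 / 2 := fun x y hxy => by
    refine (abs_max_sub_max_le_abs _ _ _).trans ?_
    rw [← mul_sub, abs_mul, abs_of_nonneg (by linarith : 0 ≤ 1 - τ)]
    have := hK p x y hxy
    have := abs_nonneg (f p x - f p y)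
    nlinarith
  have hJ2 : 1 + 1 / (q : ℝ) ≤ τ * (1 + 1 / (q : ℝ)) ^ J := by
    have := (le_max_right _ _).trans hJ.le
    rw [div_le_iff₀ hτ] at this
    linarith
  obtain ⟨h, h', h1, h2, h3, h4, h5, h6⟩ := exists_compatible_primitive hq1 hτ hφ
    ((le_max_left _ _).trans hJ.le) hJ2 hK0 hφm N
  have hCq : (C + 1) / q ≤ τ ^ 2 / 2 := by
    rw [div_lt_iff₀ (by positivity)] at hq
    rw [div_le_iff₀ hq0]
    linarith
  refine ⟨h, h', h1, h2, h3, h4, fun x hx => ?_, fun x hx hfx => ?_, h6⟩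
  · have e1 := abs_le.1 (h5 x hx)
    have e2 := hf0 p x
    have e3 : φ x ≤ f p x + τ := max_le (by nlinarith [e2.1]) (by linarith [e2.1])
    have e4 : (1 - τ) * f p x ≤ φ x := le_max_left _ _
    rw [abs_le]
    constructor <;> nlinarith [e2.1, e2.2]
  · have e1 := abs_le.1 (h5 x hx)
    have e2 := hf0 p x
    have e3 : φ x = (1 - τ) * f p x := max_eq_left (by nlinarith [e2.1])
    nlinarith [e2.1, e2.2]

/-- Interpolation between two functions near the end points by a rescaling of a third one. -/
theorem exists_bridge {g F G F' G' : ℝ → ℝ} {a e : ℝ} (ha : a ∈ Ioo (0 : ℝ) (1 / 2))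
    (hg : StrictMonoOn g (Icc 0 1)) (hgA : AbsolutelyContinuousOnInterval g 0 1)
    (hF : ∀ x, HasDerivAt F (F' x) x) (hG : ∀ x, HasDerivAt G (G' x) x) (hFc : Continuous F')
    (hGc : Continuous G') (hF' : ∀ x, 0 < F' x) (hG' : ∀ x, 0 < G' x) (hF0 : F 0 = 0)
    (hG1 : G 1 = 1) (hFe : ∀ x ∈ Icc 0 a, |F x - g x| ≤ e)
    (hGe : ∀ x ∈ Icc (1 - a) 1, |G x - g x| ≤ e) (hlt : F a < G (1 - a)) :
    ∃ E : I ≃ₜ I, StrictMono E ∧ EqOn (ext E) F (Icc 0 a) ∧ EqOn (ext E) G (Icc (1 - a) 1) ∧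
      AbsolutelyContinuousOnInterval (ext E) 0 1 ∧ ∀ x ∈ Icc (0 : ℝ) 1, |ext E x - g x| ≤ e := by
  obtain ⟨ha0, ha1⟩ := ha
  have hcd : ∀ F F' : ℝ → ℝ, (∀ x, HasDerivAt F (F' x) x) → Continuous F' → ContDiff ℝ 1 F := by
    intro F F' h hc
    refine contDiff_one_iff_deriv.2 ⟨fun x => (h x).differentiableAt, ?_⟩
    rwa [show deriv F = F' from funext fun x => (h x).deriv]
  have hFm : StrictMono F := strictMono_of_deriv_pos fun x => by rw [(hF x).deriv]; exact hF' x
  have hGm : StrictMono G := strictMono_of_deriv_pos fun x => by rw [(hG x).deriv]; exact hG' x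
  have hgg : g a < g (1 - a) :=
    hg ⟨ha0.le, by linarith⟩ ⟨by linarith, by linarith⟩ (by linarith)
  set c := (G (1 - a) - F a) / (g (1 - a) - g a) with hc
  have hc0 : 0 < c := div_pos (by linarith) (by linarith)
  have hcm : c * (g (1 - a) - g a) = G (1 - a) - F a := div_mul_cancel₀ _ (by linarith)
  let P : ℝ → ℝ := fun x => min x a
  let Q : ℝ → ℝ := fun x => max a (min x (1 - a))
  let R : ℝ → ℝ := fun x => max x (1 - a)
  have hPm : Monotone P := fun x y h => min_le_min_right _ h
  have hQm : Monotone Q := fun x y h => max_le_max_left _ (min_le_min_right _ h)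
  have hRm : Monotone R := fun x y h => max_le_max_right _ h
  have hQmem : ∀ x, Q x ∈ Icc (0 : ℝ) 1 := fun x =>
    ⟨ha0.le.trans (le_max_left _ _), max_le (by linarith) ((min_le_right _ _).trans (by linarith))⟩
  -- With clamped arguments only one summand varies on each of the three intervals, so absolute
  -- continuity can be checked for each summand separately.
  let h : ℝ → ℝ := fun x => F (P x) + c * (g (Q x) - g a) + (G (R x) - G (1 - a))
  have hleft : ∀ x, x ≤ a → h x = F x := by
    intro x hx
    simp only [h, P, Q, R]
    rw [min_eq_left hx, min_eq_left (by linarith), max_eq_left hx, max_eq_right (by linarith)]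
    ring
  have hmid : ∀ x ∈ Icc a (1 - a), h x = F a + c * (g x - g a) := by
    intro x hx
    simp only [h, P, Q, R]
    rw [min_eq_right hx.1, min_eq_left hx.2, max_eq_right hx.1, max_eq_right hx.2]
    ring
  have hright : ∀ x, 1 - a ≤ x → h x = G x := by
    intro x hx
    simp only [h, P, Q, R]
    rw [min_eq_right (by linarith), min_eq_right hx, max_eq_right (by linarith), max_eq_left hx, hcm]
    ring
  have hgQ : Monotone fun x => g (Q x) := fun x y hxy =>
    hg.monotoneOn (hQmem x) (hQmem y) (hQm hxy)
  have hm : StrictMono h := by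
    intro x y hxy
    have e1 := hFm.monotone (hPm hxy.le)
    have e2 := mul_le_mul_of_nonneg_left (hgQ hxy.le) hc0.le
    have e3 := hGm.monotone (hRm hxy.le)
    simp only [h]
    rcases lt_or_ge x a with hx | hx
    · have : F (P x) < F (P y) := hFm (by simp only [P]; rw [min_eq_left hx.le]; exact lt_min hxy hx)
      linarith
    · rcases lt_or_ge x (1 - a) with hx' | hx'
      · have : g (Q x) < g (Q y) := by
          refine hg (hQmem x) (hQmem y) ?_
          simp only [Q]
          rw [min_eq_left hx'.le, max_eq_right hx]
          exact lt_max_of_lt_right (lt_min hxy hx')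
        have := mul_lt_mul_of_pos_left this hc0
        linarith
      · have : G (R x) < G (R y) := hGm (by
          simp only [R]; rw [max_eq_left hx', max_eq_left (hx'.trans hxy.le)]; exact hxy)
        linarith
  have hLip : ∀ φ : ℝ → ℝ, LipschitzWith 1 φ → LipschitzOnWith 1 φ (Icc 0 1) :=
    fun φ h => h.lipschitzOnWith
  have hA : AbsolutelyContinuousOnInterval h 0 1 := by
    have a1 : AbsolutelyContinuousOnInterval (F ∘ P) 0 1 :=
      absolutelyContinuousOnInterval_comp_monotoneOn zero_le_one
        ((hcd _ _ hF hFc).contDiffOn.absolutelyContinuousOnInterval)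
        (hLip _ (LipschitzWith.id.min_const a)) (hPm.monotoneOn _)
        fun x hx => ⟨le_min hx.1 ha0.le, (min_le_left _ _).trans hx.2⟩
    have a2 : AbsolutelyContinuousOnInterval (g ∘ Q) 0 1 :=
      absolutelyContinuousOnInterval_comp_monotoneOn zero_le_one hgA
        (hLip _ ((LipschitzWith.id.min_const (1 - a)).const_max a)) (hQm.monotoneOn _)
        fun x _ => hQmem x
    have a3 : AbsolutelyContinuousOnInterval (G ∘ R) 0 1 :=
      absolutelyContinuousOnInterval_comp_monotoneOn zero_le_one
        ((hcd _ _ hG hGc).contDiffOn.absolutelyContinuousOnInterval)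
        (hLip _ (LipschitzWith.id.max_const (1 - a))) (hRm.monotoneOn _)
        fun x hx => ⟨hx.1.trans (le_max_left _ _), max_le hx.2 (by linarith)⟩
    have hconst : ∀ t : ℝ, AbsolutelyContinuousOnInterval (fun _ => t) 0 1 := fun t =>
      (LipschitzWith.const t).lipschitzOnWith.absolutelyContinuousOnInterval
    exact (a1.add ((a2.sub (hconst (g a))).const_mul c)).add (a3.sub (hconst (G (1 - a))))
  obtain ⟨E, hE, hEh⟩ := exists_homeomorph_of_strictMonoOn (f := h)
    (by simpa [uIcc_of_le zero_le_one] using hA.continuousOn) (hm.strictMonoOn _)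
    (by rw [hleft 0 ha0.le, hF0]) (by rw [hright 1 (by linarith), hG1])
  refine ⟨E, hE, fun x hx => ?_, fun x hx => ?_, ?_, fun x hx => ?_⟩
  · rw [hEh ⟨hx.1, by linarith [hx.2]⟩, hleft x hx.2]
  · rw [hEh ⟨by linarith [hx.1], hx.2⟩, hright x hx.1]
  · exact absolutelyContinuousOnInterval_congr hA (by
      rw [uIcc_of_le zero_le_one]; exact hEh.symm)
  · rw [hEh hx]
    rcases le_total x a with hxa | hxa
    · rw [hleft x hxa]; exact hFe x ⟨hx.1, hxa⟩
    · rcases le_total x (1 - a) with hxa' | hxa'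
      · rw [hmid x ⟨hxa, hxa'⟩]
        have b1 := abs_le.1 (hFe a ⟨ha0.le, le_rfl⟩)
        have b2 := abs_le.1 (hGe (1 - a) ⟨le_rfl, by linarith⟩)
        have m1 : g a ≤ g x := hg.monotoneOn ⟨ha0.le, by linarith⟩ hx hxa
        have m2 : g x ≤ g (1 - a) := hg.monotoneOn hx ⟨by linarith, by linarith⟩ hxa'
        set D := g (1 - a) - g a with hD
        have hD0 : 0 < D := by linarith
        -- The error in the middle is a convex combination of the errors at a and at 1 - a.
        have key : (F a + c * (g x - g a) - g x) * D =
            (F a - g a) * (g (1 - a) - g x) + (G (1 - a) - g (1 - a)) * (g x - g a) := by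
          have : c * (g x - g a) * D = (G (1 - a) - F a) * (g x - g a) := by
            rw [← hcm]; ring
          linear_combination this + (F a - g x) * hD
        rw [abs_le]
        constructor
        · refine le_of_mul_le_mul_right (a := D) ?_ hD0
          rw [key]
          nlinarith
        · refine le_of_mul_le_mul_right (a := D) ?_ hD0
          rw [key]
          nlinarith
      · rw [hright x hxa']; exact hGe x ⟨hxa', hx.2⟩

namespace IFS

variable {β : Ioo (0 : ℝ) (1 / 2)} {k : ℕ}

/-- The maps of the system seen from the left end point (`false`) and, after the reflection
`x ↦ 1 - x`, from the right end point (`true`). -/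
def endMap (S : IFS β k) (p : Fin k × Bool) (x : ℝ) : ℝ :=
  bif p.2 then 1 - ext (S.map p.1) (1 - x) else ext (S.map p.1) x

/-- The derivative of `endMap` on `[0, β]`, extended by constants. -/
def endSlope (S : IFS β k) (p : Fin k × Bool) (x : ℝ) : ℝ :=
  bif p.2 then endDeriv β (S.map p.1) (1 - projIcc 0 (β : ℝ) β.2.1.le x)
  else endDeriv β (S.map p.1) (projIcc 0 (β : ℝ) β.2.1.le x)

theorem endMap_zero (S : IFS β k) (p : Fin k × Bool) : S.endMap p 0 = 0 := by
  obtain ⟨i, b⟩ := p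
  cases b
  · exact S.ext_map_zero i
  · simp [endMap, S.ext_map_one i]

theorem continuous_endMap (S : IFS β k) (p : Fin k × Bool) : Continuous (S.endMap p) := by
  obtain ⟨i, b⟩ := p
  have := continuous_ext (S.map i).continuous
  cases b
  · exact this
  · exact continuous_const.sub (this.comp (by fun_prop))

theorem monotone_endMap (S : IFS β k) (p : Fin k × Bool) : Monotone (S.endMap p) := by
  obtain ⟨i, b⟩ := p
  have := monotone_ext (S.strictMono i).monotone
  cases b
  · exact this
  · intro x y h
    have := this (show 1 - y ≤ 1 - x by linarith)
    simp only [endMap, cond_true]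
    linarith

theorem hasDerivWithinAt_endMap (S : IFS β k) (p : Fin k × Bool) {x : ℝ} (hx : x ∈ Icc (0 : ℝ) β) :
    HasDerivWithinAt (S.endMap p) (S.endSlope p x) (Icc 0 β) x := by
  obtain ⟨i, b⟩ := p
  have hpr : (projIcc 0 (β : ℝ) β.2.1.le x : ℝ) = x := by rw [projIcc_of_mem _ hx]
  cases b
  · simp only [endSlope, cond_false, hpr]
    exact hasDerivWithinAt_ext_left β.2 (S.map_mem i) hx
  · simp only [endSlope, cond_true, hpr]
    have hg : HasDerivWithinAt (fun x : ℝ => 1 - x) (-1) (Icc (0 : ℝ) β) x := by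
      simpa using (hasDerivWithinAt_id x (Icc (0 : ℝ) β)).const_sub 1
    have hm : ∀ y ∈ Icc (0 : ℝ) β, 1 - y ∈ Icc (1 - β : ℝ) 1 :=
      fun y hy => ⟨by linarith [hy.2], by linarith [hy.1]⟩
    have := HasDerivWithinAt.scomp (t' := Icc (1 - β : ℝ) 1) x
      (hasDerivWithinAt_ext_right β.2 (S.map_mem i) (hm x hx)) hg hm
    have h2 := this.const_sub 1
    simp only [smul_eq_mul, neg_mul, one_mul, neg_neg] at h2
    exact h2

theorem uniformContinuous_endSlope (S : IFS β k) (p : Fin k × Bool) :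
    UniformContinuous (S.endSlope p) := by
  obtain ⟨i, b⟩ := p
  have hc := S.continuousOn_endDeriv i
  have hp : UniformContinuous (projIcc 0 (β : ℝ) β.2.1.le) :=
    (LipschitzWith.projIcc _).uniformContinuous
  cases b
  · have h1 : Continuous fun y : Icc (0 : ℝ) β => endDeriv β (S.map i) y :=
      hc.comp_continuous continuous_subtype_val fun y => Or.inl y.2
    exact (CompactSpace.uniformContinuous_of_continuous h1).comp hp
  · have h1 : Continuous fun y : Icc (0 : ℝ) β => endDeriv β (S.map i) (1 - y) :=
      hc.comp_continuous (by fun_prop) fun y => Or.inr ⟨by linarith [y.2.2], by linarith [y.2.1]⟩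
    exact (CompactSpace.uniformContinuous_of_continuous h1).comp hp

theorem endSlope_nonneg (S : IFS β k) (p : Fin k × Bool) (x : ℝ) : 0 ≤ S.endSlope p x := by
  have h : ∀ y ∈ endSet (β : ℝ), 0 ≤ endDeriv β (S.map p.1) y := fun y _ =>
    (monotone_ext (S.strictMono p.1).monotone).monotoneOn _ |>.derivWithin_nonneg
  have hpr := (projIcc 0 (β : ℝ) β.2.1.le x).2
  unfold endSlope
  cases p.2
  · exact h _ (Or.inl hpr)
  · exact h _ (Or.inr ⟨by linarith [hpr.2], by linarith [hpr.1]⟩)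

theorem exists_endSlope_le (S : IFS β k) : ∃ C, 0 ≤ C ∧ ∀ p x, S.endSlope p x ∈ Icc 0 C := by
  have : ∀ p, ∃ C, ∀ x, S.endSlope p x ≤ C := by
    intro p
    obtain ⟨C, hC⟩ := (isCompact_Icc (a := (0 : ℝ)) (b := β)).exists_bound_of_continuousOn
      (S.uniformContinuous_endSlope p).continuous.continuousOn
    refine ⟨C, fun x => ?_⟩
    have hpr := projIcc 0 (β : ℝ) β.2.1.le x
    have h1 := hC _ (projIcc 0 (β : ℝ) β.2.1.le x).2
    have h2 : S.endSlope p (projIcc 0 (β : ℝ) β.2.1.le x) = S.endSlope p x := by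
      simp [endSlope]
    rw [h2] at h1
    exact (le_abs_self _).trans h1
  choose C hC using this
  refine ⟨∑ p, |C p|, by positivity, fun p x => ⟨S.endSlope_nonneg p x, ?_⟩⟩
  exact ((hC p x).trans (le_abs_self _)).trans
    (Finset.single_le_sum (f := fun p => |C p|) (fun _ _ => abs_nonneg _) (Finset.mem_univ p))

/-! ### Stability of the admissibility conditions -/

/-- Strict inequalities at each point persist nearby, and compactness makes the margin uniform.
Uniformly small perturbations then keep maps on both sides of the diagonal away from the ends. -/
theorem IsAdmissible.exists_margin {S : IFS β k} (hS : S.IsAdmissible) {x₀ : ℝ} (h0 : 0 < x₀) :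
    ∃ m > 0, ∀ x ∈ Icc x₀ (1 - x₀), (∃ i, ext (S.map i) x + m < x) ∧
      ∃ j, x + m < ext (S.map j) x := by
  refine (isCompact_Icc (a := x₀) (b := 1 - x₀)).induction_on
    (p := fun s => ∃ m > 0, ∀ x ∈ s, (∃ i, ext (S.map i) x + m < x) ∧
      ∃ j, x + m < ext (S.map j) x) ⟨1, one_pos, by simp⟩ ?_ ?_ ?_
  · rintro s t hst ⟨m, hm, h⟩
    exact ⟨m, hm, fun x hx => h x (hst hx)⟩
  · rintro s t ⟨m, hm, h⟩ ⟨m', hm', h'⟩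
    refine ⟨min m m', lt_min hm hm', fun x hx => ?_⟩
    have e1 := min_le_left m m'
    have e2 := min_le_right m m'
    rcases hx with hx | hx
    · obtain ⟨⟨i, hi⟩, j, hj⟩ := h x hx
      exact ⟨⟨i, by linarith⟩, j, by linarith⟩
    · obtain ⟨⟨i, hi⟩, j, hj⟩ := h' x hx
      exact ⟨⟨i, by linarith⟩, j, by linarith⟩
  · intro x hx
    have hx01 : x ∈ Icc (0 : ℝ) 1 := ⟨by linarith [hx.1], by linarith [hx.2]⟩
    obtain ⟨i, j, hi, hj⟩ := hS.exists_lt_lt ⟨x, hx01⟩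
      ⟨Subtype.mk_lt_mk.2 (by linarith [hx.1]), Subtype.mk_lt_mk.2 (by linarith [hx.2])⟩
    have hi' : ext (S.map i) x < x := by rw [ext_of_mem _ hx01]; exact hi
    have hj' : x < ext (S.map j) x := by rw [ext_of_mem _ hx01]; exact hj
    obtain ⟨m, hm0, hm⟩ := exists_between
      (lt_min (sub_pos.2 hi') (sub_pos.2 hj'))
    have c1 := continuous_ext (S.map i).continuous
    have c2 := continuous_ext (S.map j).continuous
    have o1 : ∀ᶠ y in 𝓝 x, ext (S.map i) y + m < y :=
      (c1.add continuous_const).continuousAt.eventually_lt continuousAt_id (by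
        have := hm.trans_le (min_le_left _ _)
        change ext (S.map i) x + m < x
        linarith)
    have o2 : ∀ᶠ y in 𝓝 x, y + m < ext (S.map j) y :=
      (continuous_id.add continuous_const).continuousAt.eventually_lt c2.continuousAt (by
        have := hm.trans_le (min_le_right _ _)
        change x + m < ext (S.map j) x
        linarith)
    exact ⟨_, mem_nhdsWithin_of_mem_nhds (o1.and o2), m, hm0, fun y hy => ⟨⟨i, hy.1⟩, j, hy.2⟩⟩

theorem IsAdmissible.endSlope_zero_pos {S : IFS β k} (hS : S.IsAdmissible) (p : Fin k × Bool) :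
    0 < S.endSlope p 0 := by
  obtain ⟨i, b⟩ := p
  cases b
  · simpa [endSlope] using hS.deriv_zero_pos i
  · simpa [endSlope] using hS.deriv_one_pos i

theorem IsAdmissible.sum_log_endSlope_pos {S : IFS β k} (hS : S.IsAdmissible) (b : Bool) :
    0 < ∑ i, S.prob i * Real.log (S.endSlope (i, b) 0) := by
  cases b
  · simpa [endSlope] using hS.lyapunov_zero_pos
  · simpa [endSlope] using hS.lyapunov_one_pos

/-- A positive exponent forces some slope at the end point to exceed 1; continuity spreads the
strict inequalities to a neighbourhood. -/
theorem IsAdmissible.exists_endSlope_bounds {S : IFS β k} (hS : S.IsAdmissible) :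
    ∃ c > 0, ∃ x₀ ∈ Ioo (0 : ℝ) β, (∀ p, ∀ x ∈ Icc 0 x₀, c ≤ S.endSlope p x) ∧
      ∀ b, ∃ j, ∀ x ∈ Icc 0 x₀, 1 + c ≤ S.endSlope (j, b) x := by
  have h1 : ∀ b, ∃ j, 1 < S.endSlope (j, b) 0 := fun b => by
    by_contra! hb
    refine absurd (hS.sum_log_endSlope_pos b) (not_lt.2 (Finset.sum_nonpos fun i _ => ?_))
    exact mul_nonpos_of_nonneg_of_nonpos (hS.prob_pos i).le
      (Real.log_nonpos (hS.endSlope_zero_pos _).le (hb i))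
  choose j hj using h1
  have e1 : ∀ p, ∀ᶠ c in 𝓝[>] (0 : ℝ), c < S.endSlope p 0 := fun p =>
    nhdsWithin_le_nhds (eventually_lt_nhds (hS.endSlope_zero_pos p))
  have e2 : ∀ b, ∀ᶠ c in 𝓝[>] (0 : ℝ), c < S.endSlope (j b, b) 0 - 1 := fun b =>
    nhdsWithin_le_nhds (eventually_lt_nhds (sub_pos.2 (hj b)))
  obtain ⟨c, ⟨hc1, hc2⟩, hc0⟩ :=
    (((eventually_all.2 e1).and (eventually_all.2 e2)).and self_mem_nhdsWithin).exists
  have c1 : ∀ p, ContinuousAt (S.endSlope p) 0 :=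
    fun p => (S.uniformContinuous_endSlope p).continuous.continuousAt
  have f1 : ∀ p, ∀ᶠ x in 𝓝 (0 : ℝ), c < S.endSlope p x := fun p =>
    (c1 p).eventually_const_lt (hc1 p)
  have f2 : ∀ b, ∀ᶠ x in 𝓝 (0 : ℝ), 1 + c < S.endSlope (j b, b) x := fun b =>
    (c1 _).eventually_const_lt (by linarith [hc2 b])
  obtain ⟨δ, hδ, h⟩ := Metric.eventually_nhds_iff.1 ((eventually_all.2 f1).and (eventually_all.2 f2))
  have hβ := β.2.1
  refine ⟨c, hc0, min δ β / 2, ⟨by positivity, ?_⟩, ?_⟩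
  · linarith [min_le_right δ (β : ℝ)]
  · have h3 : ∀ x ∈ Icc 0 (min δ (β : ℝ) / 2), dist x 0 < δ := fun x hx => by
      rw [Real.dist_0_eq_abs, abs_of_nonneg hx.1]
      linarith [min_le_left δ (β : ℝ), hx.2]
    exact ⟨fun p x hx => ((h (h3 x hx)).1 p).le, fun b => ⟨j b, fun x hx => ((h (h3 x hx)).2 b).le⟩⟩

theorem IsAdmissible.exists_lyapunov_tolerance {S : IFS β k} (hS : S.IsAdmissible) :
    ∃ t > 0, ∀ l : Fin k × Bool → ℝ, (∀ p, |l p - S.endSlope p 0| ≤ t) →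
      ∀ b, 0 < ∑ i, S.prob i * Real.log (l (i, b)) := by
  have h1 : ∀ b, ∀ᶠ l in 𝓝 (fun p => S.endSlope p 0),
      0 < ∑ i, S.prob i * Real.log (l (i, b)) := fun b => by
    have : ContinuousAt (fun l : Fin k × Bool → ℝ => ∑ i, S.prob i * Real.log (l (i, b)))
        (fun p => S.endSlope p 0) := by
      refine tendsto_finsetSum _ fun i _ => ?_
      exact tendsto_const_nhds.mul (ContinuousAt.log
        (f := fun l : Fin k × Bool → ℝ => l (i, b)) (continuous_apply (i, b)).continuousAt
        (hS.endSlope_zero_pos (i, b)).ne')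
    exact this.eventually_const_lt (hS.sum_log_endSlope_pos b)
  obtain ⟨δ, hδ, h⟩ := Metric.eventually_nhds_iff.1 (eventually_all.2 h1)
  refine ⟨δ / 2, half_pos hδ, fun l hl b => h ?_ b⟩
  exact (dist_pi_lt_iff hδ).2 fun p => (hl p).trans_lt (half_lt_self hδ)

/-- A map with derivative close to that of an end map stays close to it slightly beyond `β`. -/
theorem abs_sub_endMap_le (S : IFS β k) (p : Fin k × Bool) {h h' : ℝ → ℝ} {C e T a : ℝ}
    (hd : ∀ x, HasDerivAt h (h' x) x) (h0 : h 0 = 0) (hC : ∀ x, S.endSlope p x ∈ Icc 0 C)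
    (hT : ∀ x, 0 ≤ x → |h' x - S.endSlope p x| ≤ T) (hT0 : 0 ≤ T) (hTe : T ≤ e / 4)
    (hT1 : T ≤ 1) (ha : β ≤ a) (haC : (C + 1) * (a - β) ≤ e / 4)
    (hae : S.endMap p a - S.endMap p β ≤ e / 4) {x : ℝ} (hx : x ∈ Icc 0 a) :
    |h x - S.endMap p x| ≤ e := by
  have hβ := β.2
  have main : ∀ y ∈ Icc (0 : ℝ) β, |h y - S.endMap p y| ≤ T := by
    intro y hy
    have := (convex_Icc (0 : ℝ) β).norm_image_sub_le_of_norm_hasDerivWithin_le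
      (f := fun z => h z - S.endMap p z) (f' := fun z => h' z - S.endSlope p z) (C := T)
      (fun z hz => (hd z).hasDerivWithinAt.sub (S.hasDerivWithinAt_endMap p hz))
      (fun z hz => hT z hz.1) (left_mem_Icc.2 hβ.1.le) hy
    simp only [h0, S.endMap_zero, sub_zero, Real.norm_eq_abs] at this
    refine this.trans ?_
    rw [abs_of_nonneg hy.1]
    have := hy.2
    nlinarith [hβ.2]
  rcases le_total x β with hxb | hxb
  · exact (main x ⟨hx.1, hxb⟩).trans (by linarith)
  -- Beyond β no slope comparison is available, but on [β, a] each of the two functions moves by at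
  -- most e/4.
  · have b1 := abs_le.1 (main β ⟨hβ.1.le, le_rfl⟩)
    have b2 := (convex_Icc (β : ℝ) a).norm_image_sub_le_of_norm_hasDerivWithin_le
      (f := h) (f' := h') (C := C + 1) (fun z _ => (hd z).hasDerivWithinAt)
      (fun z hz => by
        have hz0 : 0 ≤ z := hβ.1.le.trans hz.1
        have h1 := abs_le.1 (hT z hz0)
        have h2 := hC z
        rw [Real.norm_eq_abs, abs_le]
        constructor <;> linarith [h2.1, h2.2]) (left_mem_Icc.2 ha) (y := x) ⟨hxb, hx.2⟩
    rw [Real.norm_eq_abs, Real.norm_eq_abs, abs_of_nonneg (by linarith : 0 ≤ x - β)] at b2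
    have hC0 : 0 ≤ C := (hC 0).1.trans (hC 0).2
    have b3 := abs_le.1 (b2.trans ((mul_le_mul_of_nonneg_left (sub_le_sub_right hx.2 _)
      (by linarith)).trans haC))
    have b4 := S.monotone_endMap p hxb
    have b5 := S.monotone_endMap p hx.2
    rw [abs_le]
    constructor <;> linarith [b1.1, b1.2, b3.1, b3.2]

/-- Existence of maps below and above the diagonal near an end point. -/
theorem exists_lt_lt_near_end (S : IFS β k) {b : Bool} {h h' : Fin k × Bool → ℝ → ℝ} {x₀ : ℝ}
    (hx₀ : x₀ < β) (hd : ∀ p x, HasDerivAt (h p) (h' p x) x) (h0 : ∀ p, h p 0 = 0)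
    (hle : ∀ p, ∀ x ∈ Icc 0 x₀, h' p x ≤ S.endSlope p x) {j : Fin k}
    (hj : ∀ x ∈ Icc 0 x₀, 1 < h' (j, b) x) {x : ℝ} (hx : x ∈ Ioc 0 x₀)
    (hS : ∃ i, S.endMap (i, b) x < x) : (∃ i, h (i, b) x < x) ∧ ∃ j, x < h (j, b) x := by
  have hsub : Icc 0 x ⊆ Icc 0 x₀ := Icc_subset_Icc_right hx.2
  have hsub' : Icc 0 x ⊆ Icc 0 (β : ℝ) := Icc_subset_Icc_right (hx.2.trans hx₀.le)
  -- Uniform closeness cannot decide the side of the diagonal near a fixed point, and a branch below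
  -- it may even be tangent to it. Such a branch is kept below by the one-sided slope bound; the
  -- branch above comes from a slope exceeding 1.
  constructor
  · obtain ⟨i, hi⟩ := hS
    refine ⟨i, lt_of_le_of_lt ?_ hi⟩
    have := monotoneOn_of_hasDerivWithinAt_nonneg (convex_Icc 0 x)
      (f := fun y => S.endMap (i, b) y - h (i, b) y)
      (f' := fun y => S.endSlope (i, b) y - h' (i, b) y)
      (((S.continuous_endMap _).sub
        (continuous_iff_continuousAt.2 fun y => (hd (i, b) y).continuousAt)).continuousOn)
      (fun y hy => ((S.hasDerivWithinAt_endMap _ (hsub' (interior_subset hy))).mono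
        (interior_subset.trans hsub')).sub (hd _ y).hasDerivWithinAt)
      (fun y hy => sub_nonneg.2 (hle _ y (hsub (interior_subset hy))))
      (left_mem_Icc.2 hx.1.le) (right_mem_Icc.2 hx.1.le) hx.1.le
    simp only [S.endMap_zero, h0] at this
    linarith
  · refine ⟨j, ?_⟩
    have := strictMonoOn_of_hasDerivWithinAt_pos (convex_Icc 0 x)
      (f := fun y => h (j, b) y - y) (f' := fun y => h' (j, b) y - 1)
      (((continuous_iff_continuousAt.2 fun y => (hd (j, b) y).continuousAt).sub
        continuous_id).continuousOn)
      (fun y _ => ((hd _ y).sub (hasDerivAt_id y)).hasDerivWithinAt)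
      (fun y hy => sub_pos.2 (hj y (hsub (interior_subset hy))))
      (left_mem_Icc.2 hx.1.le) (right_mem_Icc.2 hx.1.le) hx.1
    simp only [h0] at this
    linarith

theorem endDeriv_of_left {H : IFS β k} {h h' : ℝ → ℝ} {i : Fin k} {a x : ℝ} (ha : β ≤ a)
    (hd : ∀ x, HasDerivAt h (h' x) x) (hL : EqOn (ext (H.map i)) h (Icc 0 a))
    (hx : x ∈ Icc 0 (β : ℝ)) : endDeriv β (H.map i) x = h' x :=
  endDeriv_eq_left β.2 (hd x) (hL.mono (Icc_subset_Icc_right ha)) hx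

theorem hasDerivAt_reflect {h h' : ℝ → ℝ} (hd : ∀ x, HasDerivAt h (h' x) x) (x : ℝ) :
    HasDerivAt (fun x => 1 - h (1 - x)) (h' (1 - x)) x := by
  simpa using ((hd (1 - x)).comp_const_sub 1 x).const_sub 1

theorem endDeriv_of_right {H : IFS β k} {h h' : ℝ → ℝ} {i : Fin k} {a x : ℝ} (ha : β ≤ a)
    (hd : ∀ x, HasDerivAt h (h' x) x)
    (hR : EqOn (ext (H.map i)) (fun x => 1 - h (1 - x)) (Icc (1 - a) 1))
    (hx : x ∈ Icc (1 - β : ℝ) 1) : endDeriv β (H.map i) x = h' (1 - x) :=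
  endDeriv_eq_right β.2 (hasDerivAt_reflect hd x)
    (hR.mono (Icc_subset_Icc_left (by linarith))) hx

/-- Admissible systems can be approximated by admissible systems whose branches near the end
points are compatible with a common family of arcs, at arbitrarily fine scales. -/
theorem exists_compatible_system {S : IFS β k} (hS : S ∈ admissibleAC β k) {ε : ℝ} (hε : 0 < ε) :
    ∃ (a : ℝ) (q J : ℕ), β < a ∧ a < 1 / 2 ∧ 1 ≤ q ∧ ∀ N K₀ : ℕ, ∃ K : ℕ, K₀ ≤ K ∧ 0 < K ∧
      ∃ (H : IFS β k) (h h' : Fin k × Bool → ℝ → ℝ), H.prob = S.prob ∧ H ∈ admissibleAC β k ∧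
        (∀ p, Continuous (h' p)) ∧ (∀ p x, HasDerivAt (h p) (h' p x) x) ∧ (∀ p, h p 0 = 0) ∧
        (∀ p x, 0 < h' p x) ∧ (∀ p x, 0 ≤ x → |h' p x - S.endSlope p x| ≤ ε) ∧
        (∀ i, EqOn (ext (H.map i)) (h (i, false)) (Icc 0 a)) ∧
        (∀ i, EqOn (ext (H.map i)) (fun x => 1 - h (i, true) (1 - x)) (Icc (1 - a) 1)) ∧
        (∀ i, ∀ x ∈ Icc (0 : ℝ) 1, |ext (H.map i) x - ext (S.map i) x| ≤ ε) ∧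
        ∀ p x, 0 ≤ x → Compatible (1 + 1 / (q : ℝ)) (K * ((q * (q + 1) : ℕ) : ℝ) ^ (J + N)) N J x
          (h p x) := by
  obtain ⟨hSa, hSAC⟩ := hS
  have hβ := β.2
  obtain ⟨C, hC0, hC⟩ := S.exists_endSlope_le
  obtain ⟨c, hc, x₀, hx₀, hc1, hc2⟩ := hSa.exists_endSlope_bounds
  obtain ⟨m, hm, hmar⟩ := hSa.exists_margin hx₀.1
  obtain ⟨t, ht, hlyap⟩ := hSa.exists_lyapunov_tolerance
  have hgap : ∀ i, 0 < ext (S.map i) (1 - β) - ext (S.map i) β := fun i => sub_pos.2 <|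
    strictMonoOn_ext (S.strictMono i) ⟨hβ.1.le, by linarith [hβ.2]⟩
      ⟨by linarith [hβ.2], by linarith [hβ.1]⟩ (by linarith [hβ.2])
  -- Replacing both ends lowers the rise available in the middle by at most 5e/2, so a third of the
  -- rise leaves room for a monotone bridge.
  have he1 : ∀ᶠ e in 𝓝[>] (0 : ℝ), ∀ i, e < (ext (S.map i) (1 - β) - ext (S.map i) β) / 3 :=
    eventually_all.2 fun i => nhdsWithin_le_nhds (eventually_lt_nhds (by linarith [hgap i]))
  obtain ⟨e, ⟨⟨heg, hem⟩, heε⟩, he0⟩ := (((he1.and (nhdsWithin_le_nhds (eventually_lt_nhds hm))).and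
    (nhdsWithin_le_nhds (eventually_lt_nhds hε))).and self_mem_nhdsWithin).exists
  have ha1 : ∀ᶠ a in 𝓝[>] (β : ℝ), ∀ p, S.endMap p a - S.endMap p β < e / 4 :=
    eventually_all.2 fun p => nhdsWithin_le_nhds <|
      (((S.continuous_endMap p).sub continuous_const).continuousAt (x := (β : ℝ))).eventually_lt_const
        (by simp only [Pi.sub_apply, sub_self]; positivity)
  have ha2 : ∀ᶠ a in 𝓝[>] (β : ℝ), (C + 1) * (a - β) < e / 4 :=
    nhdsWithin_le_nhds <| (Continuous.continuousAt (x := (β : ℝ))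
      (f := fun a : ℝ => (C + 1) * (a - β)) (by fun_prop)).eventually_lt_const
        (by simp only [sub_self, mul_zero]; positivity)
  obtain ⟨a, ⟨⟨ha1, ha2⟩, ha3⟩, haβ⟩ := (((ha1.and ha2).and
    (nhdsWithin_le_nhds (eventually_lt_nhds hβ.2))).and self_mem_nhdsWithin).exists
  obtain ⟨T, hT0, hT⟩ := exists_between (a₁ := 0)
    (a₂ := min (e / 4) (min (c / 2) (min t (min ε 1)))) (by positivity)
  simp only [lt_min_iff] at hT
  obtain ⟨hTe, hTc, hTt, hTε, hT1⟩ := hT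
  obtain ⟨τ, hτ0, hτ⟩ := exists_between (a₁ := 0)
    (a₂ := min (T / (C + 2)) (min (c / 2) (1 / 2))) (by positivity)
  simp only [lt_min_iff] at hτ
  obtain ⟨hτT, hτc, hτ1⟩ := hτ
  rw [lt_div_iff₀ (by positivity)] at hτT
  obtain ⟨q, J, hq, hfam⟩ := exists_family_primitive (fun p => S.uniformContinuous_endSlope p) hC hC0
    hτ0 hτ1.le
  refine ⟨a, q, J, haβ, ha3, hq, fun N K₀ => ?_⟩
  obtain ⟨K, hK, hK0, hex⟩ := hfam N K₀
  choose h h' hc' hd hpos h0 hclose hle hcomp using hex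
  have hcl : ∀ p x, 0 ≤ x → |h' p x - S.endSlope p x| ≤ T :=
    fun p x hx => (hclose p x hx).trans hτT.le
  have hnear : ∀ p, ∀ x ∈ Icc 0 a, |h p x - S.endMap p x| ≤ e := fun p x hx =>
    S.abs_sub_endMap_le p (hd p) (h0 p) (hC p) (hcl p) hT0.le hTe.le hT1.le haβ.le ha2.le
      (ha1 p).le hx
  have hbr : ∀ i, ∃ E : I ≃ₜ I, StrictMono E ∧ EqOn (ext E) (h (i, false)) (Icc 0 a) ∧
      EqOn (ext E) (fun x => 1 - h (i, true) (1 - x)) (Icc (1 - a) 1) ∧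
      AbsolutelyContinuousOnInterval (ext E) 0 1 ∧
      ∀ x ∈ Icc (0 : ℝ) 1, |ext E x - ext (S.map i) x| ≤ e := by
    intro i
    refine exists_bridge ⟨hβ.1.trans haβ, ha3⟩ (strictMonoOn_ext (S.strictMono i)) (hSAC i)
      (hd (i, false)) (fun x => hasDerivAt_reflect (hd (i, true)) x) (hc' _)
      ((hc' _).comp (by fun_prop)) (hpos _) (fun x => hpos _ _) (h0 _) ?_ ?_ ?_ ?_
    · simp [h0]
    · exact fun x hx => hnear (i, false) x hx
    · intro x hx
      have := hnear (i, true) (1 - x) ⟨by linarith [hx.2], by linarith [hx.1]⟩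
      simp only [endMap, cond_true, sub_sub_cancel] at this
      rw [abs_sub_comm] at this
      convert! this using 2
      ring
    · have b1 := abs_le.1 (hnear (i, false) a ⟨(hβ.1.trans haβ).le, le_rfl⟩)
      have b2 := abs_le.1 (hnear (i, true) a ⟨(hβ.1.trans haβ).le, le_rfl⟩)
      have b3 := ha1 (i, false)
      have b4 := ha1 (i, true)
      have b5 := heg i
      simp only [endMap, cond_true, cond_false] at b1 b2 b3 b4
      simp only [sub_sub_cancel]
      linarith [b1.2, b2.2]
  choose E hEm hEL hER hEAC hEe using hbr
  have hcd : ∀ F F' : ℝ → ℝ, (∀ x, HasDerivAt F (F' x) x) → Continuous F' → ContDiff ℝ 1 F := by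
    intro F F' h hc
    refine contDiff_one_iff_deriv.2 ⟨fun x => (h x).differentiableAt, ?_⟩
    rwa [show deriv F = F' from funext fun x => (h x).deriv]
  let H : IFS β k :=
    { map := E
      prob := S.prob
      map_mem := fun i => mem_CPlus_of_eqOn (hEm i).monotone (hcd _ _ (hd (i, false)) (hc' _))
        (hcd _ _ (fun x => hasDerivAt_reflect (hd (i, true)) x) ((hc' _).comp (by fun_prop)))
        ((hEL i).mono (Icc_subset_Icc_right haβ.le))
        ((hER i).mono (Icc_subset_Icc_left (by linarith)))
      prob_mem := S.prob_mem }
  have hd0 : ∀ i, endDeriv β (H.map i) 0 = h' (i, false) 0 := fun i =>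
    endDeriv_of_left haβ.le (hd _) (hEL i) ⟨le_rfl, hβ.1.le⟩
  have hd1 : ∀ i, endDeriv β (H.map i) 1 = h' (i, true) 0 := fun i => by
    rw [endDeriv_of_right haβ.le (hd _) (hER i) ⟨by linarith [hβ.1], le_rfl⟩, sub_self]
  have hly := hlyap (fun p => h' p 0) fun p => (hcl p 0 le_rfl).trans hTt.le
  have hle' : ∀ p, ∀ x ∈ Icc 0 x₀, h' p x ≤ S.endSlope p x := fun p x hx =>
    hle p x hx.1 (by linarith [hc1 p x hx])
  have hgt : ∀ b, ∃ j, ∀ x ∈ Icc 0 x₀, 1 < h' (j, b) x := fun b => by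
    obtain ⟨j, hj⟩ := hc2 b
    refine ⟨j, fun x hx => ?_⟩
    have := abs_le.1 (hcl (j, b) x hx.1)
    linarith [hj x hx, this.1]
  have hend : ∀ b, ∀ x ∈ Ioc 0 x₀, (∃ i, S.endMap (i, b) x < x) →
      (∃ i, h (i, b) x < x) ∧ ∃ j, x < h (j, b) x := fun b x hx hSx => by
    obtain ⟨j, hj⟩ := hgt b
    exact S.exists_lt_lt_near_end hx₀.2 hd h0 hle' hj hx hSx
  have hdiag : ∀ x ∈ Ioo (0 : ℝ) 1, (∃ i, ext (E i) x < x) ∧ ∃ j, x < ext (E j) x := by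
    intro x hx
    have hx01 : x ∈ Icc (0 : ℝ) 1 := Ioo_subset_Icc_self hx
    obtain ⟨i, j, hi, hj⟩ := hSa.exists_lt_lt ⟨x, hx01⟩
      ⟨Subtype.mk_lt_mk.2 hx.1, Subtype.mk_lt_mk.2 hx.2⟩
    have hi' : ext (S.map i) x < x := by rw [ext_of_mem _ hx01]; exact hi
    have hj' : x < ext (S.map j) x := by rw [ext_of_mem _ hx01]; exact hj
    -- Near the ends the slopes decide, in the middle the uniform margin; at the right end
    -- reflection exchanges above and below.
    rcases le_total x x₀ with h1 | h1
    · have hE : ∀ i, ext (E i) x = h (i, false) x := fun i =>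
        hEL i ⟨hx.1.le, by linarith [hx₀.2]⟩
      simp only [hE]
      exact hend false x ⟨hx.1, h1⟩ ⟨i, hi'⟩
    rcases le_total x (1 - x₀) with h2 | h2
    · obtain ⟨⟨i, hi⟩, j, hj⟩ := hmar x ⟨h1, h2⟩
      have b1 := abs_le.1 (hEe i x hx01)
      have b2 := abs_le.1 (hEe j x hx01)
      exact ⟨⟨i, by linarith [b1.2]⟩, j, by linarith [b2.1]⟩
    · have hE : ∀ i, ext (E i) x = 1 - h (i, true) (1 - x) := fun i =>
        hER i ⟨by linarith [hx₀.2], hx.2.le⟩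
      simp only [hE]
      obtain ⟨⟨i, hi⟩, j, hj⟩ := hend true (1 - x) ⟨by linarith [hx.2], by linarith⟩
        ⟨j, by simp only [endMap, cond_true, sub_sub_cancel]; linarith⟩
      exact ⟨⟨j, by linarith⟩, i, by linarith⟩
  refine ⟨K, hK, hK0, H, h, h', rfl, ⟨⟨hSa.prob_pos, ?_, ?_, ?_, ?_, ?_⟩, hEAC⟩, hc', hd, h0, hpos,
    fun p x hx => (hcl p x hx).trans hTε.le, hEL, hER, fun i x hx => (hEe i x hx).trans heε.le, hcomp⟩
  · intro x hx
    obtain ⟨⟨i, hi⟩, j, hj⟩ := hdiag x ⟨hx.1, hx.2⟩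
    rw [ext_apply] at hi hj
    exact ⟨i, j, hi, hj⟩
  · exact fun i => by rw [hd0]; exact hpos _ _
  · exact fun i => by rw [hd1]; exact hpos _ _
  · simp only [hd0]
    exact hly false
  · simp only [hd1]
    exact hly true

end IFS

/-! ### Conjugation to systems with nearly singular stationary measures -/

/-- The number r^m Q^N is a positive integer, hence at least 1; so every frequency in the weight is
at least K. -/
theorem le_zpow_mul_of_abs_le {q J N K : ℕ} (hq : 1 ≤ q) {m : ℤ} (hm : |m| ≤ N) :
    (K : ℝ) ≤ (1 + 1 / (q : ℝ)) ^ m * (K * ((q * (q + 1) : ℕ) : ℝ) ^ (J + N)) := by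
  obtain ⟨t, ht⟩ := exists_int_eq_zpow_mul hq hm
  have hQ : (1 : ℝ) ≤ ((q * (q + 1) : ℕ) : ℝ) := by
    exact_mod_cast Nat.mul_pos hq (by omega)
  have hr : (0 : ℝ) < (1 + 1 / (q : ℝ)) ^ m := by positivity
  have ht0 : (0 : ℝ) < t := by rw [← ht]; exact mul_pos hr (by positivity)
  have ht1 : (1 : ℝ) ≤ t := by
    have : 0 < t := by exact_mod_cast ht0
    exact_mod_cast this
  have hJ : (1 : ℝ) ≤ ((q * (q + 1) : ℕ) : ℝ) ^ J := one_le_pow₀ hQ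
  calc (K : ℝ) = K * (1 * 1) := by ring
    _ ≤ K * (((q * (q + 1) : ℕ) : ℝ) ^ J * t) := by gcongr
    _ = _ := by rw [← ht, pow_add]; ring

theorem exists_pow_tail_le {ρ b : ℝ} (hρ : ρ ∈ Ioo (0 : ℝ) 1) (hb : 0 < b) :
    ∃ N : ℕ, (2 * N + 1) ^ 2 * ρ ^ N ≤ b := by
  have h := tendsto_pow_const_mul_const_pow_of_abs_lt_one 2
    (show |ρ| < 1 by rw [abs_of_pos hρ.1]; exact hρ.2)
  obtain ⟨N, hN, hN1⟩ := ((h.eventually_lt_const (show 0 < b / 9 by positivity)).and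
    (eventually_ge_atTop 1)).exists
  refine ⟨N, ?_⟩
  have h1 : (1 : ℝ) ≤ N := by exact_mod_cast hN1
  have h2 : (2 * (N : ℝ) + 1) ^ 2 ≤ 9 * N ^ 2 := by nlinarith
  have h3 : 0 < ρ ^ N := pow_pos hρ.1 N
  nlinarith

theorem abs_div_div_sub_one_le {x y T θ : ℝ} (hx : 0 < x) (hT : 0 < T) (hθ : 0 ≤ θ)
    (h1 : y ≤ (1 + θ) * x) (h2 : x ≤ (1 + θ) * y) : |y / T / (x / T) - 1| ≤ θ := by
  rw [div_div_div_cancel_right₀ hT.ne', div_sub_one hx.ne', abs_div, abs_of_pos hx,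
    div_le_iff₀ hx, abs_le]
  constructor
  · by_contra hlt
    have : y < x := by nlinarith [mul_nonneg hθ hx.le]
    nlinarith [mul_le_mul_of_nonneg_left this.le hθ]
  · linarith

/-- ρ near 1 handles shifts up to J. Then L is a multiple of 2N + 1, which makes δ of order 1/(2N +
1); the tail condition therefore asks for (2N+1)² ρ^N small, and exponential decay provides such an
N. The value of δ is η times the lower bound 1/(16L) for the total weight. -/
theorem exists_weight_parameters (J : ℕ) {θ η : ℝ} (hθ : 0 < θ) (hη : 0 < η) :
    ∃ (ρ δ : ℝ) (N L : ℕ), ρ ∈ Ioo (0 : ℝ) 1 ∧ 1 ≤ (1 + θ) * ρ ^ J ∧ 0 < δ ∧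
      (2 * N + 1) * ρ ^ N ≤ θ * δ * ρ ^ J ∧ 2 ≤ L ∧ (2 * N + 1) / (L : ℝ) ≤ η ∧
      δ = η * (1 / (16 * L)) := by
  have hρ : ∀ᶠ ρ in 𝓝[<] (1 : ℝ), 1 < (1 + θ) * ρ ^ J :=
    nhdsWithin_le_nhds <| (Continuous.continuousAt (x := (1 : ℝ))
      (f := fun ρ : ℝ => (1 + θ) * ρ ^ J) (by fun_prop)).eventually_const_lt (by simpa using hθ)
  obtain ⟨ρ, hρJ, hρ01⟩ := (hρ.and (Ioo_mem_nhdsLT zero_lt_one)).exists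
  obtain ⟨L₀, hL₀⟩ := exists_nat_gt (max 2 (1 / η))
  have hL2 : (2 : ℝ) < L₀ := (le_max_left _ _).trans_lt hL₀
  have hLη : 1 / η < L₀ := (le_max_right _ _).trans_lt hL₀
  have hL₀2 : 2 < L₀ := by exact_mod_cast hL2
  obtain ⟨N, hN⟩ := exists_pow_tail_le hρ01
    (show 0 < θ * (η / (16 * L₀)) * ρ ^ J from mul_pos (by positivity) (pow_pos hρ01.1 J))
  let L : ℕ := (2 * N + 1) * L₀
  have hLe : (L : ℝ) = (2 * N + 1) * L₀ := by simp [L]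
  have hLL : 2 ≤ L := by
    have : 1 * L₀ ≤ (2 * N + 1) * L₀ := Nat.mul_le_mul_right _ (by omega)
    simp only [L]; omega
  have hL0 : (0 : ℝ) < L := by rw [hLe]; positivity
  let δ : ℝ := η / (16 * L)
  have hδ0 : 0 < δ := by positivity
  have htail : (2 * N + 1) * ρ ^ N ≤ θ * δ * ρ ^ J := by
    have h1 : δ = η / (16 * L₀) / (2 * N + 1) := by simp only [δ]; rw [hLe]; field_simp
    rw [h1, mul_div_assoc', div_mul_eq_mul_div, le_div_iff₀ (by positivity)]
    linarith
  refine ⟨ρ, δ, N, L, hρ01, hρJ.le, hδ0, htail, hLL, ?_, ?_⟩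
  · rw [hLe, div_le_iff₀ (by positivity)]
    rw [div_lt_iff₀ hη] at hLη
    have : (0 : ℝ) ≤ 2 * N + 1 := by positivity
    nlinarith
  · simp only [δ]
    ring

/-- A diffeomorphism close to the identity, with derivative almost invariant under compatible
maps, that pushes most of the mass of a given measure to a set of small Lebesgue measure. -/
theorem exists_concentrating_homeomorph {q J : ℕ} (hq : 1 ≤ q) {θ κ η : ℝ} (hθ : 0 < θ)
    (hκ : 0 < κ) (hη : 0 < η) :
    ∃ N K₀ : ℕ, ∀ K : ℕ, K₀ ≤ K → 0 < K → ∀ (μ : Measure I) [IsProbabilityMeasure μ],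
      ∃ (ψ : ℝ ≃ₜ ℝ) (v : ℝ → ℝ) (E : Set I), StrictMono ψ ∧ ψ 0 = 0 ∧ ψ 1 = 1 ∧ Continuous v ∧
        (∀ x, 0 < v x) ∧ (∀ x, HasDerivAt ψ (v x) x) ∧ (∀ x ∈ Icc (0 : ℝ) 1, |ψ x - x| ≤ κ) ∧
        (∀ x y, Compatible (1 + 1 / (q : ℝ)) (K * ((q * (q + 1) : ℕ) : ℝ) ^ (J + N)) N J x y →
          |v y / v x - 1| ≤ θ) ∧
        MeasurableSet E ∧ 1 - η ≤ μ.real E ∧ ∀ x ∈ E, v x ≤ η := by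
  obtain ⟨ρ, δ, N, L, hρ01, hρJ, hδ0, htail, hLL, hLη, hδ⟩ := exists_weight_parameters J hθ hη
  have hL0 : (0 : ℝ) < L := by
    have : 0 < L := by omega
    exact_mod_cast this
  -- For e = (2N+1)/K this yields e ≤ 1/(16L), which keeps the total weight T above 1/(16L), and 2e
  -- ≤ κ/(16L) ≤ κT, which bounds the displacement of ψ by κ.
  obtain ⟨K₀, hK₀⟩ := exists_nat_gt ((2 * N + 1) * (16 * L) * (1 + 2 / κ))
  refine ⟨N, K₀, fun K hK hK0 μ _ => ?_⟩
  set M : ℝ := K * ((q * (q + 1) : ℕ) : ℝ) ^ (J + N) with hM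
  set r : ℝ := 1 + 1 / (q : ℝ) with hr
  have hKr : (0 : ℝ) < K := by exact_mod_cast hK0
  obtain ⟨l, hl, hμ⟩ := exists_arc μ r M N (L := L) (by omega)
  set w := weight δ ρ r M N (arcBump L l) with hw
  have hwc : Continuous w := continuous_weight _ _ _ _ _ _ _
  have hwδ : ∀ x, δ ≤ w x := fun x => (weight_mem hρ01.1 hρ01.2.le x).1
  have hint := abs_integral_weight_sub_le (δ := δ) (L := L) (l := l) (r := r) (M := M)
    hρ01.1 hρ01.2.le hKr (N := N) fun m hm => le_zpow_mul_of_abs_le hq hm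
  set c := δ + (∑ m ∈ Finset.Icc (-N : ℤ) N, ρ ^ m.natAbs) * ∫ y in (0 : ℝ)..1, arcBump L l y
    with hc
  have hcL : 1 / (8 * L) ≤ c := by
    have h1 := le_integral_arcBump hl
    have h2 := (sum_pow_natAbs_mem (N := N) hρ01.1 hρ01.2.le).1
    have h3 : (0 : ℝ) < 1 / (8 * L) := by positivity
    nlinarith
  set T := ∫ u in (0 : ℝ)..1, w u with hT
  have hKK : (2 * N + 1) * (16 * L) * (1 + 2 / κ) ≤ (K : ℝ) :=
    hK₀.le.trans (by exact_mod_cast hK)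
  have hE : (2 * N + 1) / (K : ℝ) * (1 + 2 / κ) ≤ 1 / (16 * L) := by
    rw [div_mul_eq_mul_div, div_le_div_iff₀ hKr (by positivity)]
    linarith
  set e := (2 * N + 1) / (K : ℝ) with he
  have he0 : 0 < e := by positivity
  have hκ2 : 0 < 2 / κ := by positivity
  have he1 : e ≤ 1 / (16 * L) := by nlinarith
  have he2 : 2 * e ≤ κ * (1 / (16 * L)) := by
    have : e * (2 / κ) ≤ 1 / (16 * L) := by nlinarith
    rw [mul_div_assoc', div_le_iff₀ hκ] at this
    linarith
  have h1 := abs_le.1 (hint 1)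
  have hTL : 1 / (16 * L) ≤ T := by
    have : 1 / (8 * (L : ℝ)) = 2 * (1 / (16 * L)) := by field_simp; norm_num
    linarith [h1.1]
  have hT0 : 0 < T := lt_of_lt_of_le (by positivity) hTL
  obtain ⟨ψ, hψ, hψ0, hψ1, hψi, hψd⟩ := exists_homeomorph_of_weight hwc hδ0 hwδ
  have hw0 : ∀ x, 0 < w x := fun x => hδ0.trans_le (hwδ x)
  refine ⟨ψ, fun x => w x / T, {x : I | w x ≤ δ}, hψ, hψ0, hψ1, hwc.div_const _,
    fun x => div_pos (hw0 x) hT0, hψd, fun x hx => ?_, fun x y hxy => ?_, ?_, ?_, fun x hx => ?_⟩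
  · rw [hψi, div_sub' hT0.ne', abs_div, abs_of_pos hT0, div_le_iff₀ hT0]
    have h3 : 2 * e ≤ κ * T := he2.trans (by gcongr)
    have h4 : |(T - c) * x| ≤ e := by
      rw [abs_mul, abs_of_nonneg hx.1]
      have h5 : |T - c| ≤ e := by simpa only [mul_one] using hint 1
      calc |T - c| * x ≤ |T - c| * 1 := by gcongr; exact hx.2
        _ ≤ e := by rwa [mul_one]
    calc |(∫ u in (0 : ℝ)..x, w u) - T * x|
        = |((∫ u in (0 : ℝ)..x, w u) - c * x) - (T - c) * x| := by congr 1; ring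
      _ ≤ e + e := (abs_sub _ _).trans (add_le_add (hint x) h4)
      _ ≤ κ * T := by linarith
  · obtain ⟨e1, e2⟩ := weight_le_of_compatible hδ0 hρ01.1 hρ01.2.le hθ.le hρJ htail hLL hl hxy
    exact abs_div_div_sub_one_le (hw0 x) hT0 hθ.le e1 e2
  · exact measurableSet_le (hwc.comp continuous_subtype_val).measurable measurable_const
  · have hms : MeasurableSet {x : I | w x ≤ δ} :=
      measurableSet_le (hwc.comp continuous_subtype_val).measurable measurable_const
    have hco := probReal_compl_eq_one_sub (μ := μ) hms
    -- Where the weight exceeds δ, some phase meets the chosen arc.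
    have h2 : μ.real {x : I | w x ≤ δ}ᶜ ≤ (2 * N + 1) / L := by
      refine le_trans (measureReal_mono fun x hx => ?_) hμ
      by_contra hne
      simp only [mem_ofPred_eq, not_exists, not_and, not_lt] at hne
      refine hx ?_
      change w x ≤ δ
      rw [hw, weight, add_le_iff_nonpos_right]
      exact Finset.sum_nonpos fun m hm => mul_nonpos_of_nonneg_of_nonpos
        (pow_nonneg hρ01.1.le _) (hne m hm)
    linarith
  · have hx' : w x ≤ δ := hx
    rw [div_le_iff₀ hT0]
    calc w x ≤ η * (1 / (16 * L)) := hx'.trans_eq hδ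
      _ ≤ η * T := by gcongr

namespace IFS

variable {β : Ioo (0 : ℝ) (1 / 2)} {k : ℕ}

theorem isAdmissible_of_conj {S T : IFS β k} (hS : S.IsAdmissible) (hp : T.prob = S.prob)
    {Ψ : I ≃ₜ I} (hΨ : StrictMono Ψ)
    (hT : ∀ i, T.map i = Ψ.symm.trans ((S.map i).trans Ψ))
    (h0 : ∀ i, endDeriv β (T.map i) 0 = endDeriv β (S.map i) 0)
    (h1 : ∀ i, endDeriv β (T.map i) 1 = endDeriv β (S.map i) 1) : T.IsAdmissible := by
  obtain ⟨hΨ0, hΨ1⟩ := homeomorph_fix hΨ.monotone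
  refine ⟨fun i => hp ▸ hS.prob_pos i, fun x hx => ?_, fun i => h0 i ▸ hS.deriv_zero_pos i,
    fun i => h1 i ▸ hS.deriv_one_pos i, ?_, ?_⟩
  · obtain ⟨u, rfl⟩ := Ψ.surjective x
    have hu : u ∈ Ioo (0 : I) 1 := ⟨hΨ.lt_iff_lt.1 (by rw [hΨ0]; exact hx.1),
      hΨ.lt_iff_lt.1 (by rw [hΨ1]; exact hx.2)⟩
    obtain ⟨i, j, hi, hj⟩ := hS.exists_lt_lt u hu
    refine ⟨i, j, ?_, ?_⟩
    · simpa [hT] using hΨ hi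
    · simpa [hT] using hΨ hj
  · simpa only [hp, h0] using hS.lyapunov_zero_pos
  · simpa only [hp, h1] using hS.lyapunov_one_pos

/-- The three errors are the displacement by the outer Ψ, the distance from h to g, and the
displacement by the inner Ψ seen through g. -/
theorem dist_conj_le {g h : I ≃ₜ I} {Ψ : I ≃ₜ I} {κ ε : ℝ} (hκ0 : 0 ≤ κ) (hκ : κ ≤ ε)
    (hΨ : ∀ x, dist (Ψ x) x ≤ κ) (hh : ∀ x, dist (h x) (g x) ≤ ε)
    (hg : ∀ x y, dist x y ≤ κ → dist (g x) (g y) ≤ ε) :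
    dist (Ψ.symm.trans (h.trans Ψ) : C(I, I)) (g : C(I, I)) ≤ 3 * ε := by
  refine (ContinuousMap.dist_le (by linarith)).2 fun y => ?_
  obtain ⟨x, rfl⟩ := Ψ.surjective y
  have e1 := hΨ (h x)
  have e2 := hg x (Ψ x) (by rw [dist_comm]; exact hΨ x)
  have e3 := dist_triangle4 (Ψ (h x)) (h x) (g x) (g (Ψ x))
  have e4 := hh x
  change dist (Ψ (h (Ψ.symm (Ψ x)))) (g (Ψ x)) ≤ 3 * ε
  rw [Homeomorph.symm_apply_apply]
  linarith

theorem d_le {S T : IFS β k} {ε : ℝ} (hε : 0 ≤ ε) (hp : T.prob = S.prob)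
    (h1 : ∀ i, dist (T.map i : C(I, I)) (S.map i : C(I, I)) ≤ ε)
    (h2 : ∀ i, dist ((T.map i).symm : C(I, I)) ((S.map i).symm : C(I, I)) ≤ ε)
    (h3 : ∀ i, ∀ x ∈ endSet (β : ℝ), |endDeriv β (T.map i) x - endDeriv β (S.map i) x| ≤ ε) :
    d T S ≤ k * (3 * ε) := by
  unfold d
  refine (Finset.sum_le_card_nsmul _ _ (3 * ε) fun i _ => ?_).trans (by simp)
  have h4 : (⨆ x : endSet (β : ℝ), |endDeriv β (T.map i) x - endDeriv β (S.map i) x|) ≤ ε :=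
    Real.iSup_le (fun x => h3 i x x.2) hε
  have h5 : |T.prob i - S.prob i| = 0 := by rw [hp]; simp
  linarith [h1 i, h2 i]

theorem abs_mul_sub_le {s ρ u u' C ε θ : ℝ} (hρ : |ρ - 1| ≤ θ) (hs : |s - u| ≤ ε)
    (hu : |u - u'| ≤ ε) (hs0 : 0 ≤ s) (hsC : s ≤ C) (hC : C * θ ≤ ε) : |s * ρ - u'| ≤ 3 * ε := by
  have h1 : |s * (ρ - 1)| ≤ ε := by
    rw [abs_mul, abs_of_nonneg hs0]
    exact (mul_le_mul hsC hρ (abs_nonneg _) (hs0.trans hsC)).trans hC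
  calc |s * ρ - u'| = |s * (ρ - 1) + ((s - u) + (u - u'))| := by congr 1; ring
    _ ≤ |s * (ρ - 1)| + (|s - u| + |u - u'|) :=
      (abs_add_le _ _).trans (by gcongr; exact abs_add_le _ _)
    _ ≤ 3 * ε := by linarith

theorem exists_modulus (S : IFS β k) {ε : ℝ} (hε : 0 < ε) :
    ∃ κ > 0, (∀ i x y, dist x y ≤ κ → dist (S.map i x) (S.map i y) ≤ ε) ∧
      ∀ p x y, |x - y| ≤ κ → |S.endSlope p x - S.endSlope p y| ≤ ε := by
  have h1 : ∀ i, ∀ᶠ κ in 𝓝[>] (0 : ℝ), ∀ x y, dist x y ≤ κ →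
      dist (S.map i x) (S.map i y) ≤ ε := fun i => by
    obtain ⟨δ, hδ, h⟩ := Metric.uniformContinuous_iff.1
      (CompactSpace.uniformContinuous_of_continuous (S.map i).continuous) ε hε
    filter_upwards [nhdsWithin_le_nhds (eventually_lt_nhds hδ)] with κ hκ x y hxy
    exact (h (hxy.trans_lt hκ)).le
  have h2 : ∀ p, ∀ᶠ κ in 𝓝[>] (0 : ℝ), ∀ x y, |x - y| ≤ κ →
      |S.endSlope p x - S.endSlope p y| ≤ ε := fun p => by
    obtain ⟨δ, hδ, h⟩ := Metric.uniformContinuous_iff.1 (S.uniformContinuous_endSlope p) ε hε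
    filter_upwards [nhdsWithin_le_nhds (eventually_lt_nhds hδ)] with κ hκ x y hxy
    exact (h (show dist x y < δ from hxy.trans_lt hκ)).le
  obtain ⟨κ, ⟨a, b⟩, c⟩ :=
    (((eventually_all.2 h1).and (eventually_all.2 h2)).and self_mem_nhdsWithin).exists
  exact ⟨κ, c, a, b⟩

/-- Inversion is continuous, so the inverse terms of the metric follow from uniform closeness of the
maps themselves. -/
theorem exists_symm_tolerance (S : IFS β k) {ε : ℝ} (hε : 0 < ε) :
    ∃ e > 0, 3 * e ≤ ε ∧ ∀ i, ∀ g : I ≃ₜ I, dist (g : C(I, I)) (S.map i : C(I, I)) ≤ 3 * e →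
      dist (g.symm : C(I, I)) ((S.map i).symm : C(I, I)) ≤ ε := by
  have h1 : ∀ i, ∀ᶠ e in 𝓝[>] (0 : ℝ), ∀ g : I ≃ₜ I,
      dist (g : C(I, I)) (S.map i : C(I, I)) ≤ 3 * e →
      dist (g.symm : C(I, I)) ((S.map i).symm : C(I, I)) ≤ ε := fun i => by
    obtain ⟨δ, hδ, h⟩ := exists_dist_symm_lt (S.map i) hε
    filter_upwards [nhdsWithin_le_nhds (eventually_lt_nhds (show 0 < δ / 3 by positivity))]
      with e he g hg
    exact (h g (by linarith)).le
  obtain ⟨e, ⟨a, b⟩, c⟩ := (((eventually_all.2 h1).and (nhdsWithin_le_nhds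
    (eventually_lt_nhds (show 0 < ε / 3 by positivity)))).and self_mem_nhdsWithin).exists
  exact ⟨e, c, by linarith, a⟩

theorem exists_mem_Fn_d_lt {S : IFS β k} (hS : S ∈ admissibleAC β k) {n : ℕ} (hn : 1 ≤ n) {ε : ℝ}
    (hε : 0 < ε) : ∃ T ∈ Fn β k n, d T S < ε := by
  have hβ := β.2
  have hε₂ : 0 < ε / (3 * (k + 1)) := by positivity
  set ε₂ := ε / (3 * ((k : ℝ) + 1)) with hε₂d
  obtain ⟨e, he, heε, hsymm⟩ := S.exists_symm_tolerance hε₂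
  obtain ⟨κ₁, hκ₁, hmodS, hmods⟩ := S.exists_modulus he
  obtain ⟨C, hC0, hC⟩ := S.exists_endSlope_le
  obtain ⟨a, q, J, haβ, ha2, hq, hsys⟩ := exists_compatible_system hS he
  obtain ⟨κ, hκ0, hκ⟩ := exists_between (a₁ := 0) (a₂ := min κ₁ (min e (a - β)))
    (lt_min hκ₁ (lt_min he (by linarith)))
  simp only [lt_min_iff] at hκ
  obtain ⟨hκκ, hκe, hκa⟩ := hκ
  have hn0 : (0 : ℝ) < n := by exact_mod_cast hn
  -- θ is such that the slope bound C + e times θ is e; η lies below both 1/n and 1/(2n).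
  obtain ⟨N, K₀, hconc⟩ := exists_concentrating_homeomorph (J := J) hq
    (θ := e / (C + e)) (by positivity) hκ0 (η := 1 / (4 * n)) (by positivity)
  obtain ⟨K, hK, hK0, H, h, h', hHp, hHad, hc', hd, h0, hpos, hclose, hL, hR, hHS, hcomp⟩ := hsys N K₀
  obtain ⟨μ, ⟨hμp, hμ1⟩, hμ⟩ := hHad.1.exists_invariant
  obtain ⟨ψ, v, E, hψ, hψ0, hψ1, hvc, hv0, hψd, hψκ, hvcomp, hE, hμE, hvE⟩ := hconc K hK hK0 μ
  obtain ⟨T, Ψ, hTp, hΨ, hTΨ, hTAC, hTL, hTR⟩ := H.exists_conj haβ ha2 hHad.2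
    (FL := fun i => h (i, false)) (FR := fun i x => 1 - h (i, true) (1 - x))
    (fun i => hd (i, false)) (fun i => hasDerivAt_reflect (hd (i, true))) (fun i => hc' _)
    (fun i => (hc' _).comp (by fun_prop)) hL hR hψ hψ0 hψ1 hvc hv0 hψd hψκ (by linarith)
  have hΨm : StrictMono Ψ := fun x y hxy => by
    rw [← Subtype.coe_lt_coe, hΨ, hΨ]
    exact hψ hxy
  -- At a fixed point the factor v(h x) / v(x) is 1, so the conjugation leaves the slopes, and with
  -- them the exponents, unchanged.
  have hT0 : ∀ i, endDeriv β (T.map i) 0 = endDeriv β (H.map i) 0 := fun i => by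
    obtain ⟨x, -, hx, hTx⟩ := hTL i 0 ⟨le_rfl, hβ.1.le⟩
    have hx0 : x = 0 := hψ.injective (hx.trans hψ0.symm)
    rw [hTx, endDeriv_of_left haβ.le (hd (i, false)) (hL i) ⟨le_rfl, hβ.1.le⟩, hx0, h0,
      div_self (hv0 0).ne', mul_one]
  have hT1 : ∀ i, endDeriv β (T.map i) 1 = endDeriv β (H.map i) 1 := fun i => by
    obtain ⟨x, -, hx, hTx⟩ := hTR i 1 ⟨by linarith [hβ.1], le_rfl⟩
    have hx1 : x = 1 := hψ.injective (hx.trans hψ1.symm)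
    rw [hTx, endDeriv_of_right haβ.le (hd (i, true)) (hR i) ⟨by linarith [hβ.1], le_rfl⟩, hx1]
    simp only [sub_self, h0, sub_zero]
    rw [div_self (hv0 1).ne', mul_one]
  have hslope : ∀ p x, 0 ≤ x → h' p x ≤ C + e := fun p x hx => by
    linarith [(abs_le.1 (hclose p x hx)).2, (hC p x).2]
  have hCe : (C + e) * (e / (C + e)) ≤ e := (mul_div_cancel₀ e (by positivity)).le
  have hdist : ∀ i, dist (T.map i : C(I, I)) (S.map i : C(I, I)) ≤ 3 * e := fun i => by
    rw [hTΨ]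
    refine dist_conj_le hκ0.le hκe.le (fun x => ?_) (fun x => ?_)
      fun x y hxy => hmodS i x y (hxy.trans hκκ.le)
    · rw [Subtype.dist_eq, Real.dist_eq, hΨ]
      exact hψκ x x.2
    · have := hHS i x x.2
      rwa [ext_apply, ext_apply] at this
  have hderiv : ∀ i, ∀ y ∈ endSet (β : ℝ),
      |endDeriv β (T.map i) y - endDeriv β (S.map i) y| ≤ 3 * e := by
    rintro i y (hy | hy)
    · obtain ⟨x, hx, rfl, hTx⟩ := hTL i y hy
      have h1 : S.endSlope (i, false) (ψ x) = endDeriv β (S.map i) (ψ x) := by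
        simp [endSlope, projIcc_of_mem _ hy]
      rw [hTx, ← h1]
      refine abs_mul_sub_le (hvcomp _ _ (hcomp (i, false) x hx.1)) (hclose _ x hx.1)
        (hmods _ _ _ ?_) (hpos _ _).le (hslope _ _ hx.1) hCe
      rw [abs_sub_comm]
      exact (hψκ x ⟨hx.1, by linarith [hx.2]⟩).trans hκκ.le
    · obtain ⟨x, hx, rfl, hTx⟩ := hTR i y hy
      have h1 : S.endSlope (i, true) (1 - ψ x) = endDeriv β (S.map i) (ψ x) := by
        simp [endSlope, projIcc_of_mem _ (show 1 - ψ x ∈ Icc (0 : ℝ) β from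
          ⟨by linarith [hy.2], by linarith [hy.1]⟩)]
      have hx0 : 0 ≤ 1 - x := by linarith [hx.2]
      -- The branch at the right end is the reflection of `h (i, true)`, while the density v lives
      -- in the unreflected coordinate.
      have hxc := (hcomp (i, true) (1 - x) hx0).reflect hq
      rw [sub_sub_cancel] at hxc
      rw [hTx, ← h1]
      refine abs_mul_sub_le (hvcomp _ _ hxc) (hclose _ _ hx0)
        (hmods _ _ _ ?_) (hpos _ _).le (hslope _ _ hx0) hCe
      rw [show 1 - x - (1 - ψ x) = ψ x - x by ring]
      exact (hψκ x ⟨by linarith [hx.1], hx.2⟩).trans hκκ.le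
  have hTad : T ∈ admissibleAC β k := ⟨isAdmissible_of_conj hHad.1 hTp hΨm hTΨ hT0 hT1, hTAC⟩
  have hprob : IsProbabilityMeasure (μ.map Ψ) :=
    Measure.isProbabilityMeasure_map Ψ.continuous.aemeasurable
  have hη1 : 1 / (4 * (n : ℝ)) < 1 / n := one_div_lt_one_div_of_lt hn0 (by linarith)
  have hη2 : 1 / (4 * (n : ℝ)) < 1 / n / 2 := by
    rw [div_div]
    exact one_div_lt_one_div_of_lt (by positivity) (by linarith)
  refine ⟨T, ⟨hTad, μ.map Ψ, ⟨⟨hprob, ?_⟩, hprob, Ψ '' E, ?_, ?_, ?_⟩, ?_⟩, ?_⟩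
  · rw [Measure.map_apply Ψ.measurable measurableSet_Ioo]
    convert! hμ1
    ext x
    obtain ⟨hΨ0, hΨ1⟩ := homeomorph_fix hΨm.monotone
    constructor
    · rintro ⟨h1, h2⟩
      exact ⟨hΨm.lt_iff_lt.1 (by rwa [hΨ0]), hΨm.lt_iff_lt.1 (by rwa [hΨ1])⟩
    · rintro ⟨h1, h2⟩
      exact ⟨by have := hΨm h1; rwa [hΨ0] at this, by have := hΨm h2; rwa [hΨ1] at this⟩
  · exact Ψ.measurableEmbedding.measurableSet_image.2 hE
  · exact (volume_image_le hΨ hψ.injective hψd hv0 (by positivity) hE hvE).trans_lt hη1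
  · rw [measureReal_def, Ψ.measurableEmbedding.map_apply, preimage_image_eq _ Ψ.injective,
      ← measureReal_def]
    linarith
  · exact H.markov_conj T hTp Ψ hTΨ hμ
  · refine (d_le hε₂.le (hTp.trans hHp) (fun i => (hdist i).trans heε)
      (fun i => hsymm i _ (hdist i)) fun i y hy => (hderiv i y hy).trans heε).trans_lt ?_
    rw [hε₂d, show (k : ℝ) * (3 * (ε / (3 * (k + 1)))) = k * ε / (k + 1) by field_simp,
      div_lt_iff₀ (by positivity)]
    nlinarith

end IFS
end IntervalIFS
end

theorem mainTheorem3 (β : Set.Ioo (0 : ℝ) (1 / 2)) (k n : ℕ) (hn : 1 ≤ n) :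
    Dense {S : IntervalIFS.admissibleAC β k |
      (S : IntervalIFS.IFS β k) ∈ IntervalIFS.Fn β k n} := by
  refine Metric.dense_iff.2 fun S ε hε => ?_
  obtain ⟨T, hT, hd⟩ := IntervalIFS.IFS.exists_mem_Fn_d_lt S.2 hn hε
  exact ⟨⟨T, hT.1⟩, hd, hT⟩
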